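/- Notation. Let $\mathbb D$ be the open unit disk in $\mathbb C$ and $dA$ the area measure on $\mathbb D$ normalized so that $A(\mathbb D)=1$. For $\alpha>-1$ put $\omega_\alpha(z)=(1+\alpha)(1-|z|^2)^\alpha$; for $0<p<\infty$ let $L^p_a(\omega_\alpha)$ be the space of analytic functions $f$ on $\mathbb D$ with $\|f\|_{L^p(\omega_\alpha)}=\big(\int_{\mathbb D}|f|^p\omega_\alpha\,dA\big)^{1/p}<\infty$. For a finite positive Borel measure $\mu$ on $\mathbb D$ and $\gamma>-1$ let $$T_{\mu,\gamma}(f)(z)=\int_{\mathbb D}\frac{f(w)}{(1-z\bar w)^{2+\gamma}}\,d\mu(w),\qquad z\in\mathbb D,$$ with the principal branch of the power. The operator $T_{\mu,\beta}:L^p_a(\omega_\alpha)\to L^1_a(\omega_\beta)$ is called bounded if there is a finite constant $C$ such that, for every polynomial $f$, $T_{\mu,\beta}(f)\in L^1_a(\omega_\beta)$ and $\|T_{\mu,\beta}(f)\|_{L^1(\omega_\beta)}\le C\|f\|_{L^p(\omega_\alpha)}$. The measure $\mu$ is a $q$-Carleson measure for $L^1_a(\omega_\alpha)$ if there is a constant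 $C>0$ such that $\big(\int_{\mathbb D}|f|^q\,d\mu\big)^{1/q}\le C\|f\|_{L^1(\omega_\alpha)}$ for all $f\in L^1_a(\omega_\alpha)$. The logarithmic Bloch space $\mathcal{LB}^1$ consists of the analytic functions $f$ on $\mathbb D$ with $$|f(0)|+\sup_{z\in\mathbb D}(1-|z|^2)\Big(\log\frac{2}{1-|z|^2}\Big)|f'(z)|<\infty.$$ Theorem. Let $\mu$ be a finite positive Borel measure on $\mathbb D$, let $0<p\le1$ and $-1<\alpha,\beta<\infty$. Then $T_{\mu,\beta}:L^p_a(\omega_\alpha)\to L^1_a(\omega_\beta)$ is bounded if and only if $\mu$ is a $\frac1p$-Carleson measure for $L^1_a(\omega_\alpha)$ and $T_{\mu,\frac{2+\alpha}{p}-2}(1)\in\mathcal{LB}^1$. -/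

import Mathlib

namespace BergmanToeplitz

open MeasureTheory
open scoped ENNReal NNReal ComplexConjugate

/-- The open unit disk `𝔻` in `ℂ`. -/
abbrev unitDisk : Set ℂ := Metric.ball (0 : ℂ) 1

/-- The standard weight `ω_α(z) = (1 + α) (1 - |z|²)^α`. -/
noncomputable def weight (α : ℝ) (z : ℂ) : ℝ := (1 + α) * (1 - ‖z‖ ^ 2) ^ α

/-- The measure `ω_α dA` on `𝔻`, where `dA` is Lebesgue measure divided by `π`
(so that `𝔻` has area one). -/
noncomputable def weightedArea (α : ℝ) : Measure ℂ :=
  (volume.restrict unitDisk).withDensity fun z => ENNReal.ofReal (weight α z / Real.pi)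

/-- The (quasi-)norm `‖f‖_{L^p(ω_α)} = (∫_𝔻 |f|^p ω_α dA)^{1/p}` in `[0, ∞]`, for `0 < p < ∞`. -/
noncomputable def bergmanNorm (p α : ℝ) (f : ℂ → ℂ) : ℝ≥0∞ :=
  eLpNorm f (ENNReal.ofReal p) (weightedArea α)

/-- Membership in the weighted Bergman space `L^p_a(ω_α)`. Only the values of `f` on `𝔻` matter. -/
def MemBergman (p α : ℝ) (f : ℂ → ℂ) : Prop :=
  DifferentiableOn ℂ f unitDisk ∧ bergmanNorm p α f < ∞

/-- The Toeplitz operator `T_{μ,α} f (z) = ∫ f(w) / (1 - z w̄)^{2+α} dμ(w)`, for a measure `μ`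
concentrated on `𝔻`. Since `Re (1 - z w̄) > 0` for `z, w ∈ 𝔻`, the power is the principal one. -/
noncomputable def toeplitz (μ : Measure ℂ) (α : ℝ) (f : ℂ → ℂ) (z : ℂ) : ℂ :=
  ∫ w, f w / (1 - z * conj w) ^ ((2 + α : ℝ) : ℂ) ∂μ

/-- Boundedness of `T_{μ,β} : L^p_a(ω_α) → L^q_a(ω_γ)`: the norm inequality holds for all
polynomials, with one finite constant. -/
def ToeplitzBounded (μ : Measure ℂ) (β p α q γ : ℝ) : Prop :=
  ∃ C : ℝ≥0, ∀ f : Polynomial ℂ,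
    MemBergman q γ (toeplitz μ β fun w => f.eval w) ∧
      bergmanNorm q γ (toeplitz μ β fun w => f.eval w) ≤ C * bergmanNorm p α fun w => f.eval w

/-- `μ` (a measure concentrated on `𝔻`) is a `q`-Carleson measure for `L^p_a(ω_α)`. -/
def IsCarleson (μ : Measure ℂ) (q p α : ℝ) : Prop :=
  ∃ C : ℝ≥0, 0 < C ∧ ∀ f : ℂ → ℂ, MemBergman p α f →
    eLpNorm f (ENNReal.ofReal q) μ ≤ C * bergmanNorm p α f

/-- Membership in the logarithmic Bloch space `LB^a`: `f` is analytic on `𝔻` and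
`sup_{z ∈ 𝔻} (1 - |z|²)^a log (2 / (1 - |z|²)) |f'(z)|` is finite. -/
def MemLogBloch (a : ℝ) (f : ℂ → ℂ) : Prop :=
  DifferentiableOn ℂ f unitDisk ∧
    BddAbove ((fun z : ℂ =>
      (1 - ‖z‖ ^ 2) ^ a * Real.log (2 / (1 - ‖z‖ ^ 2)) * ‖deriv f z‖) '' unitDisk)

end BergmanToeplitz

namespace BergmanToeplitz

open MeasureTheory Filter Topology
open scoped ENNReal NNReal ComplexConjugate

/-! Put s = (2+α)/p, so s > 1, and write d(z) = 1-|z|². The proof rests on a duality. Pairing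
T_{μ,β}f, dilated by r < 1, with a measurable φ, |φ| ≤ 1, in L²(ω_β) gives by Fubini the integral ∫
f(w) conj(g(w)) dμ(w), where g(w) = Pφ(rw) and P is the Bergman projection up to a constant
(`integral_mul_toeplitz`). Such g are Bloch functions with bounds independent of φ and r
(`exists_bloch_bound_dilate`). Choosing φ as the sign of the dilated T_{μ,β}f recovers its L¹ norm,
so boundedness of the operator amounts to bounding these pairings by ‖f‖_{L^p(ω_α)}.

Sufficiency. Expand f by the reproducing formula with weight ω_{s-1}. The pairing becomes an
integral of f(a) against the conjugate of ∫ g(w)(1-a w̄)^{-(s+1)} dμ(w), and the point is that this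
is O(1/d(a)) (`exists_norm_integral_bloch_le`). Write g = (g-g(a)) + g(a). The oscillation term is
controlled by the Carleson condition, since g-g(a) grows only logarithmically in the hyperbolic
distance (`exists_lintegral_bloch_le`). The value g(a) is O(log(2/d(a))), and the logarithmic Bloch
condition gains exactly this factor, because the derivative of T_{μ,s-2}(1) is essentially ∫ (1-a
w̄)^{-(s+1)} dμ(w). What remains is ∫|f| ω_{s-2} dA, bounded by ‖f‖_{L^p(ω_α)} because p ≤ 1
(`lintegral_le_bergmanNorm`). Fatou's lemma then lets r → 1.

Necessity. Dilations are uniformly bounded on L¹_a(ω_β), so boundedness gives the pairing estimate,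
first for polynomials and then for functions analytic across the circle. If f and φ are both
multiples of the kernel k(w) = (1-w b̄)^{-(s+1)}, then Pφ is a multiple of k and the pairing
controls ∫|k|² dμ. This kernel estimate implies the Carleson embedding
(`isCarleson_of_lintegral_absKernel_le`). For the logarithmic condition take f(w) = w(1-w
z̄)^{-(s+1)} and choose φ so that g(z) = ∫|1-rz ū|^{-(2+β)} ω_β(u) dA(u), which grows like
log(1/(1-r|z|)). Replacing g by g(z) in the pairing costs only the oscillation term, already
controlled, and leaves the logarithm times the derivative of T_{μ,s-2}(1). -/

/-- The quantity `1 - |z|²`. -/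
noncomputable def defect (z : ℂ) : ℝ := 1 - ‖z‖ ^ 2

/-- The Bergman-type kernel `1 / (1 - z w̄)^b`. -/
noncomputable def kern (b : ℝ) (z w : ℂ) : ℂ := 1 / (1 - z * conj w) ^ (b : ℂ)

/-- The modulus of `kern`, as an extended nonnegative real. -/
noncomputable def absKernel (b : ℝ) (z w : ℂ) : ℝ≥0∞ := ENNReal.ofReal (‖1 - z * conj w‖ ^ (-b))

/-! ### Elementary bounds for 1 - z w̄ and the kernels -/

lemma mem_unitDisk {z : ℂ} : z ∈ unitDisk ↔ ‖z‖ < 1 := by simp [unitDisk]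

lemma defect_pos {z : ℂ} (hz : z ∈ unitDisk) : 0 < defect z := by
  have := mem_unitDisk.1 hz
  have h0 := norm_nonneg z
  unfold defect; nlinarith

lemma defect_le_one (z : ℂ) : defect z ≤ 1 := by
  unfold defect; nlinarith [sq_nonneg ‖z‖]

lemma one_sub_norm_le_defect {z : ℂ} (hz : z ∈ unitDisk) : 1 - ‖z‖ ≤ defect z := by
  have := mem_unitDisk.1 hz
  have h0 := norm_nonneg z
  unfold defect; nlinarith

lemma defect_le_two_mul {z : ℂ} (hz : z ∈ unitDisk) : defect z ≤ 2 * (1 - ‖z‖) := by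
  have := mem_unitDisk.1 hz
  have h0 := norm_nonneg z
  unfold defect; nlinarith

lemma continuous_defect : Continuous defect := by unfold defect; fun_prop

lemma norm_one_sub_mul_conj_comm (z w : ℂ) : ‖1 - z * conj w‖ = ‖1 - w * conj z‖ := by
  rw [← Complex.norm_conj]; simp [mul_comm]

lemma absKernel_comm (b : ℝ) (z w : ℂ) : absKernel b z w = absKernel b w z := by
  unfold absKernel; rw [norm_one_sub_mul_conj_comm]

lemma norm_mul_conj (z w : ℂ) : ‖z * conj w‖ = ‖z‖ * ‖w‖ := by simp

lemma one_sub_norm_le_norm {z w : ℂ} (hw : ‖w‖ ≤ 1) :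
    1 - ‖z‖ ≤ ‖1 - z * conj w‖ := by
  have h := norm_sub_norm_le (1 : ℂ) (z * conj w)
  rw [norm_mul_conj, norm_one] at h
  nlinarith [norm_nonneg z]

lemma norm_one_sub_le_two {z w : ℂ} (hz : z ∈ unitDisk) (hw : w ∈ unitDisk) :
    ‖1 - z * conj w‖ ≤ 2 := by
  have h := norm_sub_le (1 : ℂ) (z * conj w)
  rw [norm_mul_conj, norm_one] at h
  nlinarith [mem_unitDisk.1 hz, mem_unitDisk.1 hw, norm_nonneg z, norm_nonneg w]

lemma defect_le_norm {z w : ℂ} (hz : z ∈ unitDisk) (hw : w ∈ unitDisk) :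
    defect z ≤ 2 * ‖1 - z * conj w‖ :=
  (defect_le_two_mul hz).trans
    (by linarith [one_sub_norm_le_norm (z := z) (mem_unitDisk.1 hw).le])

lemma norm_one_sub_pos {z w : ℂ} (hz : z ∈ unitDisk) (hw : w ∈ unitDisk) :
    0 < ‖1 - z * conj w‖ := by
  linarith [one_sub_norm_le_norm (z := z) (mem_unitDisk.1 hw).le, mem_unitDisk.1 hz]

lemma one_sub_mem_slitPlane {x : ℂ} (hx : ‖x‖ < 1) : 1 - x ∈ Complex.slitPlane := by
  left
  have := Complex.re_le_norm x
  simp; linarith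

lemma norm_mul_conj_lt_one {z w : ℂ} (hz : z ∈ unitDisk) (hw : w ∈ unitDisk) :
    ‖z * conj w‖ < 1 := by
  rw [norm_mul_conj]
  nlinarith [mem_unitDisk.1 hz, mem_unitDisk.1 hw, norm_nonneg z, norm_nonneg w]

lemma one_sub_mul_conj_mem_slitPlane {z w : ℂ} (hz : z ∈ unitDisk) (hw : w ∈ unitDisk) :
    1 - z * conj w ∈ Complex.slitPlane := one_sub_mem_slitPlane (norm_mul_conj_lt_one hz hw)

lemma norm_kern (b : ℝ) (z w : ℂ) : ‖kern b z w‖ = ‖1 - z * conj w‖ ^ (-b) := by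
  unfold kern
  rw [norm_div, norm_one, Complex.norm_cpow_real, Real.rpow_neg (norm_nonneg _), one_div]

lemma enorm_kern (b : ℝ) (z w : ℂ) : ‖kern b z w‖ₑ = absKernel b z w := by
  rw [← ofReal_norm, norm_kern, absKernel]

lemma conj_kern (b : ℝ) {z w : ℂ} (hz : z ∈ unitDisk) (hw : w ∈ unitDisk) :
    conj (kern b z w) = kern b w z := by
  unfold kern
  rw [map_div₀, map_one]
  have h := Complex.conj_cpow (1 - z * conj w) (b : ℂ)
    (Complex.slitPlane_arg_ne_pi (one_sub_mul_conj_mem_slitPlane hz hw))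
  rw [Complex.conj_ofReal] at h
  rw [← h]; simp [mul_comm]

lemma measurable_absKernel (b : ℝ) (z : ℂ) : Measurable (absKernel b z) := by
  unfold absKernel; fun_prop

/-! ### The weighted area measure: change of weight, rotations, polar coordinates -/

lemma weight_eq (γ : ℝ) (z : ℂ) : weight γ z = (1 + γ) * defect z ^ γ := rfl

lemma measurable_weight (γ : ℝ) : Measurable (weight γ) := by
  unfold weight; fun_prop

lemma lintegral_weightedArea (γ : ℝ) (F : ℂ → ℝ≥0∞) :
    ∫⁻ z, F z ∂weightedArea γ =
      ∫⁻ z in unitDisk, ENNReal.ofReal (weight γ z / Real.pi) * F z := by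
  unfold weightedArea
  rw [lintegral_withDensity_eq_lintegral_mul_non_measurable _
    ((measurable_weight γ).div_const _).ennreal_ofReal (by simp)]
  rfl

lemma ae_mem_unitDisk (γ : ℝ) : ∀ᵐ z ∂weightedArea γ, z ∈ unitDisk := by
  unfold weightedArea
  exact (withDensity_absolutelyContinuous _ _).ae_le
    (ae_restrict_mem Metric.isOpen_ball.measurableSet)

lemma lintegral_mono_weightedArea {γ : ℝ} {F G : ℂ → ℝ≥0∞} (h : ∀ z ∈ unitDisk, F z ≤ G z) :
    ∫⁻ z, F z ∂weightedArea γ ≤ ∫⁻ z, G z ∂weightedArea γ :=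
  lintegral_mono_ae ((ae_mem_unitDisk γ).mono h)

lemma lintegral_congr_weightedArea {γ : ℝ} {F G : ℂ → ℝ≥0∞} (h : ∀ z ∈ unitDisk, F z = G z) :
    ∫⁻ z, F z ∂weightedArea γ = ∫⁻ z, G z ∂weightedArea γ :=
  lintegral_congr_ae ((ae_mem_unitDisk γ).mono h)

/-- Change of weight. -/
lemma lintegral_weightedArea_change {γ γ' : ℝ} (hγ : -1 < γ) (hγ' : -1 < γ') (F : ℂ → ℝ≥0∞) :
    ∫⁻ z, F z ∂weightedArea γ' =
      ENNReal.ofReal ((1 + γ') / (1 + γ)) *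
        ∫⁻ z, ENNReal.ofReal (defect z ^ (γ' - γ)) * F z ∂weightedArea γ := by
  rw [lintegral_weightedArea, lintegral_weightedArea, ← lintegral_const_mul' _ _ (by simp)]
  refine setLIntegral_congr_fun Metric.isOpen_ball.measurableSet fun z hz => ?_
  have hd := defect_pos hz
  have hγ0 : 0 < 1 + γ := by linarith
  have hγ0' : 0 < 1 + γ' := by linarith
  simp only [weight_eq]
  rw [← mul_assoc, ← mul_assoc, ← ENNReal.ofReal_mul (by positivity),
    ← ENNReal.ofReal_mul (by positivity)]
  congr 2
  rw [Real.rpow_sub hd]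
  have := (Real.rpow_pos_of_pos hd γ).ne'
  have := Real.pi_pos.ne'
  field_simp

lemma map_mul_weightedArea (γ : ℝ) {c : ℂ} (hc : ‖c‖ = 1) :
    MeasurePreserving (fun z => c * z) (weightedArea γ) (weightedArea γ) := by
  have hm : Measurable fun z : ℂ => c * z := by fun_prop
  refine ⟨hm, ?_⟩
  let e := rotation ⟨c, mem_sphere_zero_iff_norm.2 hc⟩
  have hfun : ⇑e = fun z => c * z := funext fun z => rotation_apply _ _
  have hp : MeasurePreserving (fun z : ℂ => c * z) volume volume := by
    rw [← hfun]; exact e.measurePreserving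
  have hemb : MeasurableEmbedding (fun z : ℂ => c * z) := by
    rw [← hfun]; exact e.toHomeomorph.measurableEmbedding
  have hw : ∀ z, weight γ (c * z) = weight γ z := by
    intro z; simp [weight, hc]
  have hpre : Set.preimage (fun z : ℂ => c * z) unitDisk = unitDisk := by
    ext z; simp [hc]
  refine Measure.ext_of_lintegral _ fun f hf => ?_
  rw [lintegral_map hf hm, lintegral_weightedArea, lintegral_weightedArea]
  have := hp.setLIntegral_comp_preimage_emb hemb
    (fun z => ENNReal.ofReal (weight γ z / Real.pi) * f z) unitDisk
  rw [hpre] at this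
  simpa [hw] using this

lemma setLIntegral_unitDisk_polar {F : ℂ → ℝ≥0∞} (hF : Measurable F) :
    ∫⁻ z in unitDisk, F z = ∫⁻ r in Set.Ioo (0 : ℝ) 1, ∫⁻ θ in Set.Ioo (-Real.pi) Real.pi,
      ENNReal.ofReal r * F (r * (Real.cos θ + Real.sin θ * Complex.I)) := by
  have hmD : MeasurableSet unitDisk := Metric.isOpen_ball.measurableSet
  rw [← lintegral_indicator hmD, ← Complex.lintegral_comp_polarCoord_symm]
  have hn : ∀ p : ℝ × ℝ, ‖Complex.polarCoord.symm p‖ = |p.1| := Complex.norm_polarCoord_symm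
  have h1 : ∀ p ∈ polarCoord.target,
      ENNReal.ofReal p.1 • unitDisk.indicator F (Complex.polarCoord.symm p) =
      (Set.Ioo (0 : ℝ) 1 ×ˢ Set.Ioo (-Real.pi) Real.pi).indicator
        (fun p => ENNReal.ofReal p.1 * F (p.1 * (Real.cos p.2 + Real.sin p.2 * Complex.I))) p := by
    intro p hp
    have hp' : 0 < p.1 ∧ p.2 ∈ Set.Ioo (-Real.pi) Real.pi := hp
    by_cases h : p.1 < 1
    · rw [Set.indicator_of_mem, Set.indicator_of_mem, Complex.polarCoord_symm_apply, smul_eq_mul]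
      · exact ⟨⟨hp'.1, h⟩, hp'.2⟩
      · rw [mem_unitDisk, hn, abs_of_pos hp'.1]; exact h
    · rw [Set.indicator_of_notMem, Set.indicator_of_notMem, smul_zero]
      · exact fun h' => h h'.1.2
      · rw [mem_unitDisk, hn, abs_of_pos hp'.1]; exact h
  have hsub : Set.Ioo (0 : ℝ) 1 ×ˢ Set.Ioo (-Real.pi) Real.pi ⊆ polarCoord.target :=
    fun p hp => ⟨hp.1.1, hp.2⟩
  have hms : MeasurableSet (Set.Ioo (0 : ℝ) 1 ×ˢ Set.Ioo (-Real.pi) Real.pi) :=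
    measurableSet_Ioo.prod measurableSet_Ioo
  rw [setLIntegral_congr_fun polarCoord.open_target.measurableSet h1,
    setLIntegral_indicator hms, Set.inter_eq_left.2 hsub, Measure.volume_eq_prod,
    ← Measure.prod_restrict, lintegral_prod]
  refine Measurable.aemeasurable ?_
  refine Measurable.mul (by fun_prop) (hF.comp (by fun_prop))

/-! ### Forelli–Rudin integrals -/

/-- The one-dimensional estimate behind the Forelli–Rudin bounds. -/
lemma lintegral_Ioi_rpow_mul_rpow_le {κ τ : ℝ} (hκ : -1 < κ) (hτ : 0 < τ) {d : ℝ} (hd : 0 < d) :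
    ∫⁻ y in Set.Ioi (0 : ℝ), ENNReal.ofReal (y ^ κ * (d + y) ^ (-(1 + κ + τ))) ≤
      ENNReal.ofReal ((1 / (κ + 1) + 1 / τ) * d ^ (-τ)) := by
  -- Below d use d + y ≥ d, where κ > -1 gives integrability at 0; above d use d + y ≥ y, where τ >
  -- 0 gives integrability at infinity.
  have hsplit : Set.Ioi (0 : ℝ) = Set.Ioc 0 d ∪ Set.Ioi d := (Set.Ioc_union_Ioi_eq_Ioi hd.le).symm
  rw [hsplit]
  refine (lintegral_union_le _ _ _).trans ?_
  have hA : ∫⁻ y in Set.Ioc (0 : ℝ) d, ENNReal.ofReal (y ^ κ * (d + y) ^ (-(1 + κ + τ))) ≤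
      ENNReal.ofReal (1 / (κ + 1) * d ^ (-τ)) := by
    calc _ ≤ ∫⁻ y in Set.Ioc (0 : ℝ) d, ENNReal.ofReal (y ^ κ * d ^ (-(1 + κ + τ))) := by
          refine setLIntegral_mono' measurableSet_Ioc fun y hy => ?_
          refine ENNReal.ofReal_le_ofReal ?_
          refine mul_le_mul_of_nonneg_left ?_ (Real.rpow_nonneg hy.1.le _)
          exact Real.rpow_le_rpow_of_nonpos hd (by linarith [hy.1]) (by linarith)
      _ = ENNReal.ofReal (∫ y in Set.Ioc (0 : ℝ) d, y ^ κ * d ^ (-(1 + κ + τ))) := by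
          rw [ofReal_integral_eq_lintegral_ofReal]
          · refine Integrable.mul_const ?_ _
            have := (intervalIntegral.intervalIntegrable_rpow' (a := 0) (b := d) hκ)
            rwa [intervalIntegrable_iff_integrableOn_Ioc_of_le hd.le] at this
          · refine (ae_restrict_iff' measurableSet_Ioc).2 (ae_of_all _ fun y hy => ?_)
            have := hy.1
            simp only [Pi.zero_apply]; positivity
      _ = _ := by
          congr 1
          rw [← intervalIntegral.integral_of_le hd.le, intervalIntegral.integral_mul_const,
            integral_rpow (Or.inl hκ), Real.zero_rpow (by linarith), sub_zero, div_mul_eq_mul_div,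
            ← Real.rpow_add hd]
          rw [show κ + 1 + -(1 + κ + τ) = -τ by ring]; ring
  have hB : ∫⁻ y in Set.Ioi d, ENNReal.ofReal (y ^ κ * (d + y) ^ (-(1 + κ + τ))) ≤
      ENNReal.ofReal (1 / τ * d ^ (-τ)) := by
    calc _ ≤ ∫⁻ y in Set.Ioi d, ENNReal.ofReal (y ^ (-1 - τ)) := by
          refine setLIntegral_mono' measurableSet_Ioi fun y hy => ?_
          refine ENNReal.ofReal_le_ofReal ?_
          have hy0 : 0 < y := hd.trans hy
          calc y ^ κ * (d + y) ^ (-(1 + κ + τ)) ≤ y ^ κ * y ^ (-(1 + κ + τ)) := by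
                refine mul_le_mul_of_nonneg_left ?_ (Real.rpow_nonneg hy0.le _)
                exact Real.rpow_le_rpow_of_nonpos hy0 (by linarith) (by linarith)
            _ = _ := by rw [← Real.rpow_add hy0]; congr 1; ring
      _ = ENNReal.ofReal (∫ y in Set.Ioi d, y ^ (-1 - τ)) := by
          rw [ofReal_integral_eq_lintegral_ofReal]
          · exact integrableOn_Ioi_rpow_of_lt (by linarith) hd
          · refine (ae_restrict_iff' measurableSet_Ioi).2 (ae_of_all _ fun y hy => ?_)
            have : 0 < y := hd.trans hy
            simp only [Pi.zero_apply]; positivity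
      _ = _ := by
          congr 1
          rw [integral_Ioi_rpow_of_lt (by linarith) hd, show -1 - τ + 1 = -τ by ring]
          field_simp
  refine (add_le_add hA hB).trans ?_
  have : 0 < κ + 1 := by linarith
  rw [← ENNReal.ofReal_add (by positivity) (by positivity)]
  exact le_of_eq (by congr 1; ring)

lemma lintegral_comp_abs_le {f : ℝ → ℝ≥0∞} (hf : Measurable f) :
    ∫⁻ θ, f |θ| ≤ 2 * ∫⁻ y in Set.Ioi (0 : ℝ), f y := by
  have hae : ∀ᵐ θ : ℝ, f |θ| ≤ (Set.Ioi (0 : ℝ)).indicator f (-θ) +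
      (Set.Ioi (0 : ℝ)).indicator f θ := by
    have h0 : ∀ᵐ θ : ℝ, θ ≠ 0 := by simp [ae_iff]
    filter_upwards [h0] with θ hθ
    rcases lt_or_gt_of_ne hθ with h | h
    · rw [abs_of_neg h, Set.indicator_of_mem (by simpa using h)]
      exact le_self_add
    · rw [abs_of_pos h, Set.indicator_of_mem (s := Set.Ioi (0 : ℝ)) (a := θ) h]
      exact le_add_self
  have hneg := lintegral_sub_left_eq_self (μ := (volume : Measure ℝ))
    ((Set.Ioi (0 : ℝ)).indicator f) 0
  simp only [zero_sub] at hneg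
  refine (lintegral_mono_ae hae).trans ?_
  rw [lintegral_add_right _ (hf.indicator measurableSet_Ioi), hneg,
    lintegral_indicator measurableSet_Ioi, two_mul]

/-- The real part gives the lower bound 1-ρ. The lower bound |θ|/π comes from ‖X‖² = sin²θ + (ρ -
cos θ)² and Jordan's inequality when |θ| ≤ π/2, and from ‖X‖ ≥ 1 when cos θ ≤ 0. The two are
averaged. -/
lemma add_abs_div_pi_le {ρ θ : ℝ} (h0 : 0 ≤ ρ) (h1 : ρ ≤ 1) (hθ : |θ| ≤ Real.pi) :
    (1 - ρ + |θ|) / (2 * Real.pi) ≤ ‖(1 : ℂ) - ρ * (Real.cos θ - Real.sin θ * Complex.I)‖ := by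
  set X := (1 : ℂ) - ρ * (Real.cos θ - Real.sin θ * Complex.I) with hX
  have hre : X.re = 1 - ρ * Real.cos θ := by simp [hX, -Complex.ofReal_cos, -Complex.ofReal_sin]
  have him : X.im = ρ * Real.sin θ := by simp [hX, -Complex.ofReal_cos, -Complex.ofReal_sin]
  have hA : 1 - ρ ≤ ‖X‖ := by
    refine le_trans ?_ (Complex.re_le_norm X)
    rw [hre]; nlinarith [Real.cos_le_one θ]
  have hsq : ‖X‖ ^ 2 = (1 - ρ * Real.cos θ) ^ 2 + (ρ * Real.sin θ) ^ 2 := by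
    rw [← Complex.normSq_eq_norm_sq, Complex.normSq_apply, hre, him]; ring
  have hpi := Real.pi_pos
  have hB : |θ| / Real.pi ≤ ‖X‖ := by
    rw [div_le_iff₀ hpi]
    by_cases hc : |θ| ≤ Real.pi / 2
    · have hs := Real.mul_le_sin (abs_nonneg θ) hc
      have hs2 : Real.sin |θ| ^ 2 ≤ ‖X‖ ^ 2 := by
        have : Real.sin |θ| ^ 2 = Real.sin θ ^ 2 := by
          rcases abs_choice θ with h | h <;> rw [h]; simp
        rw [this, hsq]
        nlinarith [Real.sin_sq_add_cos_sq θ, sq_nonneg (ρ - Real.cos θ)]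
      have hs3 := abs_le_of_sq_le_sq' hs2 (norm_nonneg X)
      have h4 : |θ| * 2 ≤ Real.sin |θ| * Real.pi := by
        have := mul_le_mul_of_nonneg_right hs hpi.le
        field_simp at this; linarith
      nlinarith [hs3.2, abs_nonneg θ]
    · have hcos : Real.cos θ ≤ 0 := by
        rw [← Real.cos_abs]
        exact Real.cos_nonpos_of_pi_div_two_le_of_le (by linarith) (by linarith)
      have : 1 ≤ ‖X‖ := by
        refine le_trans ?_ (Complex.re_le_norm X)
        rw [hre]; nlinarith
      nlinarith
  have h2 : (1 - ρ) / Real.pi ≤ 1 - ρ := by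
    rw [div_le_iff₀ hpi]; nlinarith [Real.pi_gt_three]
  have : (1 - ρ + |θ|) / (2 * Real.pi) = ((1 - ρ) / Real.pi + |θ| / Real.pi) / 2 := by
    field_simp
  rw [this]; linarith

/-- After `add_abs_div_pi_le` the integrand is a multiple of (1-ρ+|θ|)^(-b), the case κ = 0, τ = b-1
of `lintegral_Ioi_rpow_mul_rpow_le`. -/
lemma lintegral_angle_le {b : ℝ} (hb : 1 < b) :
    ∃ C : ℝ, 0 < C ∧ ∀ ρ : ℝ, 0 ≤ ρ → ρ < 1 →
      ∫⁻ θ in Set.Ioo (-Real.pi) Real.pi,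
        ENNReal.ofReal (‖(1 : ℂ) - ρ * (Real.cos θ - Real.sin θ * Complex.I)‖ ^ (-b)) ≤
      ENNReal.ofReal (C * (1 - ρ) ^ (1 - b)) := by
  have hpi := Real.pi_pos
  have hb1 : 0 < b - 1 := by linarith
  refine ⟨2 * (2 * Real.pi) ^ b * (1 / (0 + 1) + 1 / (b - 1)), by positivity, fun ρ h0 h1 => ?_⟩
  have hd : 0 < 1 - ρ := by linarith
  calc _ ≤ ∫⁻ θ in Set.Ioo (-Real.pi) Real.pi, ENNReal.ofReal ((2 * Real.pi) ^ b) *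
          ENNReal.ofReal (|θ| ^ (0 : ℝ) * (1 - ρ + |θ|) ^ (-(1 + 0 + (b - 1)))) := by
        refine setLIntegral_mono' measurableSet_Ioo fun θ hθ => ?_
        rw [← ENNReal.ofReal_mul (by positivity)]
        refine ENNReal.ofReal_le_ofReal ?_
        have hle := add_abs_div_pi_le h0 h1.le (abs_le.2 ⟨hθ.1.le, hθ.2.le⟩)
        have hp : 0 < 1 - ρ + |θ| := by positivity
        refine (Real.rpow_le_rpow_of_nonpos (by positivity) hle (by linarith)).trans (le_of_eq ?_)
        rw [Real.div_rpow hp.le (by positivity), Real.rpow_zero, one_mul,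
          Real.rpow_neg (x := 2 * Real.pi) (by positivity), div_inv_eq_mul, mul_comm]
        congr 2; ring
    _ ≤ ∫⁻ θ, ENNReal.ofReal ((2 * Real.pi) ^ b) *
          ENNReal.ofReal (|θ| ^ (0 : ℝ) * (1 - ρ + |θ|) ^ (-(1 + 0 + (b - 1)))) :=
        setLIntegral_le_lintegral _ _
    _ = ENNReal.ofReal ((2 * Real.pi) ^ b) * ∫⁻ θ,
          ENNReal.ofReal (|θ| ^ (0 : ℝ) * (1 - ρ + |θ|) ^ (-(1 + 0 + (b - 1)))) :=
        lintegral_const_mul' _ _ (by simp)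
    _ ≤ ENNReal.ofReal ((2 * Real.pi) ^ b) * (2 * ENNReal.ofReal
          ((1 / (0 + 1) + 1 / (b - 1)) * (1 - ρ) ^ (-(b - 1)))) := by
        gcongr
        refine (lintegral_comp_abs_le
          (f := fun y => ENNReal.ofReal (y ^ (0 : ℝ) * (1 - ρ + y) ^ (-(1 + 0 + (b - 1)))))
          (by fun_prop)).trans ?_
        gcongr
        exact lintegral_Ioi_rpow_mul_rpow_le (by norm_num) hb1 hd
    _ = _ := by
        rw [show (2 : ℝ≥0∞) = ENNReal.ofReal 2 by simp, ← ENNReal.ofReal_mul (by norm_num),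
          ← ENNReal.ofReal_mul (by positivity)]
        congr 1
        rw [show -(b - 1) = 1 - b by ring]; ring

/-- The factor (1+r)^γ lies between 2^(-|γ|) and 2^|γ|, whatever the sign of γ. -/
lemma one_sub_sq_rpow_le (γ : ℝ) {r : ℝ} (h0 : 0 ≤ r) (h1 : r < 1) :
    (1 - r ^ 2) ^ γ ≤ 2 ^ |γ| * (1 - r) ^ γ := by
  have : 1 - r ^ 2 = (1 + r) * (1 - r) := by ring
  rw [this, Real.mul_rpow (by linarith) (by linarith)]
  refine mul_le_mul_of_nonneg_right ?_ (Real.rpow_nonneg (by linarith) _)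
  calc (1 + r) ^ γ ≤ (1 + r) ^ |γ| := Real.rpow_le_rpow_of_exponent_le (by linarith) (le_abs_self γ)
    _ ≤ 2 ^ |γ| := Real.rpow_le_rpow (by linarith) (by linarith) (abs_nonneg _)

lemma le_one_sub_sq_rpow (γ : ℝ) {r : ℝ} (h0 : 0 ≤ r) (h1 : r < 1) :
    2 ^ (-|γ|) * (1 - r) ^ γ ≤ (1 - r ^ 2) ^ γ := by
  have : 1 - r ^ 2 = (1 + r) * (1 - r) := by ring
  rw [this, Real.mul_rpow (by linarith) (by linarith)]
  refine mul_le_mul_of_nonneg_right ?_ (Real.rpow_nonneg (by linarith) _)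
  calc (2 : ℝ) ^ (-|γ|) ≤ (1 + r) ^ (-|γ|) :=
        Real.rpow_le_rpow_of_nonpos (by linarith) (by linarith) (by simp)
    _ ≤ (1 + r) ^ γ := Real.rpow_le_rpow_of_exponent_le (by linarith) (neg_abs_le γ)

lemma exists_norm_one_mul (a : ℂ) : ∃ c : ℂ, ‖c‖ = 1 ∧ a = c * (‖a‖ : ℂ) := by
  by_cases h : a = 0
  · exact ⟨1, by simp, by simp [h]⟩
  · have : (‖a‖ : ℂ) ≠ 0 := by simpa using h
    exact ⟨a / ‖a‖, by simp [h], by field_simp⟩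

/-- The kernel integral depends on the modulus of the parameter only. -/
lemma lintegral_absKernel_norm (γ b : ℝ) (a : ℂ) :
    ∫⁻ w, absKernel b a w ∂weightedArea γ = ∫⁻ w, absKernel b (‖a‖ : ℂ) w ∂weightedArea γ := by
  obtain ⟨c, hc, ha⟩ := exists_norm_one_mul a
  rw [← (map_mul_weightedArea γ hc).lintegral_comp (measurable_absKernel b a)]
  congr 1; ext w
  unfold absKernel
  congr 3
  nth_rewrite 1 [ha]
  have : c * conj c = 1 := by
    rw [Complex.mul_conj, Complex.normSq_eq_norm_sq, hc]; simp
  rw [map_mul]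
  linear_combination (-(‖a‖ : ℂ) * conj w) * this

lemma lintegral_absKernel_polar {γ b x : ℝ} :
    ∫⁻ w, absKernel b (x : ℂ) w ∂weightedArea γ =
      ∫⁻ r in Set.Ioo (0 : ℝ) 1, ENNReal.ofReal (r * ((1 + γ) * (1 - r ^ 2) ^ γ / Real.pi)) *
        ∫⁻ θ in Set.Ioo (-Real.pi) Real.pi, ENNReal.ofReal
          (‖(1 : ℂ) - (x * r : ℝ) * (Real.cos θ - Real.sin θ * Complex.I)‖ ^ (-b)) := by
  rw [lintegral_weightedArea, setLIntegral_unitDisk_polar]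
  · refine setLIntegral_congr_fun measurableSet_Ioo fun r hr => ?_
    rw [← lintegral_const_mul' _ _ (by simp)]
    refine lintegral_congr fun θ => ?_
    rw [ENNReal.ofReal_mul hr.1.le, mul_assoc]
    congr 2
    · have hn : ‖(r : ℂ) * (Real.cos θ + Real.sin θ * Complex.I)‖ = r := by
        rw [Complex.ofReal_cos, Complex.ofReal_sin, ← Complex.exp_mul_I, norm_mul,
          Complex.norm_exp_ofReal_mul_I, mul_one, Complex.norm_of_nonneg hr.1.le]
      rw [weight, hn]
    · unfold absKernel
      congr 3
      simp only [map_mul, map_add, Complex.conj_ofReal, Complex.conj_I]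
      push_cast; ring
  · exact ((measurable_weight γ).div_const _).ennreal_ofReal.mul (measurable_absKernel b _)

/-- The Forelli–Rudin estimate. -/
theorem lintegral_absKernel_le {γ t : ℝ} (hγ : -1 < γ) (ht : 0 < t) :
    ∃ C : ℝ, 0 < C ∧ ∀ a ∈ unitDisk,
      ∫⁻ w, absKernel (2 + γ + t) a w ∂weightedArea γ ≤ ENNReal.ofReal (C * defect a ^ (-t)) := by
  obtain ⟨C, hC, hang⟩ := lintegral_angle_le (b := 2 + γ + t) (by linarith)
  have hpi := Real.pi_pos
  have hγ1 : 0 < 1 + γ := by linarith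
  have hγ2 : 0 < γ + 1 := by linarith
  refine ⟨(1 + γ) * 2 ^ |γ| * C / Real.pi * 2 ^ (1 + γ + t) * (1 / (γ + 1) + 1 / t) * 2 ^ t,
    by positivity, fun a ha => ?_⟩
  rw [lintegral_absKernel_norm, lintegral_absKernel_polar]
  have hx1 := mem_unitDisk.1 ha
  set x := ‖a‖ with hx
  have hx0 : 0 ≤ x := norm_nonneg a
  have hd : 0 < 1 - x := by linarith
  set A : ℝ := (1 + γ) * 2 ^ |γ| * C / Real.pi * 2 ^ (1 + γ + t) with hA
  have hA0 : 0 < A := by positivity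
  calc _ ≤ ∫⁻ r in Set.Ioo (0 : ℝ) 1, ENNReal.ofReal
          (A * ((1 - r) ^ γ * (1 - x + (1 - r)) ^ (-(1 + γ + t)))) := by
        refine setLIntegral_mono' measurableSet_Ioo fun r hr => ?_
        have hr0 := hr.1
        have hr1 : 0 < 1 - r := by linarith [hr.2]
        have hxr : x * r < 1 := by nlinarith
        have h1r2 : 0 ≤ 1 - r ^ 2 := by nlinarith
        refine (mul_le_mul' le_rfl (hang (x * r) (by positivity) hxr)).trans ?_
        rw [← ENNReal.ofReal_mul (by positivity)]
        refine ENNReal.ofReal_le_ofReal ?_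
        have h1 := one_sub_sq_rpow_le γ hr0.le hr.2
        -- Since 1 - xr is at least the mean of 1-x and 1-r, the product xr is replaced by a sum,
        -- which is the form of the one-dimensional estimate.
        have h2 : (1 - x * r) ^ (1 - (2 + γ + t)) ≤
            2 ^ (1 + γ + t) * (1 - x + (1 - r)) ^ (-(1 + γ + t)) := by
          have hle : (1 - x + (1 - r)) / 2 ≤ 1 - x * r := by nlinarith
          refine (Real.rpow_le_rpow_of_nonpos (by positivity) hle (by linarith)).trans
            (le_of_eq ?_)
          rw [Real.div_rpow (by positivity) (by norm_num),
            show 1 - (2 + γ + t) = -(1 + γ + t) by ring,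
            Real.rpow_neg (x := 2) (by norm_num), div_inv_eq_mul, mul_comm]
        have h3 : 0 ≤ (1 - x * r) ^ (1 - (2 + γ + t)) := Real.rpow_nonneg (by linarith) _
        calc r * ((1 + γ) * (1 - r ^ 2) ^ γ / Real.pi) * (C * (1 - x * r) ^ (1 - (2 + γ + t)))
            ≤ 1 * ((1 + γ) * (2 ^ |γ| * (1 - r) ^ γ) / Real.pi) *
              (C * (2 ^ (1 + γ + t) * (1 - x + (1 - r)) ^ (-(1 + γ + t)))) := by
              have := hr.2.le
              gcongr
          _ = _ := by rw [hA]; ring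
    _ = ENNReal.ofReal A * ∫⁻ r in Set.Ioo (0 : ℝ) 1, ENNReal.ofReal
          ((1 - r) ^ γ * (1 - x + (1 - r)) ^ (-(1 + γ + t))) := by
        rw [← lintegral_const_mul' _ _ (by simp)]
        simp_rw [← ENNReal.ofReal_mul hA0.le]
    _ ≤ ENNReal.ofReal A * ∫⁻ y in Set.Ioi (0 : ℝ), ENNReal.ofReal
          (y ^ γ * (1 - x + y) ^ (-(1 + γ + t))) := by
        refine mul_le_mul' le_rfl ?_
        -- Substitute y = 1 - r, then enlarge the range (0,1) to the half-line.
        have := lintegral_sub_left_eq_self (μ := (volume : Measure ℝ))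
          ((Set.Ioi (0 : ℝ)).indicator fun y => ENNReal.ofReal
            (y ^ γ * (1 - x + y) ^ (-(1 + γ + t)))) 1
        rw [lintegral_indicator measurableSet_Ioi] at this
        rw [← this, ← lintegral_indicator measurableSet_Ioo]
        refine lintegral_mono fun r => ?_
        by_cases h : r ∈ Set.Ioo (0 : ℝ) 1
        · have h1 : 1 - r ∈ Set.Ioi (0 : ℝ) := by simpa using h.2
          simp only [Set.indicator_of_mem h, Set.indicator_of_mem h1]; exact le_rfl
        · simp [Set.indicator_of_notMem h]
    _ ≤ ENNReal.ofReal A * ENNReal.ofReal ((1 / (γ + 1) + 1 / t) * (1 - x) ^ (-t)) := by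
        gcongr
        exact lintegral_Ioi_rpow_mul_rpow_le hγ ht hd
    _ ≤ _ := by
        rw [← ENNReal.ofReal_mul hA0.le]
        refine ENNReal.ofReal_le_ofReal ?_
        have hda := defect_le_two_mul ha
        have h4 : (1 - x) ^ (-t) ≤ 2 ^ t * defect a ^ (-t) := by
          have hle : defect a / 2 ≤ 1 - x := by linarith
          refine (Real.rpow_le_rpow_of_nonpos (by have := defect_pos ha; positivity) hle
            (by linarith)).trans (le_of_eq ?_)
          rw [Real.div_rpow (defect_pos ha).le (by norm_num),
            Real.rpow_neg (x := 2) (by norm_num), div_inv_eq_mul, mul_comm]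
        calc A * ((1 / (γ + 1) + 1 / t) * (1 - x) ^ (-t))
            ≤ A * ((1 / (γ + 1) + 1 / t) * (2 ^ t * defect a ^ (-t))) := by gcongr
          _ = _ := by ring

/-- In the limiting case the kernel integral grows at least logarithmically. -/
theorem log_le_lintegral_absKernel {γ : ℝ} (hγ : -1 < γ) :
    ∃ c : ℝ, 0 < c ∧ ∀ a ∈ unitDisk,
      ENNReal.ofReal (c * (Real.log (1 / (1 - ‖a‖)) - 1)) ≤
        ∫⁻ w, absKernel (2 + γ) a w ∂weightedArea γ := by
  have hpi := Real.pi_pos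
  have hγ1 : 0 < 1 + γ := by linarith
  refine ⟨(1 + γ) * 2 ^ (-|γ|) / Real.pi * 3 ^ (-(2 + γ)) * 2, by positivity, fun a ha => ?_⟩
  rw [lintegral_absKernel_norm, lintegral_absKernel_polar]
  have hx1 := mem_unitDisk.1 ha
  set x := ‖a‖ with hx
  have hx0 : 0 ≤ x := norm_nonneg a
  have hd : 0 < 1 - x := by linarith
  set A : ℝ := (1 + γ) * 2 ^ (-|γ|) / Real.pi * 3 ^ (-(2 + γ)) * 2 with hA
  have hA0 : 0 < A := by positivity
  -- Only the region r ≤ x, |θ| < 1-r is kept. There |1 - x r e^{-iθ}| ≤ (1-xr) + (1-r) ≤ 3(1-r).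
  have hang : ∀ r ∈ Set.Ioc (0 : ℝ) x, ENNReal.ofReal (2 * (1 - r) * (3 * (1 - r)) ^ (-(2 + γ))) ≤
      ∫⁻ θ in Set.Ioo (-Real.pi) Real.pi, ENNReal.ofReal
          (‖(1 : ℂ) - (x * r : ℝ) * (Real.cos θ - Real.sin θ * Complex.I)‖ ^ (-(2 + γ))) := by
    intro r hr
    have hr0 := hr.1
    have hr1 : 0 < 1 - r := by linarith [hr.2]
    have hsub : Set.Ioo (-(1 - r)) (1 - r) ⊆ Set.Ioo (-Real.pi) Real.pi :=
      Set.Ioo_subset_Ioo (by linarith [Real.pi_gt_three]) (by linarith [Real.pi_gt_three])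
    refine le_trans ?_ (lintegral_mono_set hsub)
    calc ENNReal.ofReal (2 * (1 - r) * (3 * (1 - r)) ^ (-(2 + γ)))
        = ∫⁻ θ in Set.Ioo (-(1 - r)) (1 - r), ENNReal.ofReal ((3 * (1 - r)) ^ (-(2 + γ))) := by
          rw [setLIntegral_const, Real.volume_Ioo, ← ENNReal.ofReal_mul (by positivity)]
          congr 1; ring
      _ ≤ _ := by
          refine setLIntegral_mono' measurableSet_Ioo fun θ hθ => ENNReal.ofReal_le_ofReal ?_
          have habs : |θ| ≤ 1 - r := abs_le.2 ⟨hθ.1.le, hθ.2.le⟩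
          have hxr : x * r < 1 := by nlinarith [hr.2]
          have hxr0 : 0 ≤ x * r := by positivity
          have hpos : 0 < ‖(1 : ℂ) - (x * r : ℝ) * (Real.cos θ - Real.sin θ * Complex.I)‖ := by
            have := add_abs_div_pi_le hxr0 hxr.le (abs_le.2 ⟨(hsub hθ).1.le, (hsub hθ).2.le⟩)
            refine lt_of_lt_of_le ?_ this
            have := abs_nonneg θ
            have : 0 < 1 - x * r + |θ| := by linarith
            positivity
          refine Real.rpow_le_rpow_of_nonpos hpos ?_ (by linarith)
          have hexp : ((Real.cos θ : ℂ) - Real.sin θ * Complex.I) =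
              Complex.exp ((-θ : ℝ) * Complex.I) := by
            rw [Complex.exp_mul_I]; push_cast; simp [sub_eq_add_neg]
          rw [hexp]
          have h1 : ‖Complex.exp (Complex.I * (-θ : ℝ)) - 1‖ ≤ ‖-θ‖ :=
            Real.norm_exp_I_mul_ofReal_sub_one_le
          rw [mul_comm Complex.I] at h1
          calc ‖(1 : ℂ) - (x * r : ℝ) * Complex.exp ((-θ : ℝ) * Complex.I)‖
              = ‖((1 - x * r : ℝ) : ℂ) -
                  (x * r : ℝ) * (Complex.exp ((-θ : ℝ) * Complex.I) - 1)‖ := by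
                congr 1; push_cast; ring
            _ ≤ ‖((1 - x * r : ℝ) : ℂ)‖ +
                  ‖((x * r : ℝ) : ℂ) * (Complex.exp ((-θ : ℝ) * Complex.I) - 1)‖ :=
                norm_sub_le _ _
            _ = (1 - x * r) + x * r * ‖Complex.exp ((-θ : ℝ) * Complex.I) - 1‖ := by
                rw [norm_mul, Complex.norm_of_nonneg (by linarith), Complex.norm_of_nonneg hxr0]
            _ ≤ (1 - x * r) + 1 * (1 - r) := by
                rw [norm_neg, Real.norm_eq_abs] at h1
                gcongr
                exact h1.trans habs
            _ ≤ 3 * (1 - r) := by nlinarith [hr.2]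
  -- With the radial weight, the powers of 1-r collapse to r/(1-r) = 1/(1-r) - 1, whose integral
  -- over (0,x) is log(1/(1-x)) - x.
  calc ENNReal.ofReal (A * (Real.log (1 / (1 - x)) - 1))
      ≤ ENNReal.ofReal (∫ r in Set.Ioc (0 : ℝ) x, A * ((1 - r)⁻¹ - 1)) := by
        refine ENNReal.ofReal_le_ofReal ?_
        rw [← intervalIntegral.integral_of_le hx0, intervalIntegral.integral_const_mul]
        have hint : IntervalIntegrable (fun r : ℝ => (1 - r)⁻¹) volume 0 x := by
          refine ContinuousOn.intervalIntegrable ?_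
          rw [Set.uIcc_of_le hx0]
          refine ContinuousOn.inv₀ (by fun_prop) fun r hr => ?_
          have := hr.2; intro h; linarith
        rw [intervalIntegral.integral_sub hint (by simp)]
        have h2 := intervalIntegral.integral_comp_sub_left (a := 0) (b := x) (fun y : ℝ => y⁻¹) 1
        rw [h2, integral_inv_of_pos hd (by norm_num)]
        simp only [intervalIntegral.integral_const, smul_eq_mul, sub_zero, mul_one]
        gcongr
    _ = ∫⁻ r in Set.Ioc (0 : ℝ) x, ENNReal.ofReal (A * ((1 - r)⁻¹ - 1)) := by
        rw [ofReal_integral_eq_lintegral_ofReal]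
        · refine ContinuousOn.integrableOn_compact isCompact_Icc (K := Set.Icc 0 x) ?_ |>.mono_set
            Set.Ioc_subset_Icc_self
          refine ContinuousOn.mul (by fun_prop) (ContinuousOn.sub ?_ (by fun_prop))
          refine ContinuousOn.inv₀ (by fun_prop) fun r hr => ?_
          have := hr.2; intro h; linarith
        · refine (ae_restrict_iff' measurableSet_Ioc).2 (ae_of_all _ fun r hr => ?_)
          have h1 : 0 < 1 - r := by linarith [hr.2]
          have : 1 ≤ (1 - r)⁻¹ := (one_le_inv₀ h1).2 (by linarith [hr.1])
          have : 0 ≤ (1 - r)⁻¹ - 1 := by linarith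
          simp only [Pi.zero_apply]; positivity
    _ ≤ ∫⁻ r in Set.Ioc (0 : ℝ) x, ENNReal.ofReal (r * ((1 + γ) * (1 - r ^ 2) ^ γ / Real.pi)) *
        ∫⁻ θ in Set.Ioo (-Real.pi) Real.pi, ENNReal.ofReal
          (‖(1 : ℂ) - (x * r : ℝ) * (Real.cos θ - Real.sin θ * Complex.I)‖ ^ (-(2 + γ))) := by
        refine setLIntegral_mono' measurableSet_Ioc fun r hr => ?_
        have hr0 := hr.1
        have hr1 : 0 < 1 - r := by linarith [hr.2]
        have h1r2 : 0 ≤ 1 - r ^ 2 := by nlinarith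
        refine le_trans ?_ (mul_le_mul' le_rfl (hang r hr))
        rw [← ENNReal.ofReal_mul (by positivity)]
        refine ENNReal.ofReal_le_ofReal ?_
        have h1 := le_one_sub_sq_rpow γ hr0.le (by linarith)
        calc A * ((1 - r)⁻¹ - 1)
            = r * ((1 + γ) * (2 ^ (-|γ|) * (1 - r) ^ γ) / Real.pi) *
              (2 * (1 - r) * (3 * (1 - r)) ^ (-(2 + γ))) := by
              rw [Real.mul_rpow (by norm_num) hr1.le, hA,
                show -(2 + γ) = -γ - 2 by ring, Real.rpow_sub hr1, Real.rpow_neg hr1.le γ]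
              have := (Real.rpow_pos_of_pos hr1 γ).ne'
              have e2 : (1 - r) ^ (2 : ℝ) = (1 - r) ^ 2 := by norm_cast
              rw [e2]
              field_simp
              ring
          _ ≤ _ := by gcongr
    _ ≤ _ := by
        have hsub : Set.Ioc 0 x ⊆ Set.Ioo 0 1 := fun r hr => ⟨hr.1, lt_of_le_of_lt hr.2 hx1⟩
        exact lintegral_mono_set hsub

/-! ### Total mass and the mean value property -/

lemma measurableSet_unitDisk : MeasurableSet unitDisk := Metric.isOpen_ball.measurableSet

lemma absKernel_zero_left (b : ℝ) (w : ℂ) : absKernel b 0 w = 1 := by simp [absKernel]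

lemma zero_mem_unitDisk : (0 : ℂ) ∈ unitDisk := by simp

/-- The kernel with parameter 0 is identically 1, so the Forelli–Rudin bound at the origin already
bounds the mass. -/
lemma isFiniteMeasure_weightedArea {γ : ℝ} (hγ : -1 < γ) : IsFiniteMeasure (weightedArea γ) := by
  obtain ⟨C, -, h⟩ := lintegral_absKernel_le hγ one_pos
  refine ⟨lt_of_le_of_lt ?_ (ENNReal.ofReal_lt_top (r := C * defect 0 ^ (-1 : ℝ)))⟩
  simpa [absKernel_zero_left] using h 0 zero_mem_unitDisk

/-- The total mass of `ω_γ dA`. -/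
noncomputable def mass (γ : ℝ) : ℝ := (weightedArea γ).real Set.univ

lemma weight_pos {γ : ℝ} (hγ : -1 < γ) {z : ℂ} (hz : z ∈ unitDisk) : 0 < weight γ z := by
  have : 0 < 1 + γ := by linarith
  have := defect_pos hz
  rw [weight_eq]; positivity

/-- Finiteness and positivity suffice throughout; the mass appears only as a normalizing constant
and its value is never computed. -/
lemma mass_pos {γ : ℝ} (hγ : -1 < γ) : 0 < mass γ := by
  have := isFiniteMeasure_weightedArea hγ
  refine ENNReal.toReal_pos ?_ (measure_ne_top _ _)
  rw [← lintegral_one, lintegral_weightedArea]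
  simp only [mul_one]
  refine ((setLIntegral_pos_iff ((measurable_weight γ).div_const _).ennreal_ofReal).2 ?_).ne'
  refine lt_of_lt_of_le (Metric.measure_ball_pos volume (0 : ℂ) one_pos)
    (measure_mono fun z hz => ⟨?_, hz⟩)
  have := weight_pos hγ hz
  have := Real.pi_pos
  simp only [Function.mem_support, ne_eq, ENNReal.ofReal_eq_zero, not_le]
  positivity

lemma toReal_density {γ : ℝ} (hγ : -1 < γ) {z : ℂ} (hz : z ∈ unitDisk) :
    (ENNReal.ofReal (weight γ z / Real.pi)).toReal = weight γ z / Real.pi :=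
  ENNReal.toReal_ofReal (div_nonneg (weight_pos hγ hz).le Real.pi_pos.le)

lemma integrable_weightedArea_iff {γ : ℝ} (hγ : -1 < γ) {F : ℂ → ℂ} :
    Integrable F (weightedArea γ) ↔
      IntegrableOn (fun z => (weight γ z / Real.pi) • F z) unitDisk := by
  unfold weightedArea
  rw [integrable_withDensity_iff_integrable_smul'
    ((measurable_weight γ).div_const _).ennreal_ofReal (by simp)]
  exact integrableOn_congr_fun (fun z hz => by simp only [toReal_density hγ hz])
    measurableSet_unitDisk

lemma integral_weightedArea {γ : ℝ} (hγ : -1 < γ) (F : ℂ → ℂ) :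
    ∫ z, F z ∂weightedArea γ = ∫ z in unitDisk, (weight γ z / Real.pi) • F z := by
  unfold weightedArea
  rw [integral_withDensity_eq_integral_toReal_smul
    ((measurable_weight γ).div_const _).ennreal_ofReal (by simp)]
  exact setIntegral_congr_fun measurableSet_unitDisk
    (fun z hz => by simp only [toReal_density hγ hz])

lemma aestronglyMeasurable_of_continuousOn {μ : Measure ℂ} (hμ : ∀ᵐ z ∂μ, z ∈ unitDisk)
    {F : ℂ → ℂ} (hF : ContinuousOn F unitDisk) : AEStronglyMeasurable F μ := by
  rw [← Measure.restrict_eq_self_of_ae_mem hμ]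
  exact hF.aestronglyMeasurable measurableSet_unitDisk

open Classical in
lemma measurable_indicator_of_continuousOn {F : ℂ → ℂ} (hF : ContinuousOn F unitDisk) :
    Measurable (unitDisk.indicator F) := by
  rw [← Set.piecewise_eq_indicator]
  exact hF.measurable_piecewise continuousOn_const measurableSet_unitDisk

/-- The mean value property with respect to the radial measure `ω_γ dA`. -/
theorem integral_eq_mass_mul {γ : ℝ} (hγ : -1 < γ) {H : ℂ → ℂ}
    (hd : DifferentiableOn ℂ H unitDisk) (hi : Integrable H (weightedArea γ)) :
    ∫ z, H z ∂weightedArea γ = mass γ * H 0 := by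
  have := isFiniteMeasure_weightedArea hγ
  -- Cutting off outside the disk makes the function Borel on the whole plane, as joint
  -- measurability in Fubini requires.
  set H' := unitDisk.indicator H with hH'
  have hm : Measurable H' := measurable_indicator_of_continuousOn hd.continuousOn
  have hae : H =ᵐ[weightedArea γ] H' :=
    (ae_mem_unitDisk γ).mono fun z hz => (Set.indicator_of_mem hz H).symm
  have hi' : Integrable H' (weightedArea γ) := hi.congr hae
  have hpi := Real.pi_pos
  have hpres : ∀ θ : ℝ, MeasurePreserving (fun z => Complex.exp (θ * Complex.I) * z)
      (weightedArea γ) (weightedArea γ) :=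
    fun θ => map_mul_weightedArea γ (Complex.norm_exp_ofReal_mul_I θ)
  have hemb : ∀ θ : ℝ, MeasurableEmbedding (fun z => Complex.exp (θ * Complex.I) * z) :=
    fun θ => (Homeomorph.mulLeft₀ _ (Complex.exp_ne_zero _)).measurableEmbedding
  -- The integral over the disk is unchanged by rotation. Integrating it over all angles and
  -- exchanging the integrals reduces the claim to the mean value property on circles.
  have hcirc : ∀ z ∈ unitDisk,
      ∫ θ in Set.Ioc 0 (2 * Real.pi), H' (Complex.exp (θ * Complex.I) * z) =
      2 * Real.pi * H 0 := by
    intro z hz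
    have hz1 := mem_unitDisk.1 hz
    have hdz : DiffContOnCl ℂ (fun ζ => H (ζ * z)) (Metric.ball 0 |1|) := by
      have hsub : ∀ ζ ∈ Metric.closedBall (0 : ℂ) 1, ζ * z ∈ unitDisk := by
        intro ζ hζ
        rw [mem_unitDisk, norm_mul]
        have : ‖ζ‖ ≤ 1 := by simpa using hζ
        nlinarith [norm_nonneg ζ, norm_nonneg z]
      have : DifferentiableOn ℂ (fun ζ => H (ζ * z)) (Metric.closedBall 0 1) :=
        hd.comp (by fun_prop) hsub
      rw [abs_one]
      refine DifferentiableOn.diffContOnCl ?_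
      rwa [closure_ball _ one_ne_zero]
    have h1 := hdz.circleAverage
    rw [Real.circleAverage_def, intervalIntegral.integral_of_le (by positivity), zero_mul] at h1
    have h2 : ∫ θ in Set.Ioc 0 (2 * Real.pi), H' (Complex.exp (θ * Complex.I) * z) =
        ∫ θ in Set.Ioc 0 (2 * Real.pi), H (circleMap 0 1 θ * z) := by
      refine integral_congr_ae (ae_of_all _ fun θ => ?_)
      simp only [hH', circleMap, Complex.ofReal_one, one_mul, zero_add]
      refine Set.indicator_of_mem ?_ H
      rw [mem_unitDisk, norm_mul, Complex.norm_exp_ofReal_mul_I, one_mul]; exact hz1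
    rw [h2, ← h1, Complex.real_smul]
    push_cast
    have : (Real.pi : ℂ) ≠ 0 := by exact_mod_cast hpi.ne'
    generalize (∫ θ in Set.Ioc 0 (2 * Real.pi), H (circleMap 0 1 θ * z)) = I
    field_simp
  have hint : Integrable (Function.uncurry fun (θ : ℝ) z => H' (Complex.exp (θ * Complex.I) * z))
      ((volume.restrict (Set.Ioc 0 (2 * Real.pi))).prod (weightedArea γ)) := by
    refine (integrable_prod_iff ?_).2 ⟨ae_of_all _ fun θ => ?_, ?_⟩
    · exact (hm.comp (by fun_prop)).aestronglyMeasurable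
    · exact (hpres θ).integrable_comp_of_integrable hi'
    · have : ∀ θ : ℝ, ∫ z, ‖H' (Complex.exp (θ * Complex.I) * z)‖ ∂weightedArea γ =
          ∫ z, ‖H' z‖ ∂weightedArea γ := fun θ =>
        (hpres θ).integral_comp (hemb θ) fun z => ‖H' z‖
      simp only [Function.uncurry_apply_pair, this]
      exact integrable_const _
  have hswap := integral_integral_swap hint
  have hl : ∀ θ : ℝ, ∫ z, H' (Complex.exp (θ * Complex.I) * z) ∂weightedArea γ =
      ∫ z, H z ∂weightedArea γ := fun θ => by
    rw [(hpres θ).integral_comp (hemb θ) H']; exact (integral_congr_ae hae).symm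
  simp only [hl] at hswap
  rw [integral_congr_ae ((ae_mem_unitDisk γ).mono hcirc)] at hswap
  simp only [integral_const, measureReal_restrict_apply_univ, Real.volume_real_Ioc_of_le
    (by positivity : (0 : ℝ) ≤ 2 * Real.pi), Complex.real_smul] at hswap
  have h2 : ((2 : ℂ) * Real.pi) ≠ 0 := by
    simp
  refine mul_left_cancel₀ h2 ?_
  have h3 : ((2 * Real.pi - 0 : ℝ) : ℂ) = 2 * Real.pi := by push_cast; ring
  rw [h3] at hswap
  rw [hswap, mass]; ring

/-! ### Disk automorphisms and the reproducing formula -/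

/-- The involutive automorphism of the disk exchanging `0` and `a`. -/
noncomputable def mobius (a z : ℂ) : ℂ := (a - z) / (1 - z * conj a)

lemma one_sub_ne_zero {a z : ℂ} (ha : a ∈ unitDisk) (hz : z ∈ unitDisk) : 1 - z * conj a ≠ 0 :=
  norm_pos_iff.1 (norm_one_sub_pos hz ha)

lemma ofReal_defect (z : ℂ) : (defect z : ℂ) = 1 - z * conj z := by
  rw [Complex.mul_conj, Complex.normSq_eq_norm_sq, defect]; push_cast; rfl

lemma defect_mobius {a z : ℂ} (ha : a ∈ unitDisk) (hz : z ∈ unitDisk) :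
    defect (mobius a z) = defect a * defect z / ‖1 - z * conj a‖ ^ 2 := by
  have h0 := one_sub_ne_zero ha hz
  have h0' : 1 - a * conj z ≠ 0 := one_sub_ne_zero hz ha
  have hc : conj (1 - z * conj a) = 1 - a * conj z := by simp [mul_comm]
  have : ((‖1 - z * conj a‖ ^ 2 : ℝ) : ℂ) = (1 - z * conj a) * (1 - a * conj z) := by
    rw [← Complex.normSq_eq_norm_sq, ← Complex.mul_conj, hc]
  apply Complex.ofReal_injective
  rw [Complex.ofReal_div, this, Complex.ofReal_mul, ofReal_defect, ofReal_defect, ofReal_defect,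
    mobius, map_div₀, hc, map_sub]
  field_simp
  ring

lemma mobius_mem {a z : ℂ} (ha : a ∈ unitDisk) (hz : z ∈ unitDisk) : mobius a z ∈ unitDisk := by
  have h := defect_mobius ha hz
  have : 0 < defect (mobius a z) := by
    rw [h]
    have := defect_pos ha
    have := defect_pos hz
    have := norm_one_sub_pos hz ha
    positivity
  rw [mem_unitDisk]
  unfold defect at this
  nlinarith [norm_nonneg (mobius a z)]

lemma one_sub_mobius_mul {a z : ℂ} (ha : a ∈ unitDisk) (hz : z ∈ unitDisk) :
    1 - mobius a z * conj a = defect a / (1 - z * conj a) := by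
  have h0 := one_sub_ne_zero ha hz
  rw [ofReal_defect, mobius]; field_simp; ring

lemma mobius_mobius {a z : ℂ} (ha : a ∈ unitDisk) (hz : z ∈ unitDisk) :
    mobius a (mobius a z) = z := by
  have h0 := one_sub_ne_zero ha hz
  have hd : (defect a : ℂ) ≠ 0 := by exact_mod_cast (defect_pos ha).ne'
  rw [mobius, one_sub_mobius_mul ha hz, div_eq_iff (div_ne_zero hd h0), mobius, ofReal_defect]
  field_simp; ring

lemma mobius_zero (a : ℂ) : mobius a 0 = a := by simp [mobius]

lemma hasDerivAt_mobius {a z : ℂ} (ha : a ∈ unitDisk) (hz : z ∈ unitDisk) :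
    HasDerivAt (mobius a) (-(defect a / (1 - z * conj a) ^ 2)) z := by
  have h0 := one_sub_ne_zero ha hz
  have h1 : HasDerivAt (fun z : ℂ => a - z) (-1) z := by
    simpa using (hasDerivAt_id z).const_sub a
  have h2 : HasDerivAt (fun z : ℂ => 1 - z * conj a) (-conj a) z := by
    simpa using ((hasDerivAt_id z).mul_const (conj a)).const_sub 1
  refine (h1.div h2 h0).congr_deriv ?_
  rw [ofReal_defect]; field_simp; ring

lemma injOn_mobius {a : ℂ} (ha : a ∈ unitDisk) : Set.InjOn (mobius a) unitDisk := by
  intro z hz w hw h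
  rw [← mobius_mobius ha hz, h, mobius_mobius ha hw]

lemma image_mobius {a : ℂ} (ha : a ∈ unitDisk) : Set.image (mobius a) unitDisk = unitDisk := by
  ext z
  constructor
  · rintro ⟨w, hw, rfl⟩; exact mobius_mem ha hw
  · exact fun hz => ⟨mobius a z, mobius_mem ha hz, mobius_mobius ha hz⟩

/-- Supplies the real Jacobian of a holomorphic change of variables with complex derivative d. -/
lemma abs_det_toSpanSingleton (d : ℂ) :
    |((ContinuousLinearMap.toSpanSingleton ℂ d).restrictScalars ℝ).det| = ‖d‖ ^ 2 := by
  have : ((ContinuousLinearMap.toSpanSingleton ℂ d).restrictScalars ℝ).det = Complex.normSq d := by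
    rw [ContinuousLinearMap.det, ← Algebra.norm_complex_apply]
    have h := LinearMap.det_restrictScalars (R := ℝ)
      (f := (ContinuousLinearMap.toSpanSingleton ℂ d : ℂ →ₗ[ℂ] ℂ))
    rw [LinearMap.det_ring] at h
    simpa using h
  rw [this, Complex.normSq_eq_norm_sq, abs_of_nonneg (by positivity)]

lemma continuousOn_kern (b : ℝ) {w : ℂ} (hw : w ∈ unitDisk) : ContinuousOn (kern b w) unitDisk := by
  unfold kern
  refine ContinuousOn.div continuousOn_const (ContinuousOn.cpow_const (by fun_prop) ?_) ?_
  · exact fun u hu => one_sub_mul_conj_mem_slitPlane hw hu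
  · intro u hu
    have := norm_one_sub_pos hw hu
    rw [← norm_pos_iff, Complex.norm_cpow_real]; positivity

/-- A crude bound, uniform in u and valid for either sign of b. It is meant for integrability and
domination only; sharp estimates go through the Forelli–Rudin integrals. -/
lemma norm_kern_le (b : ℝ) {w u : ℂ} (hw : w ∈ unitDisk) (hu : u ∈ unitDisk) :
    ‖kern b w u‖ ≤ (1 - ‖w‖) ^ (-|b|) * 2 ^ |b| := by
  have h1 := norm_one_sub_pos hw hu
  have h2 := norm_one_sub_le_two hw hu
  have h3 := one_sub_norm_le_norm (z := w) (mem_unitDisk.1 hu).le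
  have h4 : 0 < 1 - ‖w‖ := by linarith [mem_unitDisk.1 hw]
  rw [norm_kern]
  have h5 : (1 - ‖w‖) ≤ 1 := by linarith [norm_nonneg w]
  rcases le_total 0 b with hb | hb
  · rw [abs_of_nonneg hb]
    calc ‖1 - w * conj u‖ ^ (-b) ≤ (1 - ‖w‖) ^ (-b) * 1 := by
          rw [mul_one]; exact Real.rpow_le_rpow_of_nonpos h4 h3 (by linarith)
      _ ≤ _ := by gcongr; exact Real.one_le_rpow (by norm_num) hb
  · rw [abs_of_nonpos hb]
    calc ‖1 - w * conj u‖ ^ (-b) ≤ 1 * 2 ^ (-b) := by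
          rw [one_mul]; exact Real.rpow_le_rpow h1.le h2 (by linarith)
      _ ≤ _ := by
          gcongr
          exact Real.one_le_rpow_of_pos_of_le_one_of_nonpos h4 h5 (by linarith)

lemma integrable_mul_kern {γ : ℝ} (b : ℝ) {h : ℂ → ℂ} (hi : Integrable h (weightedArea γ))
    {w : ℂ} (hw : w ∈ unitDisk) : Integrable (fun u => h u * kern b w u) (weightedArea γ) := by
  refine hi.mul_bdd (c := (1 - ‖w‖) ^ (-|b|) * 2 ^ |b|)
    (aestronglyMeasurable_of_continuousOn (ae_mem_unitDisk γ)
    (continuousOn_kern b hw)) ?_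
  exact (ae_mem_unitDisk γ).mono fun u hu => norm_kern_le b hw hu

/-- The reproducing formula of the weighted Bergman space. -/
theorem integral_mul_kern {γ : ℝ} (hγ : -1 < γ) {h : ℂ → ℂ}
    (hd : DifferentiableOn ℂ h unitDisk) (hi : Integrable h (weightedArea γ))
    {w : ℂ} (hw : w ∈ unitDisk) :
    ∫ u, h u * kern (2 + γ) w u ∂weightedArea γ = mass γ * h w := by
  -- The mean value property is applied to (hP)∘`mobius w`, whose value at 0 is h(w) P(w) = h(w)
  -- d(w)^(2+γ). The change of variables produces d(w)^(2+γ)/|P|², and P/|P|² = 1/conj P is the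
  -- reproducing kernel, so the powers of d(w) cancel.
  set P : ℂ → ℂ := fun u => (1 - u * conj w) ^ ((2 + γ : ℝ) : ℂ) with hP
  set H : ℂ → ℂ := fun u => h u * P u with hH
  have hPd : DifferentiableOn ℂ P unitDisk := fun u hu => by
    refine DifferentiableAt.differentiableWithinAt ?_
    exact DifferentiableAt.cpow_const (by fun_prop) (one_sub_mul_conj_mem_slitPlane hu hw)
  have hHd : DifferentiableOn ℂ H unitDisk := hd.mul hPd
  have hdw := defect_pos hw
  have hkey : ∀ u ∈ unitDisk,
      |((ContinuousLinearMap.toSpanSingleton ℂ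
        (-(defect w / (1 - u * conj w) ^ 2) : ℂ)).restrictScalars ℝ).det| •
        ((weight γ (mobius w u) / Real.pi) • H (mobius w (mobius w u))) =
      (defect w ^ (2 + γ) : ℝ) • ((weight γ u / Real.pi) • (h u * kern (2 + γ) w u)) := by
    intro u hu
    have hdu := defect_pos hu
    have hN := norm_one_sub_pos hu hw
    rw [abs_det_toSpanSingleton, mobius_mobius hw hu, weight_eq, weight_eq, defect_mobius hw hu]
    simp only [hH, Complex.real_smul]
    have h1 : P u * conj (P u) = ((‖1 - u * conj w‖ ^ (2 * (2 + γ)) : ℝ) : ℂ) := by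
      rw [Complex.mul_conj, Complex.normSq_eq_norm_sq, hP, Complex.norm_cpow_real,
        ← Real.rpow_natCast, ← Real.rpow_mul hN.le]
      congr 2; push_cast; ring
    have h2 : kern (2 + γ) w u = 1 / conj (P u) := by
      rw [← conj_kern _ hu hw, kern, map_div₀, map_one]
    have h3 : conj (P u) ≠ 0 := by
      rw [← norm_pos_iff, RCLike.norm_conj, hP, Complex.norm_cpow_real]; positivity
    have h4 : ‖-((defect w : ℂ) / (1 - u * conj w) ^ 2)‖ ^ 2 =
        defect w ^ 2 * ‖1 - u * conj w‖ ^ (-4 : ℝ) := by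
      rw [norm_neg, norm_div, norm_pow, Complex.norm_of_nonneg hdw.le, div_pow, ← pow_mul,
        Real.rpow_neg hN.le, div_eq_mul_inv]
      norm_cast
    have h5 : (defect w * defect u / ‖1 - u * conj w‖ ^ 2) ^ γ =
        defect w ^ γ * defect u ^ γ * ‖1 - u * conj w‖ ^ (-(2 * γ)) := by
      rw [Real.div_rpow (by positivity) (by positivity), Real.mul_rpow hdw.le hdu.le,
        Real.rpow_neg hN.le, Real.rpow_mul hN.le, div_eq_mul_inv]
      norm_cast
    have h6 : defect w ^ (2 + γ) = defect w ^ 2 * defect w ^ γ := by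
      rw [Real.rpow_add hdw]; norm_cast
    have h7 : ‖1 - u * conj w‖ ^ (-4 : ℝ) * ‖1 - u * conj w‖ ^ (-(2 * γ)) *
        ‖1 - u * conj w‖ ^ (2 * (2 + γ)) = 1 := by
      rw [← Real.rpow_add hN, ← Real.rpow_add hN,
        show (-4 : ℝ) + -(2 * γ) + 2 * (2 + γ) = 0 by ring, Real.rpow_zero]
    rw [h2, h4, h5, h6, mul_one_div, div_eq_mul_inv (h u)]
    have h8 : h u * P u = h u * ((‖1 - u * conj w‖ ^ (2 * (2 + γ)) : ℝ) : ℂ) * (conj (P u))⁻¹ := by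
      rw [← h1]; field_simp
    rw [h8]
    have h9 := congrArg (fun x : ℝ => (x : ℂ)) h7
    push_cast at h9 ⊢
    linear_combination ((defect w : ℂ) ^ 2 * ((1 + γ) * ((defect w ^ γ : ℝ) * (defect u ^ γ : ℝ)) /
      Real.pi) * (h u * (conj (P u))⁻¹)) * h9
  have hdet : ∀ u ∈ unitDisk, HasFDerivWithinAt (mobius w)
      ((ContinuousLinearMap.toSpanSingleton ℂ
        (-(defect w / (1 - u * conj w) ^ 2) : ℂ)).restrictScalars ℝ) unitDisk u := fun u hu =>
    ((hasDerivAt_mobius hw hu).hasFDerivAt.restrictScalars ℝ).hasFDerivWithinAt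
  have hiK := integrable_mul_kern (2 + γ) hi hw
  have hiC : Integrable (fun x => H (mobius w x)) (weightedArea γ) := by
    rw [integrable_weightedArea_iff hγ, ← image_mobius hw,
      integrableOn_image_iff_integrableOn_abs_det_fderiv_smul volume measurableSet_unitDisk hdet
        (injOn_mobius hw), integrableOn_congr_fun hkey measurableSet_unitDisk]
    exact ((integrable_weightedArea_iff hγ).1 hiK).smul (defect w ^ (2 + γ) : ℝ)
  have hmv := integral_eq_mass_mul hγ
    (hHd.comp (fun z hz => (hasDerivAt_mobius hw hz).differentiableAt.differentiableWithinAt)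
      (fun z hz => mobius_mem hw hz)) hiC
  have hcv := integral_image_eq_integral_abs_det_fderiv_smul volume measurableSet_unitDisk hdet
    (injOn_mobius hw) fun x => (weight γ x / Real.pi) • H (mobius w x)
  rw [image_mobius hw, setIntegral_congr_fun measurableSet_unitDisk hkey, integral_smul,
    ← integral_weightedArea hγ, ← integral_weightedArea hγ] at hcv
  have hPw : P w = ((defect w ^ (2 + γ) : ℝ) : ℂ) := by
    rw [hP, Complex.ofReal_cpow hdw.le, ofReal_defect]
  simp only [Function.comp_def] at hmv
  rw [hmv, mobius_zero, Complex.real_smul, hH] at hcv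
  simp only [hPw] at hcv
  have hne : ((defect w ^ (2 + γ) : ℝ) : ℂ) ≠ 0 := by
    exact_mod_cast (Real.rpow_pos_of_pos hdw _).ne'
  refine mul_left_cancel₀ hne ?_
  rw [← hcv]; ring

/-! ### Growth of Bloch functions -/

/-- Growth of a Bloch function with respect to the hyperbolic distance. -/
theorem norm_sub_le_log {g : ℂ → ℂ} {B : ℝ} (hd : DifferentiableOn ℂ g unitDisk)
    (hB : ∀ z ∈ unitDisk, defect z * ‖deriv g z‖ ≤ B) {a w : ℂ} (ha : a ∈ unitDisk)
    (hw : w ∈ unitDisk) : ‖g w - g a‖ ≤ B * Real.log (2 / defect (mobius a w)) := by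
  set ζ := mobius a w with hζ
  have hζD : ζ ∈ unitDisk := mobius_mem ha hw
  have hζ1 := mem_unitDisk.1 hζD
  have hB0 : 0 ≤ B := le_trans (mul_nonneg (defect_pos ha).le (norm_nonneg _)) (hB a ha)
  have hmem : ∀ t ∈ Set.Icc (0 : ℝ) 1, (t : ℂ) * ζ ∈ unitDisk := by
    intro t ht
    rw [mem_unitDisk, norm_mul, Complex.norm_of_nonneg ht.1]
    nlinarith [ht.1, ht.2, norm_nonneg ζ]
  have hpos : ∀ t ∈ Set.Icc (0 : ℝ) 1, 0 < 1 - t * ‖ζ‖ := by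
    intro t ht
    nlinarith [ht.1, ht.2, norm_nonneg ζ]
  have hder : ∀ t ∈ Set.Icc (0 : ℝ) 1, HasDerivAt (fun t : ℝ => g (mobius a (t * ζ)) - g a)
      (deriv g (mobius a (t * ζ)) * (-(defect a / (1 - t * ζ * conj a) ^ 2) * ζ)) t := by
    intro t ht
    have h1 : HasDerivAt (fun t : ℝ => (t : ℂ) * ζ) ζ t := by
      simpa using (Complex.ofRealCLM.hasDerivAt (x := t)).mul_const ζ
    have h2 := (hasDerivAt_mobius ha (hmem t ht)).comp t h1
    have h3 : HasDerivAt g (deriv g (mobius a (t * ζ))) (mobius a (t * ζ)) :=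
      (hd.differentiableAt (Metric.isOpen_ball.mem_nhds (mobius_mem ha (hmem t ht)))).hasDerivAt
    exact (h3.comp t h2).sub_const _
  -- Integrate along the path t ↦ `mobius a (t * ζ)` from a to w. Conformal invariance of the Bloch
  -- seminorm bounds the speed by B|ζ|/d(tζ) ≤ B|ζ|/(1 - t|ζ|), which has primitive -B log(1 -
  -- t|ζ|).
  have hmain := image_norm_le_of_norm_deriv_right_le_deriv_boundary'
    (f := fun t : ℝ => g (mobius a (t * ζ)) - g a) (a := 0) (b := 1)
    (B := fun t => -B * Real.log (1 - t * ‖ζ‖)) (B' := fun t => B * (‖ζ‖ / (1 - t * ‖ζ‖)))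
    (fun t ht => (hder t ht).continuousAt.continuousWithinAt)
    (fun t ht => (hder t (Set.Ico_subset_Icc_self ht)).hasDerivWithinAt)
    (by simp [mobius_zero])
    (fun t ht => by
      refine ContinuousWithinAt.mul continuousWithinAt_const ?_
      have hc : ContinuousAt (fun t : ℝ => 1 - t * ‖ζ‖) t := by fun_prop
      exact (hc.log (hpos t ht).ne').continuousWithinAt)
    (fun t ht => by
      have hp := (hpos t (Set.Ico_subset_Icc_self ht)).ne'
      have h1 : HasDerivAt (fun t : ℝ => 1 - t * ‖ζ‖) (-‖ζ‖) t := by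
        simpa using ((hasDerivAt_id t).mul_const ‖ζ‖).const_sub 1
      refine (((h1.log hp).const_mul (-B)).congr_deriv ?_).hasDerivWithinAt
      ring)
    (fun t ht => by
      have ht' := Set.Ico_subset_Icc_self ht
      have hz := hmem t ht'
      have hb := hB _ (mobius_mem ha hz)
      have hN := norm_one_sub_pos hz ha
      have hda := defect_pos ha
      have hdz := defect_pos hz
      rw [defect_mobius ha hz] at hb
      have hle : 1 - t * ‖ζ‖ ≤ defect ((t : ℂ) * ζ) := by
        have := one_sub_norm_le_defect hz
        rwa [norm_mul, Complex.norm_of_nonneg ht.1] at this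
      rw [norm_mul, norm_mul, norm_neg, norm_div, norm_pow, Complex.norm_of_nonneg hda.le]
      have hp := hpos t ht'
      calc ‖deriv g (mobius a (t * ζ))‖ * (defect a / ‖1 - t * ζ * conj a‖ ^ 2 * ‖ζ‖)
          = (defect a * defect ((t : ℂ) * ζ) / ‖1 - t * ζ * conj a‖ ^ 2 *
              ‖deriv g (mobius a (t * ζ))‖) * (‖ζ‖ / defect ((t : ℂ) * ζ)) := by
            field_simp
        _ ≤ B * (‖ζ‖ / defect ((t : ℂ) * ζ)) := by gcongr
        _ ≤ B * (‖ζ‖ / (1 - t * ‖ζ‖)) := by gcongr)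
    (Set.right_mem_Icc.2 zero_le_one)
  simp only [Complex.ofReal_one, one_mul] at hmain
  rw [hζ, mobius_mobius ha hw, ← hζ] at hmain
  refine hmain.trans ?_
  have h1 : 0 < 1 - ‖ζ‖ := by linarith
  rw [neg_mul, ← mul_neg, ← Real.log_inv]
  refine mul_le_mul_of_nonneg_left (Real.log_le_log (by positivity) ?_) hB0
  rw [inv_eq_one_div, div_le_div_iff₀ h1 (defect_pos hζD)]
  linarith [defect_le_two_mul hζD]

lemma norm_le_add_log {g : ℂ → ℂ} {B : ℝ} (hd : DifferentiableOn ℂ g unitDisk)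
    (hB : ∀ z ∈ unitDisk, defect z * ‖deriv g z‖ ≤ B) {a : ℂ} (ha : a ∈ unitDisk) :
    ‖g a‖ ≤ ‖g 0‖ + B * Real.log (2 / defect a) := by
  have h := norm_sub_le_log hd hB zero_mem_unitDisk ha
  have h1 : defect (mobius 0 a) = defect a := by simp [mobius, defect]
  rw [h1] at h
  have := norm_le_norm_add_norm_sub' (g a) (g 0)
  linarith

/-! ### Kernel integrals and the Bergman projection -/

lemma hasDerivAt_kern (b : ℝ) {z u : ℂ} (hz : z ∈ unitDisk) (hu : u ∈ unitDisk) :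
    HasDerivAt (fun z => kern b z u) (b * conj u * kern (b + 1) z u) z := by
  have hs := one_sub_mul_conj_mem_slitPlane hz hu
  have h0 := Complex.slitPlane_ne_zero hs
  have h1 : HasDerivAt (fun z : ℂ => 1 - z * conj u) (-conj u) z := by
    simpa using ((hasDerivAt_id z).mul_const (conj u)).const_sub 1
  have h2 := h1.cpow_const (c := (-b : ℂ)) hs
  have h3 : (fun z => kern b z u) = fun z => (1 - z * conj u) ^ (-b : ℂ) := by
    ext z; rw [kern, Complex.cpow_neg, one_div]
  rw [h3]
  refine h2.congr_deriv ?_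
  rw [kern, one_div, ← Complex.cpow_neg]
  push_cast
  rw [show (-(b + 1) : ℂ) = -b - 1 by ring]
  ring

/-- Differentiation under the integral sign for kernel integrals. -/
theorem hasDerivAt_integral_mul_kern {ν : Measure ℂ} (hν : ∀ᵐ u ∂ν, u ∈ unitDisk) (b : ℝ)
    {φ : ℂ → ℂ} (hφ : Integrable φ ν) {z : ℂ} (hz : z ∈ unitDisk) :
    HasDerivAt (fun z => ∫ u, φ u * kern b z u ∂ν)
      (∫ u, φ u * (b * conj u * kern (b + 1) z u) ∂ν) z := by
  have hz1 := mem_unitDisk.1 hz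
  -- On the ball of radius ε about z the distance to the circle stays at least ε, so `norm_kern_le`
  -- gives a dominating function independent of the point.
  set ε := (1 - ‖z‖) / 2 with hε
  have hε0 : 0 < ε := by rw [hε]; linarith
  have hball : ∀ x ∈ Metric.ball z ε, x ∈ unitDisk ∧ ε ≤ 1 - ‖x‖ := by
    intro x hx
    have h1 : ‖x - z‖ < ε := by simpa [dist_eq_norm] using hx
    have h2 := norm_le_norm_add_norm_sub' x z
    refine ⟨mem_unitDisk.2 ?_, ?_⟩ <;> linarith
  have hmeas : ∀ c : ℝ, ∀ x ∈ unitDisk, AEStronglyMeasurable (kern c x) ν := fun c x hx =>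
    aestronglyMeasurable_of_continuousOn hν (continuousOn_kern c hx)
  refine (hasDerivAt_integral_of_dominated_loc_of_deriv_le (Metric.ball_mem_nhds z hε0)
    (F := fun z u => φ u * kern b z u) (F' := fun z u => φ u * (b * conj u * kern (b + 1) z u))
    (bound := fun u => ‖φ u‖ * (|b| * 1 * (ε ^ (-|b + 1|) * 2 ^ |b + 1|)))
    ?_ ?_ ?_ ?_ ?_ ?_).2
  · filter_upwards [Metric.ball_mem_nhds z hε0] with x hx
    exact hφ.1.mul (hmeas b x (hball x hx).1)
  · exact hφ.mul_bdd (hmeas b z hz) (hν.mono fun u hu => norm_kern_le b hz hu)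
  · exact hφ.1.mul ((Continuous.aestronglyMeasurable (by fun_prop)).mul (hmeas (b + 1) z hz))
  · filter_upwards [hν] with u hu x hx
    obtain ⟨hx1, hx2⟩ := hball x hx
    rw [norm_mul, norm_mul, norm_mul, RCLike.norm_conj, Complex.norm_real, Real.norm_eq_abs]
    have h1 : ‖kern (b + 1) x u‖ ≤ ε ^ (-|b + 1|) * 2 ^ |b + 1| := by
      refine (norm_kern_le (b + 1) hx1 hu).trans ?_
      refine mul_le_mul_of_nonneg_right ?_ (by positivity)
      exact Real.rpow_le_rpow_of_nonpos hε0 hx2 (by simp)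
    have h2 := (mem_unitDisk.1 hu).le
    gcongr
  · exact hφ.norm.mul_const _
  · filter_upwards [hν] with u hu x hx
    exact (hasDerivAt_kern b (hball x hx).1 hu).const_mul _

lemma norm_integral_le_of_lintegral_le {ν : Measure ℂ} {F : ℂ → ℂ} {c : ℝ} (hc : 0 ≤ c)
    (h : ∫⁻ u, ‖F u‖ₑ ∂ν ≤ ENNReal.ofReal c) : ‖∫ u, F u ∂ν‖ ≤ c := by
  have h1 := (enorm_integral_le_lintegral_enorm F).trans h
  rwa [← ofReal_norm, ENNReal.ofReal_le_ofReal_iff hc] at h1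

/-- The Bergman projection, up to a normalizing constant. -/
noncomputable def bergmanProj (β : ℝ) (φ : ℂ → ℂ) (w : ℂ) : ℂ :=
  ∫ u, φ u * kern (2 + β) w u ∂weightedArea β

lemma integrable_of_norm_le {γ : ℝ} (hγ : -1 < γ) {φ : ℂ → ℂ}
    (hm : AEStronglyMeasurable φ (weightedArea γ)) {M : ℝ} (hM : ∀ z ∈ unitDisk, ‖φ z‖ ≤ M) :
    Integrable φ (weightedArea γ) := by
  have := isFiniteMeasure_weightedArea hγ
  exact Integrable.of_bound hm M ((ae_mem_unitDisk γ).mono hM)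

lemma differentiableOn_integral_mul_kern {ν : Measure ℂ} (hν : ∀ᵐ u ∂ν, u ∈ unitDisk) (b : ℝ)
    {φ : ℂ → ℂ} (hφ : Integrable φ ν) :
    DifferentiableOn ℂ (fun z => ∫ u, φ u * kern b z u ∂ν) unitDisk := fun _ hz =>
  (hasDerivAt_integral_mul_kern hν b hφ hz).differentiableAt.differentiableWithinAt

/-- The Bergman projection maps bounded functions to Bloch functions. -/
theorem exists_bloch_bound_bergmanProj {β : ℝ} (hβ : -1 < β) :
    ∃ B : ℝ, 0 < B ∧ ∀ φ : ℂ → ℂ, Measurable φ → (∀ z, ‖φ z‖ ≤ 1) →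
      DifferentiableOn ℂ (bergmanProj β φ) unitDisk ∧ ‖bergmanProj β φ 0‖ ≤ B ∧
      ∀ z ∈ unitDisk, defect z * ‖deriv (bergmanProj β φ) z‖ ≤ B := by
  -- The exponent t = 1 appears because differentiation raises the kernel exponent 2+β by one.
  obtain ⟨C, hC, hFR⟩ := lintegral_absKernel_le hβ one_pos
  have hm0 := mass_pos hβ
  have h2β : 0 < 2 + β := by linarith
  refine ⟨(2 + β) * C + mass β, by positivity, fun φ hφ hφ1 => ?_⟩
  have hint : Integrable φ (weightedArea β) :=
    integrable_of_norm_le hβ hφ.aestronglyMeasurable fun z _ => hφ1 z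
  have hfin := isFiniteMeasure_weightedArea hβ
  refine ⟨differentiableOn_integral_mul_kern (ae_mem_unitDisk β) _ hint, ?_, fun z hz => ?_⟩
  · have : ‖bergmanProj β φ 0‖ ≤ 1 * mass β :=
      norm_integral_le_of_norm_le_const (ae_of_all _ fun u => by
        rw [norm_mul, norm_kern]; simpa using hφ1 u)
    nlinarith [mul_pos h2β hC]
  · have hd := defect_pos hz
    have hder : deriv (bergmanProj β φ) z = _ :=
      (hasDerivAt_integral_mul_kern (ae_mem_unitDisk β) (2 + β) hint hz).deriv
    have hle : ‖deriv (bergmanProj β φ) z‖ ≤ (2 + β) * (C * defect z ^ (-1 : ℝ)) := by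
      rw [hder]
      refine norm_integral_le_of_lintegral_le (by positivity) ?_
      calc _ ≤ ∫⁻ u, ENNReal.ofReal (2 + β) * absKernel (2 + β + 1) z u ∂weightedArea β := by
            refine lintegral_mono_weightedArea fun u hu => ?_
            rw [← enorm_kern, ← ofReal_norm, ← ofReal_norm (kern _ _ _),
              ← ENNReal.ofReal_mul h2β.le]
            refine ENNReal.ofReal_le_ofReal ?_
            rw [norm_mul, norm_mul, norm_mul, RCLike.norm_conj, Complex.norm_of_nonneg h2β.le]
            have h1 := hφ1 u
            have h2 := (mem_unitDisk.1 hu).le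
            calc ‖φ u‖ * ((2 + β) * ‖u‖ * ‖kern (2 + β + 1) z u‖)
                ≤ 1 * ((2 + β) * 1 * ‖kern (2 + β + 1) z u‖) := by gcongr
              _ = _ := by ring
        _ = ENNReal.ofReal (2 + β) * ∫⁻ u, absKernel (2 + β + 1) z u ∂weightedArea β :=
            lintegral_const_mul' _ _ (by simp)
        _ ≤ _ := by
            rw [ENNReal.ofReal_mul h2β.le]
            exact mul_le_mul' le_rfl (hFR z hz)
    rw [Real.rpow_neg_one] at hle
    calc defect z * ‖deriv (bergmanProj β φ) z‖ ≤ defect z * ((2 + β) * (C * (defect z)⁻¹)) := by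
          gcongr
      _ = (2 + β) * C := by field_simp
      _ ≤ _ := by linarith

/-! ### Embedding of the A^p norm into a weighted L¹ norm -/

lemma bergmanNorm_eq {p α : ℝ} (hp : 0 < p) (f : ℂ → ℂ) :
    bergmanNorm p α f = (∫⁻ z, ‖f z‖ₑ ^ p ∂weightedArea α) ^ (1 / p) := by
  unfold bergmanNorm
  rw [eLpNorm_eq_lintegral_rpow_enorm_toReal (by simpa using hp) (by simp),
    ENNReal.toReal_ofReal hp.le]

lemma bergmanNorm_one_eq {α : ℝ} (f : ℂ → ℂ) :
    bergmanNorm 1 α f = ∫⁻ z, ‖f z‖ₑ ∂weightedArea α := by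
  rw [bergmanNorm_eq one_pos]; simp

/-- For `0 < p ≤ 1`, bounded functions of `A^p_α` are controlled in the `L¹` norm with
weight exponent `(2 + α) / p - 2`. -/
theorem lintegral_le_bergmanNorm {p α : ℝ} (hp0 : 0 < p) (hp1 : p ≤ 1) (hα : -1 < α) :
    ∃ C : ℝ≥0∞, C ≠ ∞ ∧ ∀ f : ℂ → ℂ, DifferentiableOn ℂ f unitDisk →
      (∃ M : ℝ, ∀ z ∈ unitDisk, ‖f z‖ ≤ M) →
      ∫⁻ z, ‖f z‖ₑ ∂weightedArea ((2 + α) / p - 2) ≤ C * bergmanNorm p α f := by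
  set s := (2 + α) / p with hs
  have hps : s * p = 2 + α := by rw [hs]; field_simp
  have hs1 : 1 < s := by rw [hs, lt_div_iff₀ hp0]; nlinarith
  have hγ : -1 < s - 2 := by linarith
  have hm := mass_pos hγ
  set K : ℝ := 2 ^ s / mass (s - 2) with hK
  have hK0 : 0 < K := by positivity
  set c : ℝ≥0∞ := ENNReal.ofReal ((1 + (s - 2)) / (1 + α)) with hc
  refine ⟨(c * ENNReal.ofReal K ^ (1 - p)) ^ (1 / p), ?_, fun f hd hb => ?_⟩
  · refine ENNReal.rpow_ne_top_of_nonneg (by positivity) (ENNReal.mul_ne_top (by simp [hc]) ?_)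
    exact ENNReal.rpow_ne_top_of_nonneg (by linarith) (by simp)
  obtain ⟨M, hM⟩ := hb
  have hint : Integrable f (weightedArea (s - 2)) := integrable_of_norm_le hγ
    (aestronglyMeasurable_of_continuousOn (ae_mem_unitDisk _) hd.continuousOn) hM
  set I := ∫⁻ z, ‖f z‖ₑ ∂weightedArea (s - 2) with hI
  have hI_top : I ≠ ∞ := hint.2.ne
  -- A pointwise bound by the very L¹ norm I to be estimated: the reproducing formula with weight
  -- s-2, together with |1 - z ū| ≥ d(z)/2, which accounts for the factor 2^s in K.
  have hpt : ∀ z ∈ unitDisk, ‖f z‖ₑ ≤ ENNReal.ofReal K * I * ENNReal.ofReal (defect z ^ (-s)) := by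
    intro z hz
    have hdz := defect_pos hz
    have hrep := integral_mul_kern hγ hd hint hz
    have h1 : ‖(mass (s - 2) : ℂ) * f z‖ₑ ≤ I * ENNReal.ofReal ((defect z / 2) ^ (-s)) := by
      rw [← hrep]
      refine (enorm_integral_le_lintegral_enorm _).trans ?_
      rw [hI, ← lintegral_mul_const' _ _ (by simp)]
      refine lintegral_mono_weightedArea fun u hu => ?_
      rw [enorm_mul, enorm_kern, absKernel, show 2 + (s - 2) = s by ring]
      refine mul_le_mul' le_rfl (ENNReal.ofReal_le_ofReal ?_)
      exact Real.rpow_le_rpow_of_nonpos (by positivity) (by linarith [defect_le_norm hz hu])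
        (by linarith)
    have h2 : (defect z / 2) ^ (-s) = 2 ^ s * defect z ^ (-s) := by
      rw [Real.div_rpow hdz.le (by norm_num), Real.rpow_neg (x := 2) (by norm_num), div_inv_eq_mul,
        mul_comm]
    have h3 : ‖(mass (s - 2) : ℂ)‖ₑ = ENNReal.ofReal (mass (s - 2)) := by
      rw [← ofReal_norm, Complex.norm_of_nonneg hm.le]
    rw [enorm_mul, h3, h2, ENNReal.ofReal_mul (by positivity)] at h1
    have h4 : ENNReal.ofReal (mass (s - 2)) ≠ 0 := by simpa using hm
    rw [ENNReal.mul_le_iff_le_inv h4 (by simp)] at h1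
    refine h1.trans (le_of_eq ?_)
    rw [hK, ENNReal.ofReal_div_of_pos hm, div_eq_mul_inv]
    ring
  set J := ∫⁻ z, ‖f z‖ₑ ^ p ∂weightedArea α with hJ
  have hp1' : 0 ≤ 1 - p := by linarith
  set Q : ℝ≥0∞ := (ENNReal.ofReal K * I) ^ (1 - p) with hQ
  have hQ_top : Q ≠ ∞ :=
    ENNReal.rpow_ne_top_of_nonneg hp1' (ENNReal.mul_ne_top (by simp) hI_top)
  have hsplit : ∀ x : ℝ≥0∞, x = x ^ p * x ^ (1 - p) := fun x => by
    rw [← ENNReal.rpow_add_of_nonneg _ _ hp0.le hp1', add_sub_cancel, ENNReal.rpow_one]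
  -- Apply the pointwise bound to the factor |f|^(1-p) of |f| = |f|^p |f|^(1-p). Since sp = 2+α, the
  -- remaining weight d^(s-2-s(1-p)) is exactly d^α.
  have hIJ : I ≤ c * (J * Q) := by
    rw [hI, lintegral_weightedArea_change hα hγ, ← lintegral_mul_const' _ _ hQ_top]
    refine mul_le_mul' le_rfl (lintegral_mono_weightedArea fun z hz => ?_)
    have hdz := defect_pos hz
    calc ENNReal.ofReal (defect z ^ (s - 2 - α)) * ‖f z‖ₑ
        = ENNReal.ofReal (defect z ^ (s - 2 - α)) * (‖f z‖ₑ ^ p * ‖f z‖ₑ ^ (1 - p)) := by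
          rw [← hsplit]
      _ ≤ ENNReal.ofReal (defect z ^ (s - 2 - α)) * (‖f z‖ₑ ^ p *
            (Q * ENNReal.ofReal (defect z ^ (-s)) ^ (1 - p))) := by
          rw [hQ, ← ENNReal.mul_rpow_of_nonneg _ _ hp1']
          gcongr
          exact hpt z hz
      _ = ‖f z‖ₑ ^ p * Q := by
          rw [ENNReal.ofReal_rpow_of_pos (by positivity), ← Real.rpow_mul hdz.le]
          have : ENNReal.ofReal (defect z ^ (s - 2 - α)) *
              ENNReal.ofReal (defect z ^ (-s * (1 - p))) = 1 := by
            rw [← ENNReal.ofReal_mul (by positivity), ← Real.rpow_add hdz,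
              show s - 2 - α + -s * (1 - p) = 0 by linarith, Real.rpow_zero, ENNReal.ofReal_one]
          calc _ = ENNReal.ofReal (defect z ^ (s - 2 - α)) *
              ENNReal.ofReal (defect z ^ (-s * (1 - p))) * (‖f z‖ₑ ^ p * Q) := by ring
            _ = _ := by rw [this, one_mul]
  rw [bergmanNorm_eq hp0, ← hJ, ← ENNReal.mul_rpow_of_nonneg _ _ (by positivity)]
  -- The inequality contains I^(1-p) on the right. Dividing it out needs 0 < I < ∞, and finiteness
  -- is where the boundedness of f enters.
  by_cases hI0 : I = 0
  · rw [hI0]; exact zero_le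
  have hIp : I ^ (1 - p) ≠ 0 := by
    simp [ENNReal.rpow_eq_zero_iff, hI0, hI_top]
  have hIp' : I ^ (1 - p) ≠ ∞ := ENNReal.rpow_ne_top_of_nonneg hp1' hI_top
  have hfin : I ^ p ≤ c * ENNReal.ofReal K ^ (1 - p) * J := by
    rw [← ENNReal.mul_le_mul_iff_right hIp hIp', mul_comm, ← hsplit I]
    refine hIJ.trans (le_of_eq ?_)
    rw [hQ, ENNReal.mul_rpow_of_nonneg _ _ hp1']; ring
  calc I = (I ^ p) ^ (1 / p) := by
        rw [← ENNReal.rpow_mul, mul_one_div_cancel hp0.ne', ENNReal.rpow_one]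
    _ ≤ _ := by gcongr

lemma one_lt_exponent {p α : ℝ} (hp0 : 0 < p) (hp1 : p ≤ 1) (hα : -1 < α) : 1 < (2 + α) / p := by
  rw [lt_div_iff₀ hp0]; nlinarith

/-! ### Consequences of the Carleson condition -/

/-- The integral form of the Carleson condition. -/
lemma IsCarleson.exists_lintegral_le {μ : Measure ℂ} {p α : ℝ} (hp0 : 0 < p)
    (h : IsCarleson μ (1 / p) 1 α) :
    ∃ C : ℝ, 0 < C ∧ ∀ f : ℂ → ℂ, DifferentiableOn ℂ f unitDisk → ∀ A : ℝ, 0 ≤ A →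
      ∫⁻ w, ‖f w‖ₑ ∂weightedArea α ≤ ENNReal.ofReal A →
      ∫⁻ w, ‖f w‖ₑ ^ (1 / p) ∂μ ≤ ENNReal.ofReal ((C * A) ^ (1 / p)) := by
  obtain ⟨C, hC, hcar⟩ := h
  refine ⟨C, hC, fun f hd A hA hle => ?_⟩
  have hb : bergmanNorm 1 α f ≤ ENNReal.ofReal A := by rwa [bergmanNorm_one_eq]
  have h1 := hcar f ⟨hd, hb.trans_lt ENNReal.ofReal_lt_top⟩
  have hq : 0 < 1 / p := by positivity
  rw [eLpNorm_eq_lintegral_rpow_enorm_toReal (by simpa using hp0) (by simp),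
    ENNReal.toReal_ofReal hq.le] at h1
  have h2 : (∫⁻ w, ‖f w‖ₑ ^ (1 / p) ∂μ) ^ (1 / (1 / p)) ≤ ENNReal.ofReal (C * A) := by
    refine h1.trans ?_
    rw [ENNReal.ofReal_mul (NNReal.coe_nonneg C), ENNReal.ofReal_coe_nnreal]
    gcongr
  have h3 := ENNReal.rpow_le_rpow h2 hq.le
  rwa [← ENNReal.rpow_mul, one_div_mul_cancel hq.ne', ENNReal.rpow_one,
    ENNReal.ofReal_rpow_of_nonneg (by positivity) hq.le] at h3

lemma differentiableOn_kern (b : ℝ) {a : ℂ} (ha : a ∈ unitDisk) :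
    DifferentiableOn ℂ (fun w => kern b w a) unitDisk := fun _ hw =>
  (hasDerivAt_kern b hw ha).differentiableAt.differentiableWithinAt

lemma absKernel_rpow (b : ℝ) {r : ℝ} (hr : 0 ≤ r) (z w : ℂ) :
    absKernel b z w ^ r = absKernel (r * b) z w := by
  unfold absKernel
  rw [ENNReal.ofReal_rpow_of_nonneg (by positivity) hr, ← Real.rpow_mul (norm_nonneg _)]
  congr 2; ring

/-- Kernel test for Carleson measures. -/
theorem IsCarleson.exists_lintegral_absKernel_le {μ : Measure ℂ} {p α : ℝ} (hp0 : 0 < p)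
    (hα : -1 < α) (h : IsCarleson μ (1 / p) 1 α) {t : ℝ} (ht : 0 < t) :
    ∃ C : ℝ, 0 < C ∧ ∀ a ∈ unitDisk,
      ∫⁻ w, absKernel ((2 + α) / p + t) a w ∂μ ≤ ENNReal.ofReal (C * defect a ^ (-t)) := by
  obtain ⟨C, hC, hcar⟩ := h.exists_lintegral_le hp0
  -- The test function has kernel exponent 2+α+pt, so that its power 1/p has exponent (2+α)/p + t.
  obtain ⟨C', hC', hFR⟩ := lintegral_absKernel_le hα (t := p * t) (by positivity)
  refine ⟨(C * C') ^ (1 / p), by positivity, fun a ha => ?_⟩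
  have hda := defect_pos ha
  have h1 := hcar (fun w => kern (2 + α + p * t) w a) (differentiableOn_kern _ ha)
    (C' * defect a ^ (-(p * t))) (by positivity)
    (by simpa only [enorm_kern, absKernel_comm _ _ a] using hFR a ha)
  have h2 : ∀ w, ‖kern (2 + α + p * t) w a‖ₑ ^ (1 / p) = absKernel ((2 + α) / p + t) a w := by
    intro w
    rw [enorm_kern, absKernel_rpow _ (by positivity), absKernel_comm]
    congr 1; field_simp
  simp only [h2] at h1
  refine h1.trans (le_of_eq ?_)
  rw [← mul_assoc, Real.mul_rpow (by positivity) (by positivity), ← Real.rpow_mul hda.le]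
  congr 3; field_simp

/-- Mean oscillation of Bloch functions against Carleson measures. -/
theorem IsCarleson.exists_lintegral_bloch_le {μ : Measure ℂ}
    {p α : ℝ} (hp0 : 0 < p) (hp1 : p ≤ 1)
    (hα : -1 < α) (h : IsCarleson μ (1 / p) 1 α) {B : ℝ} (hB0 : 0 < B) :
    ∃ C : ℝ, 0 < C ∧ ∀ g : ℂ → ℂ, DifferentiableOn ℂ g unitDisk →
      (∀ z ∈ unitDisk, defect z * ‖deriv g z‖ ≤ B) → ∀ a ∈ unitDisk,
      ∫⁻ w, ‖g w - g a‖ₑ * absKernel ((2 + α) / p + 1) a w ∂μ ≤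
        ENNReal.ofReal (C * defect a ^ (-1 : ℝ)) := by
  obtain ⟨C, hC, hcar⟩ := h.exists_lintegral_le hp0
  obtain ⟨C₁, hC₁, hker⟩ := h.exists_lintegral_absKernel_le hp0 hα one_pos
  -- The logarithmic growth of g - g(a) is weakened to a power ε of 1/d(`mobius a w`). Here ε < α+1
  -- keeps the shifted weight α-ε above -1, and ε < p leaves a positive Forelli–Rudin exponent p-ε.
  set ε := min p (α + 1) / 2 with hε
  have hm : 0 < min p (α + 1) := lt_min hp0 (by linarith)
  have hε0 : 0 < ε := by positivity
  have hεp : ε < p := by have := min_le_left p (α + 1); linarith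
  have hεα : -1 < α - ε := by have := min_le_right p (α + 1); linarith
  obtain ⟨C', hC', hFR⟩ := lintegral_absKernel_le hεα (t := p - ε) (by linarith)
  set c : ℝ := (1 + α) / (1 + (α - ε)) with hc
  have hc0 : 0 < c := div_pos (by linarith) (by linarith)
  set A : ℝ := B * (2 ^ ε / ε) with hA
  have hA0 : 0 < A := by positivity
  refine ⟨C₁ + (C * (A * c * C')) ^ (1 / p), by positivity, fun g hd hB a ha => ?_⟩
  have hda := defect_pos ha
  have hint : ∫⁻ w, ‖(g w - g a) * kern (2 + α + p) w a‖ₑ ∂weightedArea α ≤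
      ENNReal.ofReal (A * c * C' * defect a ^ (-p)) := by
    calc _ ≤ ∫⁻ w, ENNReal.ofReal (A * defect a ^ (-ε)) * (ENNReal.ofReal (defect w ^ (-ε)) *
            absKernel (2 + (α - ε) + (p - ε)) a w) ∂weightedArea α := by
          refine lintegral_mono_weightedArea fun w hw => ?_
          have hdw := defect_pos hw
          have hN := norm_one_sub_pos hw ha
          have hdm := defect_pos (mobius_mem ha hw)
          rw [absKernel_comm, absKernel, ← ENNReal.ofReal_mul (by positivity),
            ← ENNReal.ofReal_mul (by positivity), ← ofReal_norm, norm_mul, norm_kern]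
          refine ENNReal.ofReal_le_ofReal ?_
          have h1 : ‖g w - g a‖ ≤ A * (defect a ^ (-ε) * defect w ^ (-ε) *
              ‖1 - w * conj a‖ ^ (2 * ε)) := by
            refine (norm_sub_le_log hd hB ha hw).trans ?_
            have h2 := Real.log_le_rpow_div (x := 2 / defect (mobius a w)) (by positivity) hε0
            refine (mul_le_mul_of_nonneg_left h2 hB0.le).trans (le_of_eq ?_)
            rw [defect_mobius ha hw, hA, Real.div_rpow (by norm_num) (by positivity),
              Real.div_rpow (by positivity) (by positivity), Real.mul_rpow hda.le hdw.le,
              Real.rpow_neg hda.le, Real.rpow_neg hdw.le, Real.rpow_mul hN.le]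
            norm_cast
            field_simp
          calc ‖g w - g a‖ * ‖1 - w * conj a‖ ^ (-(2 + α + p))
              ≤ A * (defect a ^ (-ε) * defect w ^ (-ε) * ‖1 - w * conj a‖ ^ (2 * ε)) *
                ‖1 - w * conj a‖ ^ (-(2 + α + p)) := by gcongr
            _ = A * defect a ^ (-ε) * (defect w ^ (-ε) * (‖1 - w * conj a‖ ^ (2 * ε) *
                ‖1 - w * conj a‖ ^ (-(2 + α + p)))) := by ring
            _ = _ := by
                rw [← Real.rpow_add hN]
                congr 3; ring
      _ = ENNReal.ofReal (A * defect a ^ (-ε)) * (ENNReal.ofReal c *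
            ∫⁻ w, absKernel (2 + (α - ε) + (p - ε)) a w ∂weightedArea (α - ε)) := by
          rw [lintegral_const_mul' _ _ (by simp), lintegral_weightedArea_change hεα hα]
          congr 2
          refine lintegral_congr_weightedArea fun w hw => ?_
          have hdw := defect_pos hw
          rw [← mul_assoc, ← ENNReal.ofReal_mul (by positivity), ← Real.rpow_add hdw,
            show α - (α - ε) + -ε = 0 by ring, Real.rpow_zero, ENNReal.ofReal_one, one_mul]
      _ ≤ ENNReal.ofReal (A * defect a ^ (-ε)) * (ENNReal.ofReal c *
            ENNReal.ofReal (C' * defect a ^ (-(p - ε)))) := by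
          gcongr
          exact hFR a ha
      _ = _ := by
          rw [← ENNReal.ofReal_mul hc0.le, ← ENNReal.ofReal_mul (by positivity)]
          congr 1
          have : defect a ^ (-p) = defect a ^ (-ε) * defect a ^ (-(p - ε)) := by
            rw [← Real.rpow_add hda]; congr 1; ring
          rw [this]; ring
  have h1 := hcar _ ((hd.sub_const (g a)).mul (differentiableOn_kern (2 + α + p) ha)) _
    (by positivity) hint
  calc _ ≤ ∫⁻ w, absKernel ((2 + α) / p + 1) a w +
        ‖(g w - g a) * kern (2 + α + p) w a‖ₑ ^ (1 / p) ∂μ := by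
        refine lintegral_mono fun w => ?_
        have h2 : ‖(g w - g a) * kern (2 + α + p) w a‖ₑ ^ (1 / p) =
            ‖g w - g a‖ₑ ^ (1 / p) * absKernel ((2 + α) / p + 1) a w := by
          rw [enorm_mul, ENNReal.mul_rpow_of_nonneg _ _ (by positivity), enorm_kern,
            absKernel_rpow _ (by positivity), absKernel_comm]
          congr 2; field_simp
        rw [h2]
        -- The Carleson condition controls the power 1/p ≥ 1, not the first power. The bound x ≤ 1 +
        -- x^(1/p) bridges the gap, its constant term being covered by the kernel test.
        have h3 : ‖g w - g a‖ₑ ≤ 1 + ‖g w - g a‖ₑ ^ (1 / p) := by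
          rcases le_total ‖g w - g a‖ₑ 1 with h | h
          · exact h.trans le_self_add
          · refine le_trans ?_ le_add_self
            calc ‖g w - g a‖ₑ = ‖g w - g a‖ₑ ^ (1 : ℝ) := (ENNReal.rpow_one _).symm
              _ ≤ _ := ENNReal.rpow_le_rpow_of_exponent_le h (by
                rw [le_div_iff₀ hp0]; linarith)
        calc _ ≤ (1 + ‖g w - g a‖ₑ ^ (1 / p)) * absKernel ((2 + α) / p + 1) a w := by gcongr
          _ = _ := by ring
    _ = ∫⁻ w, absKernel ((2 + α) / p + 1) a w ∂μ +
        ∫⁻ w, ‖(g w - g a) * kern (2 + α + p) w a‖ₑ ^ (1 / p) ∂μ :=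
        lintegral_add_left (measurable_absKernel _ _) _
    _ ≤ ENNReal.ofReal (C₁ * defect a ^ (-1 : ℝ)) +
        ENNReal.ofReal ((C * (A * c * C' * defect a ^ (-p))) ^ (1 / p)) :=
        add_le_add (hker a ha) h1
    _ = _ := by
        rw [← ENNReal.ofReal_add (by positivity) (by positivity)]
        congr 1
        rw [← mul_assoc, Real.mul_rpow (by positivity) (by positivity), ← Real.rpow_mul hda.le,
          show -p * (1 / p) = -1 by field_simp]
        ring

/-! ### Duality with the Bergman projection, and dilations -/

lemma toeplitz_eq (μ : Measure ℂ) (β : ℝ) (f : ℂ → ℂ) (z : ℂ) :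
    toeplitz μ β f z = ∫ w, f w * kern (2 + β) z w ∂μ := by
  unfold toeplitz kern
  simp only [mul_one_div]

lemma measurable_kern_comp {X : Type*} [MeasurableSpace X] (b : ℝ) {F G : X → ℂ}
    (hF : Measurable F) (hG : Measurable G) : Measurable fun x => kern b (F x) (G x) := by
  unfold kern
  have : Measurable fun x => (conj (G x)) := Complex.continuous_conj.measurable.comp hG
  fun_prop

lemma ofReal_mul_mem {r : ℝ} (hr0 : 0 ≤ r) (hr1 : r ≤ 1) {w : ℂ} (hw : w ∈ unitDisk) :
    (r : ℂ) * w ∈ unitDisk := by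
  rw [mem_unitDisk, norm_mul, Complex.norm_of_nonneg hr0]
  nlinarith [mem_unitDisk.1 hw, norm_nonneg w]

lemma norm_ofReal_mul_le {r : ℝ} (hr0 : 0 ≤ r) {w : ℂ} (hw : w ∈ unitDisk) :
    ‖(r : ℂ) * w‖ ≤ r := by
  rw [norm_mul, Complex.norm_of_nonneg hr0]
  nlinarith [mem_unitDisk.1 hw, norm_nonneg w]

lemma kern_ofReal_mul (b r : ℝ) (z w : ℂ) : kern b (r * z) w = kern b z (r * w) := by
  unfold kern
  congr 3
  rw [map_mul, Complex.conj_ofReal]; ring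

/-- The dilation keeps the first argument away from the circle, so the kernel is bounded in both
variables at once; this justifies Fubini for the dilated pairing. -/
lemma norm_kern_ofReal_mul_le (b : ℝ) {r : ℝ} (hr0 : 0 ≤ r) (hr1 : r < 1) {w u : ℂ}
    (hw : w ∈ unitDisk) (hu : u ∈ unitDisk) :
    ‖kern b (r * w) u‖ ≤ (1 - r) ^ (-|b|) * 2 ^ |b| := by
  refine (norm_kern_le b (ofReal_mul_mem hr0 hr1.le hw) hu).trans ?_
  have h := norm_ofReal_mul_le hr0 hw
  refine mul_le_mul_of_nonneg_right ?_ (by positivity)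
  exact Real.rpow_le_rpow_of_nonpos (by linarith) (by linarith) (by simp)

/-- The duality pairing of the Toeplitz operator, for dilated functions. -/
theorem integral_mul_toeplitz {μ : Measure ℂ} [IsFiniteMeasure μ]
    (hμ : ∀ᵐ w ∂μ, w ∈ unitDisk) {β : ℝ} (hβ : -1 < β) {f : ℂ → ℂ} (hf : Measurable f)
    {M : ℝ} (hM : ∀ w ∈ unitDisk, ‖f w‖ ≤ M) {φ : ℂ → ℂ} (hφ : Measurable φ)
    (hφ1 : ∀ u, ‖φ u‖ ≤ 1) {r : ℝ} (hr0 : 0 ≤ r) (hr1 : r < 1) :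
    ∫ u, conj (φ u) * toeplitz μ β f (r * u) ∂weightedArea β =
      ∫ w, f w * conj (bergmanProj β φ (r * w)) ∂μ := by
  have hfin := isFiniteMeasure_weightedArea hβ
  have hM0 : 0 ≤ M := (norm_nonneg _).trans (hM 0 zero_mem_unitDisk)
  have hφc : Measurable fun u => conj (φ u) := Complex.continuous_conj.measurable.comp hφ
  have hint : Integrable (Function.uncurry fun u w => conj (φ u) * (f w * kern (2 + β) (r * u) w))
      ((weightedArea β).prod μ) := by
    refine Integrable.of_bound (C := 1 * (M * ((1 - r) ^ (-|2 + β|) * 2 ^ |2 + β|))) ?_ ?_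
    · refine Measurable.aestronglyMeasurable ?_
      refine (hφc.comp measurable_fst).mul ((hf.comp measurable_snd).mul ?_)
      exact measurable_kern_comp _ (by fun_prop) (by fun_prop)
    · have h1 : ∀ᵐ q ∂((weightedArea β).prod μ), q.1 ∈ unitDisk :=
        Measure.quasiMeasurePreserving_fst.ae (ae_mem_unitDisk β)
      have h2 : ∀ᵐ q ∂((weightedArea β).prod μ), q.2 ∈ unitDisk :=
        Measure.quasiMeasurePreserving_snd.ae hμ
      filter_upwards [h1, h2] with q hq1 hq2
      simp only [Function.uncurry, norm_mul, RCLike.norm_conj]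
      have ha := hφ1 q.1
      have hb := hM _ hq2
      have hc := norm_kern_ofReal_mul_le (2 + β) hr0 hr1 hq1 hq2
      gcongr
  have hswap := integral_integral_swap hint
  have hL : ∀ u, ∫ w, conj (φ u) * (f w * kern (2 + β) (r * u) w) ∂μ =
      conj (φ u) * toeplitz μ β f (r * u) := fun u => by
    rw [toeplitz_eq, integral_const_mul]
  simp only [hL] at hswap
  rw [hswap]
  refine integral_congr_ae (hμ.mono fun w hw => ?_)
  simp only
  rw [bergmanProj, ← integral_conj, ← integral_const_mul]
  refine integral_congr_ae ((ae_mem_unitDisk β).mono fun u hu => ?_)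
  simp only
  rw [map_mul, conj_kern _ (ofReal_mul_mem hr0 hr1.le hw) hu, kern_ofReal_mul]
  ring

/-- Dilates of Bergman projections of bounded functions are uniformly Bloch, and bounded. -/
theorem exists_bloch_bound_dilate {β : ℝ} (hβ : -1 < β) :
    ∃ B : ℝ, 0 < B ∧ ∀ φ : ℂ → ℂ, Measurable φ → (∀ z, ‖φ z‖ ≤ 1) →
      ∀ r : ℝ, 0 ≤ r → r < 1 →
      DifferentiableOn ℂ (fun w => bergmanProj β φ (r * w)) unitDisk ∧
      ‖bergmanProj β φ (r * 0)‖ ≤ B ∧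
      (∀ z ∈ unitDisk, defect z * ‖deriv (fun w => bergmanProj β φ (r * w)) z‖ ≤ B) ∧
      ∃ M : ℝ, ∀ w ∈ unitDisk, ‖bergmanProj β φ (r * w)‖ ≤ M := by
  obtain ⟨B, hB, h⟩ := exists_bloch_bound_bergmanProj hβ
  have hfin := isFiniteMeasure_weightedArea hβ
  refine ⟨B, hB, fun φ hφ hφ1 r hr0 hr1 => ?_⟩
  obtain ⟨hd, h0, hbl⟩ := h φ hφ hφ1
  refine ⟨hd.comp (by fun_prop) fun w hw => ofReal_mul_mem hr0 hr1.le hw, by simpa using h0,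
    fun z hz => ?_, (1 - r) ^ (-|2 + β|) * 2 ^ |2 + β| * mass β, fun w hw => ?_⟩
  · have hz' := ofReal_mul_mem hr0 hr1.le hz
    have h1 : HasDerivAt (fun w : ℂ => (r : ℂ) * w) r z := by
      simpa using (hasDerivAt_id z).const_mul (r : ℂ)
    have h2 : HasDerivAt (fun w => bergmanProj β φ (r * w))
        (deriv (bergmanProj β φ) (r * z) * r) z :=
      (hd.differentiableAt (Metric.isOpen_ball.mem_nhds hz')).hasDerivAt.comp z h1
    rw [h2.deriv, norm_mul, Complex.norm_of_nonneg hr0]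
    refine le_trans ?_ (hbl _ hz')
    have h3 : defect z ≤ defect (r * z) := by
      unfold defect
      rw [norm_mul, Complex.norm_of_nonneg hr0]
      have hr2 : r ^ 2 ≤ 1 := pow_le_one₀ hr0 hr1.le
      nlinarith [mul_le_mul_of_nonneg_right hr2 (sq_nonneg ‖z‖)]
    have h4 := (defect_pos hz').le
    have h5 := norm_nonneg (deriv (bergmanProj β φ) (r * z))
    calc defect z * (‖deriv (bergmanProj β φ) (r * z)‖ * r)
        ≤ defect (r * z) * (‖deriv (bergmanProj β φ) (r * z)‖ * 1) := by gcongr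
      _ = _ := by rw [mul_one]
  · refine norm_integral_le_of_norm_le_const ((ae_mem_unitDisk β).mono fun u hu => ?_)
    rw [norm_mul]
    have h1 := norm_kern_ofReal_mul_le (2 + β) hr0 hr1 hw hu
    have h2 := hφ1 u
    calc _ ≤ 1 * ((1 - r) ^ (-|2 + β|) * 2 ^ |2 + β|) := by gcongr
      _ = _ := one_mul _

/-- A measurable unimodular sign of a function continuous on the disk. -/
lemma exists_measurable_sign {F : ℂ → ℂ} (hF : ContinuousOn F unitDisk) :
    ∃ φ : ℂ → ℂ, Measurable φ ∧ (∀ z, ‖φ z‖ ≤ 1) ∧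
      ∀ z ∈ unitDisk, conj (φ z) * F z = ‖F z‖ := by
  set F' := unitDisk.indicator F with hF'
  have hm : Measurable F' := measurable_indicator_of_continuousOn hF
  refine ⟨fun z => F' z / ‖F' z‖, by fun_prop, fun z => ?_, fun z hz => ?_⟩
  · rw [norm_div, Complex.norm_real, norm_norm]; exact div_self_le_one _
  · have : F' z = F z := Set.indicator_of_mem hz F
    simp only [this]
    by_cases h : F z = 0
    · simp [h]
    · have h1 : (‖F z‖ : ℂ) ≠ 0 := by simpa using h
      rw [map_div₀, Complex.conj_ofReal, div_mul_eq_mul_div, mul_comm, Complex.mul_conj,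
        Complex.normSq_eq_norm_sq]
      push_cast; field_simp

/-! ### The symbol T_μ(1) and the logarithmic Bloch condition -/

lemma differentiableOn_toeplitz {μ : Measure ℂ} [IsFiniteMeasure μ]
    (hμ : ∀ᵐ w ∂μ, w ∈ unitDisk) (β : ℝ) {f : ℂ → ℂ} (hf : Measurable f)
    {M : ℝ} (hM : ∀ w ∈ unitDisk, ‖f w‖ ≤ M) :
    DifferentiableOn ℂ (toeplitz μ β f) unitDisk := by
  have h := differentiableOn_integral_mul_kern hμ (2 + β)
    (Integrable.of_bound hf.aestronglyMeasurable M (hμ.mono hM))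
  refine h.congr fun z _ => toeplitz_eq μ β f z

lemma hasDerivAt_toeplitz_one {μ : Measure ℂ} [IsFiniteMeasure μ]
    (hμ : ∀ᵐ w ∂μ, w ∈ unitDisk) (s : ℝ) {z : ℂ} (hz : z ∈ unitDisk) :
    HasDerivAt (toeplitz μ (s - 2) fun _ => 1) (s * ∫ w, conj w * kern (s + 1) z w ∂μ) z := by
  have h := hasDerivAt_integral_mul_kern hμ s (φ := fun _ => 1) (integrable_const _) hz
  have h1 : (toeplitz μ (s - 2) fun _ => 1) = fun z => ∫ w, 1 * kern s z w ∂μ := by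
    ext z; rw [toeplitz_eq, add_sub_cancel]
  rw [h1, ← integral_const_mul]
  refine h.congr_deriv (integral_congr_ae (ae_of_all _ fun w => ?_))
  simp only; ring

lemma integrable_kern {μ : Measure ℂ} [IsFiniteMeasure μ]
    (hμ : ∀ᵐ w ∂μ, w ∈ unitDisk) (b : ℝ) {z : ℂ} (hz : z ∈ unitDisk) :
    Integrable (kern b z) μ :=
  Integrable.of_bound (measurable_kern_comp b measurable_const measurable_id).aestronglyMeasurable
    _ (hμ.mono fun _ hu => norm_kern_le b hz hu)

/-- Differentiating T_μ(1) yields ∫ w̄ `kern (s + 1)`, while the estimates need ∫ `kern (s + 1)`.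
Multiplying the kernel by 1 - z w̄ relates the two, with an error of lower order s. -/
lemma kern_eq_add (s : ℝ) {z w : ℂ} (hz : z ∈ unitDisk) (hw : w ∈ unitDisk) :
    kern (s + 1) z w = kern s z w + z * (conj w * kern (s + 1) z w) := by
  have h0 := one_sub_ne_zero hw hz
  have h1 : (1 - z * conj w) * kern (s + 1) z w = kern s z w := by
    unfold kern
    push_cast
    rw [Complex.cpow_add _ _ h0, Complex.cpow_one]
    field_simp
  rw [← h1]; ring

/-- The logarithmic Bloch condition on `T_μ(1)` in terms of kernel integrals. -/
theorem exists_log_mul_norm_le {μ : Measure ℂ} [IsFiniteMeasure μ]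
    (hμ : ∀ᵐ w ∂μ, w ∈ unitDisk) {p α : ℝ} (hp0 : 0 < p) (hp1 : p ≤ 1) (hα : -1 < α)
    (hcar : IsCarleson μ (1 / p) 1 α)
    (hlb : MemLogBloch 1 (toeplitz μ ((2 + α) / p - 2) fun _ => 1)) :
    ∃ C : ℝ, 0 < C ∧ ∀ a ∈ unitDisk, Real.log (2 / defect a) *
      ‖∫ w, kern ((2 + α) / p + 1) a w ∂μ‖ ≤ C * defect a ^ (-1 : ℝ) := by
  set s := (2 + α) / p with hs
  have hs1 : 1 < s := one_lt_exponent hp0 hp1 hα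
  obtain ⟨C, hC, hker⟩ := hcar.exists_lintegral_absKernel_le hp0 hα (t := 1 / 2) (by norm_num)
  obtain ⟨L, hL⟩ := hlb.2
  refine ⟨2 ^ (1 / 2 : ℝ) / (1 / 2) * (2 ^ (1 / 2 : ℝ) * C) + |L| / s, by positivity,
    fun a ha => ?_⟩
  have hda := defect_pos ha
  have hlog0 : 0 ≤ Real.log (2 / defect a) :=
    Real.log_nonneg (by rw [le_div_iff₀ hda]; linarith [defect_le_one a])
  -- The lower-order kernel is raised by exponent 1/2 to fit the Carleson kernel test and
  -- contributes d(a)^(-1/2). The logarithm costs at most another d(a)^(-1/2), so the product is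
  -- O(1/d(a)).
  have h1 : ‖∫ w, kern s a w ∂μ‖ ≤ 2 ^ (1 / 2 : ℝ) * C * defect a ^ (-(1 / 2) : ℝ) := by
    refine norm_integral_le_of_lintegral_le (by positivity) ?_
    rw [mul_assoc, ENNReal.ofReal_mul (by positivity)]
    refine le_trans ?_ (mul_le_mul' le_rfl (hker a ha))
    rw [← lintegral_const_mul' _ _ (by simp)]
    refine lintegral_mono_ae (hμ.mono fun w hw => ?_)
    rw [enorm_kern, absKernel, absKernel, ← ENNReal.ofReal_mul (by positivity)]
    refine ENNReal.ofReal_le_ofReal ?_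
    have hN := norm_one_sub_pos ha hw
    have hN2 := norm_one_sub_le_two ha hw
    calc ‖1 - a * conj w‖ ^ (-s) = ‖1 - a * conj w‖ ^ (1 / 2 : ℝ) *
          ‖1 - a * conj w‖ ^ (-(s + 1 / 2)) := by
          rw [← Real.rpow_add hN]; congr 1; ring
      _ ≤ _ := by gcongr
  have h2 : Real.log (2 / defect a) ≤ 2 ^ (1 / 2 : ℝ) / (1 / 2) * defect a ^ (-(1 / 2) : ℝ) := by
    refine (Real.log_le_rpow_div (ε := 1 / 2) (by positivity) (by norm_num)).trans (le_of_eq ?_)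
    rw [Real.div_rpow (by norm_num) hda.le, Real.rpow_neg hda.le]
    ring
  have h3 : Real.log (2 / defect a) * ‖∫ w, conj w * kern (s + 1) a w ∂μ‖ ≤
      |L| / s * defect a ^ (-1 : ℝ) := by
    have h4 := hL ⟨a, ha, rfl⟩
    simp only [Real.rpow_one, (hasDerivAt_toeplitz_one hμ s ha).deriv, norm_mul,
      Complex.norm_of_nonneg (by linarith : 0 ≤ s)] at h4
    have h5 : defect a * Real.log (2 / defect a) *
        (s * ‖∫ w, conj w * kern (s + 1) a w ∂μ‖) ≤ |L| := h4.trans (le_abs_self L)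
    rw [Real.rpow_neg_one, ← div_eq_mul_inv, div_div, le_div_iff₀ (by positivity)]
    linarith
  have hsplit : ∫ w, kern (s + 1) a w ∂μ =
      ∫ w, kern s a w ∂μ + a * ∫ w, conj w * kern (s + 1) a w ∂μ := by
    have hi : Integrable (fun w => conj w * kern (s + 1) a w) μ := by
      refine (integrable_kern hμ (s + 1) ha).bdd_mul (c := 1)
        Complex.continuous_conj.aestronglyMeasurable (hμ.mono fun w hw => ?_)
      rw [RCLike.norm_conj]; exact (mem_unitDisk.1 hw).le
    rw [← integral_const_mul, ← integral_add (integrable_kern hμ s ha) (hi.const_mul a)]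
    exact integral_congr_ae (hμ.mono fun w hw => kern_eq_add s ha hw)
  have h6 : ‖∫ w, kern (s + 1) a w ∂μ‖ ≤
      ‖∫ w, kern s a w ∂μ‖ + ‖∫ w, conj w * kern (s + 1) a w ∂μ‖ := by
    rw [hsplit]
    refine (norm_add_le _ _).trans ?_
    rw [norm_mul]
    gcongr
    exact mul_le_of_le_one_left (norm_nonneg _) (mem_unitDisk.1 ha).le
  have h7 : defect a ^ (-(1 / 2) : ℝ) * defect a ^ (-(1 / 2) : ℝ) = defect a ^ (-1 : ℝ) := by
    rw [← Real.rpow_add hda]; norm_num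
  calc _ ≤ Real.log (2 / defect a) *
        (‖∫ w, kern s a w ∂μ‖ + ‖∫ w, conj w * kern (s + 1) a w ∂μ‖) := by gcongr
    _ = Real.log (2 / defect a) * ‖∫ w, kern s a w ∂μ‖ +
        Real.log (2 / defect a) * ‖∫ w, conj w * kern (s + 1) a w ∂μ‖ := by ring
    _ ≤ 2 ^ (1 / 2 : ℝ) / (1 / 2) * defect a ^ (-(1 / 2) : ℝ) *
        (2 ^ (1 / 2 : ℝ) * C * defect a ^ (-(1 / 2) : ℝ)) + |L| / s * defect a ^ (-1 : ℝ) := by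
        gcongr
    _ = _ := by rw [← h7]; ring

/-! ### Sufficiency -/

/-- Testing a Bloch function against kernels, for a Carleson measure with a logarithmic
Bloch symbol. -/
theorem exists_norm_integral_bloch_le {μ : Measure ℂ} [IsFiniteMeasure μ]
    (hμ : ∀ᵐ w ∂μ, w ∈ unitDisk) {p α : ℝ} (hp0 : 0 < p) (hp1 : p ≤ 1) (hα : -1 < α)
    (hcar : IsCarleson μ (1 / p) 1 α)
    (hlb : MemLogBloch 1 (toeplitz μ ((2 + α) / p - 2) fun _ => 1)) {B : ℝ} (hB0 : 0 < B) :
    ∃ C : ℝ, 0 < C ∧ ∀ g : ℂ → ℂ, DifferentiableOn ℂ g unitDisk → ‖g 0‖ ≤ B →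
      (∀ z ∈ unitDisk, defect z * ‖deriv g z‖ ≤ B) → ∀ a ∈ unitDisk,
      ‖∫ w, g w * kern ((2 + α) / p + 1) a w ∂μ‖ ≤ C * defect a ^ (-1 : ℝ) := by
  set s := (2 + α) / p with hs
  obtain ⟨C₁, hC₁, hosc⟩ := hcar.exists_lintegral_bloch_le hp0 hp1 hα hB0
  obtain ⟨C₂, hC₂, hlog⟩ := exists_log_mul_norm_le hμ hp0 hp1 hα hcar hlb
  obtain ⟨C₃, hC₃, hker⟩ := hcar.exists_lintegral_absKernel_le hp0 hα one_pos
  refine ⟨C₁ + B * C₃ + B * C₂, by positivity, fun g hd hg0 hB a ha => ?_⟩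
  have hda := defect_pos ha
  have hk := integrable_kern hμ (s + 1) ha
  have h1 : ‖∫ w, (g w - g a) * kern (s + 1) a w ∂μ‖ ≤ C₁ * defect a ^ (-1 : ℝ) := by
    refine norm_integral_le_of_lintegral_le (by positivity) ?_
    simpa only [enorm_mul, enorm_kern] using hosc g hd hB a ha
  have hi : Integrable (fun w => (g w - g a) * kern (s + 1) a w) μ := by
    refine ⟨((aestronglyMeasurable_of_continuousOn hμ hd.continuousOn).sub aestronglyMeasurable_const).mul
      hk.1, ?_⟩
    refine lt_of_le_of_lt ?_ (ENNReal.ofReal_lt_top (r := C₁ * defect a ^ (-1 : ℝ)))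
    simpa only [enorm_mul, enorm_kern] using hosc g hd hB a ha
  -- Freeze g at a. The first term is an oscillation; in the second the growth of g(a) is at most
  -- logarithmic and is offset by `hlog`.
  have hsplit : ∫ w, g w * kern (s + 1) a w ∂μ =
      ∫ w, (g w - g a) * kern (s + 1) a w ∂μ + g a * ∫ w, kern (s + 1) a w ∂μ := by
    rw [← integral_const_mul, ← integral_add hi (hk.const_mul _)]
    congr 1; ext w; ring
  have h2 : ‖∫ w, kern (s + 1) a w ∂μ‖ ≤ C₃ * defect a ^ (-1 : ℝ) := by
    refine norm_integral_le_of_lintegral_le (by positivity) ?_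
    simpa only [enorm_kern] using hker a ha
  have h3 := norm_le_add_log hd hB ha
  have h4 := hlog a ha
  calc _ ≤ ‖∫ w, (g w - g a) * kern (s + 1) a w ∂μ‖ + ‖g a‖ * ‖∫ w, kern (s + 1) a w ∂μ‖ := by
        rw [hsplit, ← norm_mul]; exact norm_add_le _ _
    _ ≤ C₁ * defect a ^ (-1 : ℝ) + (B + B * Real.log (2 / defect a)) *
        ‖∫ w, kern (s + 1) a w ∂μ‖ := by
        gcongr
        exact h3.trans (by linarith)
    _ = C₁ * defect a ^ (-1 : ℝ) + B * ‖∫ w, kern (s + 1) a w ∂μ‖ +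
        B * (Real.log (2 / defect a) * ‖∫ w, kern (s + 1) a w ∂μ‖) := by ring
    _ ≤ C₁ * defect a ^ (-1 : ℝ) + B * (C₃ * defect a ^ (-1 : ℝ)) +
        B * (C₂ * defect a ^ (-1 : ℝ)) := by gcongr
    _ = _ := by ring

/-- The pairing of `A^p_α` with Bloch functions through the measure `μ`. -/
theorem exists_enorm_integral_mul_conj_le {μ : Measure ℂ} [IsFiniteMeasure μ]
    (hμ : ∀ᵐ w ∂μ, w ∈ unitDisk) {p α : ℝ} (hp0 : 0 < p) (hp1 : p ≤ 1) (hα : -1 < α)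
    (hcar : IsCarleson μ (1 / p) 1 α)
    (hlb : MemLogBloch 1 (toeplitz μ ((2 + α) / p - 2) fun _ => 1)) {B : ℝ} (hB0 : 0 < B) :
    ∃ C : ℝ≥0∞, C ≠ ∞ ∧ ∀ f g : ℂ → ℂ, Continuous f → DifferentiableOn ℂ f unitDisk →
      (∃ M : ℝ, ∀ z ∈ unitDisk, ‖f z‖ ≤ M) → DifferentiableOn ℂ g unitDisk → ‖g 0‖ ≤ B →
      (∀ z ∈ unitDisk, defect z * ‖deriv g z‖ ≤ B) →
      (∃ M : ℝ, ∀ z ∈ unitDisk, ‖g z‖ ≤ M) →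
      ‖∫ w, f w * conj (g w) ∂μ‖ₑ ≤ C * bergmanNorm p α f := by
  obtain ⟨C₁, hC₁, hbl⟩ := exists_norm_integral_bloch_le hμ hp0 hp1 hα hcar hlb hB0
  obtain ⟨C₂, hC₂, hemb⟩ := lintegral_le_bergmanNorm hp0 hp1 hα
  obtain ⟨C₃, hC₃, hker⟩ := hcar.exists_lintegral_absKernel_le hp0 hα one_pos
  have hs1 := one_lt_exponent hp0 hp1 hα
  set s := (2 + α) / p with hs
  -- Weight s-1 has reproducing kernel exponent s+1, the one tested against g. The resulting factor
  -- 1/d(a) lowers the weight to s-2, where `lintegral_le_bergmanNorm` applies.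
  have hγ : -1 < s - 1 := by linarith
  have hγ' : -1 < s - 2 := by linarith
  have hm := mass_pos hγ
  have hfin := isFiniteMeasure_weightedArea hγ
  have hfin' := isFiniteMeasure_weightedArea hγ'
  set c : ℝ := (1 + (s - 1)) / (1 + (s - 2)) with hc
  have hchange : ∀ F : ℂ → ℝ≥0∞,
      ∫⁻ a, F a * ENNReal.ofReal (defect a ^ (-1 : ℝ)) ∂weightedArea (s - 1) =
        ENNReal.ofReal c * ∫⁻ a, F a ∂weightedArea (s - 2) := by
    intro F
    rw [lintegral_weightedArea_change hγ' hγ]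
    congr 1
    refine lintegral_congr_weightedArea fun a ha => ?_
    have hda := defect_pos ha
    rw [mul_comm (F a), ← mul_assoc, ← ENNReal.ofReal_mul (by positivity), ← Real.rpow_add hda,
      show s - 1 - (s - 2) + -1 = 0 by ring, Real.rpow_zero, ENNReal.ofReal_one, one_mul]
  refine ⟨(ENNReal.ofReal (mass (s - 1)))⁻¹ * (ENNReal.ofReal C₁ * (ENNReal.ofReal c * C₂)), ?_,
    fun f g hf hfd hfb hgd hg0 hgB hgb => ?_⟩
  · refine ENNReal.mul_ne_top ?_ (ENNReal.mul_ne_top (by simp) (ENNReal.mul_ne_top (by simp) hC₂))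
    simpa using hm
  obtain ⟨M, hM⟩ := hfb
  obtain ⟨N, hN⟩ := hgb
  have hfint : Integrable f (weightedArea (s - 1)) :=
    integrable_of_norm_le hγ hf.aestronglyMeasurable hM
  have hgm : AEStronglyMeasurable g μ := aestronglyMeasurable_of_continuousOn hμ hgd.continuousOn
  -- The sup bounds M and N of f and g are used only qualitatively and do not enter the final
  -- constant.
  have hint : Integrable (Function.uncurry fun a w => f a * kern (s + 1) w a * conj (g w))
      ((weightedArea (s - 1)).prod μ) := by
    have hmeas : AEStronglyMeasurable
        (Function.uncurry fun a w => f a * kern (s + 1) w a * conj (g w))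
        ((weightedArea (s - 1)).prod μ) := by
      refine AEStronglyMeasurable.mul (Measurable.aestronglyMeasurable ?_) ?_
      · exact (hf.measurable.comp measurable_fst).mul
          (measurable_kern_comp _ measurable_snd measurable_fst)
      · exact (Complex.continuous_conj.comp_aestronglyMeasurable hgm).comp_snd
    refine ⟨hmeas, ?_⟩
    rw [hasFiniteIntegral_iff_enorm, lintegral_prod _ hmeas.enorm]
    refine lt_of_le_of_lt (b := ∫⁻ a, ENNReal.ofReal M * ENNReal.ofReal N * ENNReal.ofReal C₃ *
      ENNReal.ofReal (defect a ^ (-1 : ℝ)) ∂weightedArea (s - 1)) ?_ ?_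
    · refine lintegral_mono_weightedArea fun a ha => ?_
      calc _ ≤ ∫⁻ w, ENNReal.ofReal M * ENNReal.ofReal N * absKernel (s + 1) a w ∂μ := by
            refine lintegral_mono_ae (hμ.mono fun w hw => ?_)
            have h1 : ‖f a‖ₑ ≤ ENNReal.ofReal M := by
              rw [← ofReal_norm]; exact ENNReal.ofReal_le_ofReal (hM a ha)
            have h2 : ‖conj (g w)‖ₑ ≤ ENNReal.ofReal N := by
              rw [← ofReal_norm, RCLike.norm_conj]; exact ENNReal.ofReal_le_ofReal (hN w hw)
            simp only [Function.uncurry, enorm_mul, enorm_kern]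
            rw [absKernel_comm]
            calc _ ≤ ENNReal.ofReal M * absKernel (s + 1) a w * ENNReal.ofReal N := by gcongr
              _ = _ := by ring
        _ = ENNReal.ofReal M * ENNReal.ofReal N * ∫⁻ w, absKernel (s + 1) a w ∂μ :=
            lintegral_const_mul' _ _ (ENNReal.mul_ne_top (by simp) (by simp))
        _ ≤ ENNReal.ofReal M * ENNReal.ofReal N * ENNReal.ofReal (C₃ * defect a ^ (-1 : ℝ)) := by
            gcongr
            exact hker a ha
        _ = _ := by rw [ENNReal.ofReal_mul hC₃.le]; ring
    · rw [hchange, lintegral_const]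
      refine ENNReal.mul_lt_top (by simp) (ENNReal.mul_lt_top ?_ (measure_lt_top _ _))
      exact ENNReal.mul_lt_top (ENNReal.mul_lt_top (by simp) (by simp)) (by simp)
  have hswap := integral_integral_swap hint
  have hR : ∫ w, ∫ a, f a * kern (s + 1) w a * conj (g w) ∂weightedArea (s - 1) ∂μ =
      mass (s - 1) * ∫ w, f w * conj (g w) ∂μ := by
    rw [← integral_const_mul]
    refine integral_congr_ae (hμ.mono fun w hw => ?_)
    simp only
    have := integral_mul_kern hγ hfd hfint hw
    rw [show 2 + (s - 1) = s + 1 by ring] at this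
    rw [integral_mul_const, this, mul_assoc]
  rw [hR] at hswap
  have hL : ‖∫ a, ∫ w, f a * kern (s + 1) w a * conj (g w) ∂μ ∂weightedArea (s - 1)‖ₑ ≤
      ENNReal.ofReal C₁ * (ENNReal.ofReal c * (C₂ * bergmanNorm p α f)) := by
    calc _ ≤ ∫⁻ a, ENNReal.ofReal C₁ * (‖f a‖ₑ * ENNReal.ofReal (defect a ^ (-1 : ℝ)))
          ∂weightedArea (s - 1) := by
          refine (enorm_integral_le_lintegral_enorm _).trans
            (lintegral_mono_weightedArea fun a ha => ?_)
          have h1 : ∫ w, f a * kern (s + 1) w a * conj (g w) ∂μ =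
              f a * conj (∫ w, g w * kern (s + 1) a w ∂μ) := by
            rw [← integral_conj, ← integral_const_mul]
            refine integral_congr_ae (hμ.mono fun w hw => ?_)
            simp only
            rw [map_mul, conj_kern _ ha hw]; ring
          have h2 := hbl g hgd hg0 hgB a ha
          rw [h1, enorm_mul]
          have h3 : ‖conj (∫ w, g w * kern (s + 1) a w ∂μ)‖ₑ ≤
              ENNReal.ofReal C₁ * ENNReal.ofReal (defect a ^ (-1 : ℝ)) := by
            rw [← ofReal_norm, RCLike.norm_conj, ← ENNReal.ofReal_mul hC₁.le]
            exact ENNReal.ofReal_le_ofReal h2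
          calc _ ≤ ‖f a‖ₑ * (ENNReal.ofReal C₁ * ENNReal.ofReal (defect a ^ (-1 : ℝ))) := by gcongr
            _ = _ := by ring
      _ ≤ _ := by
          rw [lintegral_const_mul' _ _ (by simp), hchange]
          gcongr
          exact hemb f hfd ⟨M, hM⟩
  rw [hswap, enorm_mul, ← ofReal_norm, Complex.norm_of_nonneg hm.le,
    ENNReal.mul_le_iff_le_inv (by simpa using hm) (by simp)] at hL
  refine hL.trans (le_of_eq ?_)
  ring

lemma exists_bound_eval (f : Polynomial ℂ) : ∃ M : ℝ, ∀ z ∈ unitDisk, ‖f.eval z‖ ≤ M := by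
  obtain ⟨M, hM⟩ := (isCompact_closedBall (0 : ℂ) 1).exists_bound_of_continuousOn
    f.continuous.continuousOn
  exact ⟨M, fun z hz => hM z (Metric.ball_subset_closedBall hz)⟩

/-- Sufficiency of the Carleson and logarithmic Bloch conditions. -/
theorem toeplitzBounded_of_isCarleson {μ : Measure ℂ} [IsFiniteMeasure μ]
    (hμ : ∀ᵐ w ∂μ, w ∈ unitDisk) {p α β : ℝ} (hp0 : 0 < p) (hp1 : p ≤ 1) (hα : -1 < α)
    (hβ : -1 < β) (hcar : IsCarleson μ (1 / p) 1 α)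
    (hlb : MemLogBloch 1 (toeplitz μ ((2 + α) / p - 2) fun _ => 1)) :
    ToeplitzBounded μ β p α 1 β := by
  obtain ⟨B, hB0, hbd⟩ := exists_bloch_bound_dilate hβ
  obtain ⟨C, hC, hpair⟩ := exists_enorm_integral_mul_conj_le hμ hp0 hp1 hα hcar hlb hB0
  have hfinβ := isFiniteMeasure_weightedArea hβ
  have hfinα := isFiniteMeasure_weightedArea hα
  lift C to ℝ≥0 using hC
  have key : ∀ f : Polynomial ℂ, bergmanNorm 1 β (toeplitz μ β fun w => f.eval w) ≤
      C * bergmanNorm p α fun w => f.eval w := by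
    intro f
    obtain ⟨M, hM⟩ := exists_bound_eval f
    set F := toeplitz μ β fun w => f.eval w with hF
    have hFd : DifferentiableOn ℂ F unitDisk :=
      differentiableOn_toeplitz hμ β f.continuous.measurable hM
    -- For r < 1 the function F(r·) extends continuously to the closed disk. Its L¹ norm is its
    -- pairing with its own sign φ, hence a pairing of f with a Bloch function, with constants
    -- independent of r.
    have hdil : ∀ r : ℝ, 0 ≤ r → r < 1 →
        ∫⁻ u, ‖F (r * u)‖ₑ ∂weightedArea β ≤ C * bergmanNorm p α fun w => f.eval w := by
      intro r hr0 hr1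
      have hcont : ContinuousOn (fun u : ℂ => F (r * u)) (Metric.closedBall 0 1) := by
        refine hFd.continuousOn.comp (by fun_prop) fun u hu => ?_
        rw [mem_unitDisk, norm_mul, Complex.norm_of_nonneg hr0]
        have : ‖u‖ ≤ 1 := by simpa using hu
        nlinarith [norm_nonneg u]
      obtain ⟨φ, hφ, hφ1, hsgn⟩ :=
        exists_measurable_sign (hcont.mono Metric.ball_subset_closedBall)
      obtain ⟨hgd, hg0, hgB, hgb⟩ := hbd φ hφ hφ1 r hr0 hr1
      have h1 := integral_mul_toeplitz hμ hβ f.continuous.measurable hM hφ hφ1 hr0 hr1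
      have h2 := hpair (fun w => f.eval w) _ f.continuous f.differentiable.differentiableOn
        ⟨M, hM⟩ hgd hg0 hgB hgb
      rw [← h1] at h2
      obtain ⟨N, hN⟩ := (isCompact_closedBall (0 : ℂ) 1).exists_bound_of_continuousOn hcont
      have hint : Integrable (fun u : ℂ => F (r * u)) (weightedArea β) :=
        integrable_of_norm_le hβ (aestronglyMeasurable_of_continuousOn (ae_mem_unitDisk β)
          (hcont.mono Metric.ball_subset_closedBall))
          fun z hz => hN z (Metric.ball_subset_closedBall hz)
      have h3 : ∫ u, conj (φ u) * F (r * u) ∂weightedArea β =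
          ((∫ u, ‖F (r * u)‖ ∂weightedArea β : ℝ) : ℂ) := by
        rw [← integral_complex_ofReal]
        exact integral_congr_ae ((ae_mem_unitDisk β).mono hsgn)
      rw [h3, ← ofReal_norm, Complex.norm_of_nonneg (integral_nonneg fun _ => norm_nonneg _),
        ofReal_integral_norm_eq_lintegral_enorm hint] at h2
      exact h2
    rw [bergmanNorm_one_eq]
    -- Fatou's lemma along r → 1 removes the dilation.
    obtain ⟨r, hrmono, hr, hrlim⟩ := exists_seq_strictMono_tendsto' (x := (1 : ℝ)) (y := 0) one_pos
    calc ∫⁻ u, ‖F u‖ₑ ∂weightedArea β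
        ≤ ∫⁻ u, liminf (fun n => ‖F (r n * u)‖ₑ) atTop ∂weightedArea β := by
          refine lintegral_mono_weightedArea fun u hu => ?_
          have h1 : Tendsto (fun n => (r n : ℂ) * u) atTop (𝓝 u) := by
            have := (Complex.continuous_ofReal.tendsto 1).comp hrlim
            simpa using this.mul_const u
          have h2 : Tendsto (fun n => ‖F (r n * u)‖ₑ) atTop (𝓝 ‖F u‖ₑ) :=
            ((hFd.continuousOn.continuousAt (Metric.isOpen_ball.mem_nhds hu)).enorm.tendsto).comp h1
          exact h2.liminf_eq.ge
      _ ≤ liminf (fun n => ∫⁻ u, ‖F (r n * u)‖ₑ ∂weightedArea β) atTop := by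
          refine lintegral_liminf_le' fun n => ?_
          refine (aestronglyMeasurable_of_continuousOn (ae_mem_unitDisk β) ?_).enorm
          exact hFd.continuousOn.comp (by fun_prop)
            fun u hu => ofReal_mul_mem (hr n).1.le (hr n).2.le hu
      _ ≤ _ := by
          refine liminf_le_of_frequently_le' (Frequently.of_forall fun n => ?_)
          exact hdil (r n) (hr n).1.le (hr n).2
  refine ⟨C, fun f => ⟨⟨?_, ?_⟩, key f⟩⟩
  · obtain ⟨M, hM⟩ := exists_bound_eval f
    exact differentiableOn_toeplitz hμ β f.continuous.measurable hM
  · refine (key f).trans_lt (ENNReal.mul_lt_top (by simp) ?_)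
    obtain ⟨M, hM⟩ := exists_bound_eval f
    have : MemLp (fun w => f.eval w) (ENNReal.ofReal p) (weightedArea α) :=
      MemLp.of_bound f.continuous.aestronglyMeasurable M ((ae_mem_unitDisk α).mono hM)
    exact this.2

/-! ### Necessity: the dual form of boundedness -/

lemma measurable_absKernel_comp {X : Type*} [MeasurableSpace X] (b : ℝ) {F G : X → ℂ}
    (hF : Measurable F) (hG : Measurable G) : Measurable fun x => absKernel b (F x) (G x) := by
  simp only [← enorm_kern]
  exact (measurable_kern_comp b hF hG).enorm

/-- Dilation is uniformly bounded in the weighted `L¹` norm. -/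
theorem exists_lintegral_dilate_le {β : ℝ} (hβ : -1 < β) :
    ∃ C : ℝ≥0∞, C ≠ ∞ ∧ ∀ F : ℂ → ℂ, DifferentiableOn ℂ F unitDisk →
      Integrable F (weightedArea β) → ∀ r : ℝ, 0 ≤ r → r < 1 →
      ∫⁻ u, ‖F (r * u)‖ₑ ∂weightedArea β ≤ C * ∫⁻ u, ‖F u‖ₑ ∂weightedArea β := by
  obtain ⟨C, hC, hFR⟩ := lintegral_absKernel_le hβ one_pos
  -- F(rw) is reproduced with weight β+1 and the factor r is moved to the other variable of the
  -- kernel. Integrating in w against weight β gives O(1/d(rz)) ≤ O(1/d(z)), which brings the weight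
  -- back to β.
  have hβ' : -1 < β + 1 := by linarith
  have hm := mass_pos hβ'
  have hfin := isFiniteMeasure_weightedArea hβ
  have hfin' := isFiniteMeasure_weightedArea hβ'
  set c : ℝ := (1 + (β + 1)) / (1 + β) with hc
  refine ⟨(ENNReal.ofReal (mass (β + 1)))⁻¹ * (ENNReal.ofReal C * ENNReal.ofReal c), ?_,
    fun F hd hi r hr0 hr1 => ?_⟩
  · refine ENNReal.mul_ne_top ?_ (ENNReal.mul_ne_top (by simp) (by simp))
    simpa using hm
  have hmF : ∀ γ, AEStronglyMeasurable F (weightedArea γ) := fun γ =>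
    aestronglyMeasurable_of_continuousOn (ae_mem_unitDisk γ) hd.continuousOn
  have hi' : Integrable F (weightedArea (β + 1)) := by
    refine ⟨hmF _, ?_⟩
    rw [hasFiniteIntegral_iff_enorm, lintegral_weightedArea_change hβ hβ']
    refine ENNReal.mul_lt_top (by simp) (lt_of_le_of_lt ?_ hi.2)
    refine lintegral_mono_weightedArea fun z hz => ?_
    refine mul_le_of_le_one_left' ?_
    rw [ENNReal.ofReal_le_one]
    exact Real.rpow_le_one (defect_pos hz).le (defect_le_one z) (by linarith)
  have hpt : ∀ w ∈ unitDisk, ‖F (r * w)‖ₑ ≤ (ENNReal.ofReal (mass (β + 1)))⁻¹ *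
      ∫⁻ z, ‖F z‖ₑ * absKernel (2 + β + 1) (r * z) w ∂weightedArea (β + 1) := by
    intro w hw
    have h1 := integral_mul_kern hβ' hd hi' (ofReal_mul_mem hr0 hr1.le hw)
    rw [← ENNReal.mul_le_iff_le_inv (by simpa using hm) (by simp),
      ← Complex.norm_of_nonneg hm.le, ofReal_norm, ← enorm_mul, ← h1]
    refine (enorm_integral_le_lintegral_enorm _).trans (le_of_eq ?_)
    refine lintegral_congr fun z => ?_
    rw [enorm_mul, kern_ofReal_mul, enorm_kern, absKernel_comm, ← add_assoc 2 β 1]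
  calc ∫⁻ w, ‖F (r * w)‖ₑ ∂weightedArea β
      ≤ ∫⁻ w, (ENNReal.ofReal (mass (β + 1)))⁻¹ *
        ∫⁻ z, ‖F z‖ₑ * absKernel (2 + β + 1) (r * z) w ∂weightedArea (β + 1) ∂weightedArea β :=
        lintegral_mono_weightedArea hpt
    _ = (ENNReal.ofReal (mass (β + 1)))⁻¹ * ∫⁻ z, ‖F z‖ₑ *
        ∫⁻ w, absKernel (2 + β + 1) (r * z) w ∂weightedArea β ∂weightedArea (β + 1) := by
        rw [lintegral_const_mul' _ _ (by simpa using hm), lintegral_lintegral_swap]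
        · congr 1
          exact lintegral_congr fun z => lintegral_const_mul' _ _ (by simp)
        · refine AEMeasurable.mul (hmF (β + 1)).enorm.comp_snd (Measurable.aemeasurable ?_)
          exact measurable_absKernel_comp _ (by fun_prop) measurable_fst
    _ ≤ (ENNReal.ofReal (mass (β + 1)))⁻¹ * ∫⁻ z, ENNReal.ofReal C * (‖F z‖ₑ *
        ENNReal.ofReal (defect z ^ (-1 : ℝ))) ∂weightedArea (β + 1) := by
        refine mul_le_mul' le_rfl (lintegral_mono_weightedArea fun z hz => ?_)
        have h1 := hFR _ (ofReal_mul_mem hr0 hr1.le hz)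
        have hdz := defect_pos hz
        have h3 : defect z ≤ defect (r * z) := by
          unfold defect
          rw [norm_mul, Complex.norm_of_nonneg hr0, mul_pow]
          have hr2 : r ^ 2 ≤ 1 := pow_le_one₀ hr0 hr1.le
          nlinarith [mul_le_mul_of_nonneg_right hr2 (sq_nonneg ‖z‖)]
        calc _ ≤ ‖F z‖ₑ * ENNReal.ofReal (C * defect z ^ (-1 : ℝ)) := by
              refine mul_le_mul' le_rfl (h1.trans (ENNReal.ofReal_le_ofReal ?_))
              refine mul_le_mul_of_nonneg_left ?_ hC.le
              exact Real.rpow_le_rpow_of_nonpos hdz h3 (by norm_num)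
          _ = _ := by rw [ENNReal.ofReal_mul hC.le]; ring
    _ = _ := by
        rw [lintegral_const_mul' _ _ (by simp), lintegral_weightedArea_change hβ hβ']
        rw [mul_assoc, mul_assoc]
        congr 3
        refine lintegral_congr_weightedArea fun z hz => ?_
        have hdz := defect_pos hz
        rw [mul_comm ‖F z‖ₑ, ← mul_assoc, ← ENNReal.ofReal_mul (by positivity),
          ← Real.rpow_add hdz, show β + 1 - β + -1 = 0 by ring, Real.rpow_zero, ENNReal.ofReal_one,
          one_mul]

/-- Boundedness of the Toeplitz operator, in dual form, on polynomials. -/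
theorem ToeplitzBounded.exists_enorm_integral_le {μ : Measure ℂ} [IsFiniteMeasure μ]
    (hμ : ∀ᵐ w ∂μ, w ∈ unitDisk) {p α β : ℝ} (hβ : -1 < β) (h : ToeplitzBounded μ β p α 1 β) :
    ∃ C : ℝ≥0∞, C ≠ ∞ ∧ ∀ f : Polynomial ℂ, ∀ φ : ℂ → ℂ, Measurable φ → (∀ z, ‖φ z‖ ≤ 1) →
      ∀ r : ℝ, 0 ≤ r → r < 1 →
      ‖∫ w, f.eval w * conj (bergmanProj β φ (r * w)) ∂μ‖ₑ ≤
        C * bergmanNorm p α fun w => f.eval w := by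
  obtain ⟨C₁, hC₁⟩ := h
  obtain ⟨C₂, hC₂, hdil⟩ := exists_lintegral_dilate_le hβ
  refine ⟨C₂ * C₁, ENNReal.mul_ne_top hC₂ (by simp), fun f φ hφ hφ1 r hr0 hr1 => ?_⟩
  obtain ⟨M, hM⟩ := exists_bound_eval f
  obtain ⟨⟨hd, hlt⟩, hle⟩ := hC₁ f
  rw [bergmanNorm_one_eq] at hlt hle
  rw [← integral_mul_toeplitz hμ hβ f.continuous.measurable hM hφ hφ1 hr0 hr1, mul_assoc]
  refine (enorm_integral_le_lintegral_enorm _).trans ?_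
  refine le_trans (lintegral_mono fun u => ?_) ((hdil _ hd ⟨aestronglyMeasurable_of_continuousOn
    (ae_mem_unitDisk β) hd.continuousOn, hlt⟩ r hr0 hr1).trans (mul_le_mul' le_rfl hle))
  rw [enorm_mul]
  refine mul_le_of_le_one_left' ?_
  rw [← ofReal_norm, RCLike.norm_conj, ENNReal.ofReal_le_one]
  exact hφ1 u

/-- Functions analytic on a larger disk are uniform limits of polynomials on the unit disk. -/
lemma exists_polynomial_near {f : ℂ → ℂ} {R : ℝ} (hR : 1 < R)
    (hf : DifferentiableOn ℂ f (Metric.ball 0 R)) {ε : ℝ} (hε : 0 < ε) :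
    ∃ P : Polynomial ℂ, ∀ w ∈ unitDisk, ‖P.eval w - f w‖ ≤ ε := by
  -- On a disk of radius S > 1 the Taylor series converges uniformly over the unit disk, so a
  -- partial sum serves as P.
  obtain ⟨S, hS1, hSR⟩ := exists_between hR
  lift S to ℝ≥0 using by linarith
  have hps := (hf.mono (Metric.closedBall_subset_ball hSR)).hasFPowerSeriesOnBall
    (show 0 < S by exact_mod_cast (zero_lt_one.trans hS1))
  have hu := hps.tendstoUniformlyOn (r' := 1) (by exact_mod_cast hS1)
  rw [Metric.tendstoUniformlyOn_iff] at hu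
  obtain ⟨n, hn⟩ := (hu ε hε).exists
  refine ⟨∑ k ∈ Finset.range n, Polynomial.monomial k ((cauchyPowerSeries f 0 S).coeff k),
    fun w hw => ?_⟩
  have h1 := (hn w (by simpa using hw)).le
  rw [dist_eq_norm, norm_sub_rev, zero_add] at h1
  refine le_of_eq_of_le (congrArg (fun x => ‖x - f w‖) ?_) h1
  rw [Polynomial.eval_finsetSum, FormalMultilinearSeries.partialSum]
  refine Finset.sum_congr rfl fun k _ => ?_
  rw [Polynomial.eval_monomial, FormalMultilinearSeries.apply_eq_pow_smul_coeff, smul_eq_mul,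
    mul_comm]

/-- Boundedness of the Toeplitz operator, in dual form, on functions analytic beyond the disk. -/
theorem ToeplitzBounded.exists_enorm_integral_le_of_ball {μ : Measure ℂ} [IsFiniteMeasure μ]
    (hμ : ∀ᵐ w ∂μ, w ∈ unitDisk) {p α β : ℝ} (hα : -1 < α) (hβ : -1 < β)
    (h : ToeplitzBounded μ β p α 1 β) :
    ∃ C : ℝ≥0∞, C ≠ ∞ ∧ ∀ f : ℂ → ℂ, ∀ R : ℝ, 1 < R → DifferentiableOn ℂ f (Metric.ball 0 R) →
      ∀ φ : ℂ → ℂ, Measurable φ → (∀ z, ‖φ z‖ ≤ 1) → ∀ r : ℝ, 0 ≤ r → r < 1 →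
      ‖∫ w, f w * conj (bergmanProj β φ (r * w)) ∂μ‖ₑ ≤ C * bergmanNorm p α f := by
  obtain ⟨C, hC, hpol⟩ := h.exists_enorm_integral_le hμ hβ
  obtain ⟨B, hB0, hbd⟩ := exists_bloch_bound_dilate hβ
  have hfinα := isFiniteMeasure_weightedArea hα
  set q := ENNReal.ofReal p with hq
  -- For p < 1 only a quasi-norm is available; `LpAddConst` is the constant in its triangle
  -- inequality.
  have hA := ENNReal.LpAddConst_lt_top q
  set A := ENNReal.LpAddConst q with hAdef
  refine ⟨C * A, ENNReal.mul_ne_top hC hA.ne, fun f R hR hf φ hφ hφ1 r hr0 hr1 => ?_⟩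
  obtain ⟨hgd, -, -, N, hN⟩ := hbd φ hφ hφ1 r hr0 hr1
  set g : ℂ → ℂ := fun w => bergmanProj β φ (r * w) with hg
  have hgm : AEStronglyMeasurable (fun w => conj (g w)) μ :=
    Complex.continuous_conj.comp_aestronglyMeasurable
      (aestronglyMeasurable_of_continuousOn hμ hgd.continuousOn)
  have hfc : ContinuousOn f unitDisk :=
    hf.continuousOn.mono (Metric.ball_subset_ball hR.le)
  have hN0 : 0 ≤ N := (norm_nonneg _).trans (hN 0 zero_mem_unitDisk)
  -- K collects the approximation errors. It depends on φ and r through N, which is harmless because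
  -- ε → 0 with these fixed.
  set K : ℝ≥0∞ := C * A * weightedArea α Set.univ ^ q.toReal⁻¹ +
    ENNReal.ofReal N * μ Set.univ with hK
  have hKtop : K ≠ ∞ := by
    refine ENNReal.add_ne_top.2 ⟨ENNReal.mul_ne_top (ENNReal.mul_ne_top hC hA.ne) ?_,
      ENNReal.mul_ne_top (by simp) (measure_ne_top _ _)⟩
    exact ENNReal.rpow_ne_top_of_nonneg (by simp) (measure_ne_top _ _)
  have hbound : ∀ ε : ℝ, 0 < ε → ‖∫ w, f w * conj (g w) ∂μ‖ₑ ≤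
      C * A * bergmanNorm p α f + K * ENNReal.ofReal ε := by
    intro ε hε
    obtain ⟨P, hP⟩ := exists_polynomial_near hR hf hε
    have hgconj : ∀ᵐ w ∂μ, ‖conj (g w)‖ ≤ N := hμ.mono fun w hw => by
      rw [RCLike.norm_conj]; exact hN w hw
    have hPint : Integrable (fun w => P.eval w * conj (g w)) μ := by
      obtain ⟨M, hM⟩ := exists_bound_eval P
      exact (Integrable.of_bound P.continuous.aestronglyMeasurable M (hμ.mono hM)).mul_bdd
        hgm hgconj
    have hDint : Integrable (fun w => (P.eval w - f w) * conj (g w)) μ :=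
      (Integrable.of_bound (P.continuous.aestronglyMeasurable.sub
        (aestronglyMeasurable_of_continuousOn hμ hfc)) ε (hμ.mono hP)).mul_bdd hgm hgconj
    have hsplit : ∫ w, f w * conj (g w) ∂μ =
        ∫ w, P.eval w * conj (g w) ∂μ - ∫ w, (P.eval w - f w) * conj (g w) ∂μ := by
      rw [← integral_sub hPint hDint]
      congr 1; ext w; ring
    have h1 : ‖∫ w, (P.eval w - f w) * conj (g w) ∂μ‖ₑ ≤
        ENNReal.ofReal N * μ Set.univ * ENNReal.ofReal ε := by
      have := norm_integral_le_of_norm_le_const (C := ε * N) (μ := μ)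
        (f := fun w => (P.eval w - f w) * conj (g w)) ((hμ.and hgconj).mono fun w hw => by
          rw [norm_mul]
          have := hP w hw.1
          have := hw.2
          gcongr)
      rw [← ofReal_norm]
      refine (ENNReal.ofReal_le_ofReal this).trans (le_of_eq ?_)
      rw [ENNReal.ofReal_mul (by positivity), ENNReal.ofReal_mul hε.le, ofReal_measureReal]
      ring
    have h2 : bergmanNorm p α (fun w => P.eval w) ≤
        A * (bergmanNorm p α f + weightedArea α Set.univ ^ q.toReal⁻¹ * ENNReal.ofReal ε) := by
      have hfm : AEStronglyMeasurable f (weightedArea α) :=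
        aestronglyMeasurable_of_continuousOn (ae_mem_unitDisk α) hfc
      have hPf : (fun w => P.eval w) = f + fun w => P.eval w - f w := by ext w; simp
      unfold bergmanNorm
      rw [hPf]
      refine (eLpNorm_add_le' hfm (P.continuous.aestronglyMeasurable.sub hfm) q).trans ?_
      gcongr
      exact eLpNorm_le_of_ae_bound ((ae_mem_unitDisk α).mono hP)
    rw [hsplit]
    calc _ ≤ ‖∫ w, P.eval w * conj (g w) ∂μ‖ₑ + ‖∫ w, (P.eval w - f w) * conj (g w) ∂μ‖ₑ :=
          enorm_sub_le
      _ ≤ C * (A * (bergmanNorm p α f + weightedArea α Set.univ ^ q.toReal⁻¹ *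
          ENNReal.ofReal ε)) + ENNReal.ofReal N * μ Set.univ * ENNReal.ofReal ε := by
          gcongr
          exact (hpol P φ hφ hφ1 r hr0 hr1).trans (mul_le_mul' le_rfl h2)
      _ = _ := by rw [hK]; ring
  have hlim : Tendsto (fun ε : ℝ => C * A * bergmanNorm p α f + K * ENNReal.ofReal ε) (𝓝[>] 0)
      (𝓝 (C * A * bergmanNorm p α f + K * ENNReal.ofReal 0)) := by
    refine Tendsto.const_add _ (ENNReal.Tendsto.const_mul ?_ (Or.inr hKtop))
    exact (ENNReal.continuous_ofReal.tendsto 0).mono_left nhdsWithin_le_nhds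
  rw [ENNReal.ofReal_zero, mul_zero, add_zero] at hlim
  exact ge_of_tendsto hlim (eventually_mem_nhdsWithin.mono hbound)

/-! ### Necessity: the Carleson condition -/

/-- The dual form of boundedness tested on kernels. -/
theorem ToeplitzBounded.exists_norm_integral_kern_le {μ : Measure ℂ} [IsFiniteMeasure μ]
    (hμ : ∀ᵐ w ∂μ, w ∈ unitDisk) {p α β : ℝ} (hp0 : 0 < p) (hα : -1 < α)
    (hβ : -1 < β) (h : ToeplitzBounded μ β p α 1 β) :
    ∃ C : ℝ, 0 < C ∧ ∀ q : Polynomial ℂ, (∀ z ∈ unitDisk, ‖q.eval z‖ ≤ 1) → ∀ b ∈ unitDisk,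
      ∀ φ : ℂ → ℂ, Measurable φ → (∀ z, ‖φ z‖ ≤ 1) → ∀ r : ℝ, 0 ≤ r → r < 1 →
      ‖∫ w, q.eval w * kern ((2 + α) / p + 1) w b * conj (bergmanProj β φ (r * w)) ∂μ‖ ≤
        C * defect b ^ (-1 : ℝ) := by
  obtain ⟨C₁, hC₁, hmain⟩ := h.exists_enorm_integral_le_of_ball hμ hα hβ
  -- Here t = p because p(s+1) = 2+α+p, so the test kernel has A^p norm O(1/d(b)). The polynomial
  -- factor `q` is taken to be 1 for the Carleson condition and X for the logarithmic one.
  obtain ⟨C₂, hC₂, hFR⟩ := lintegral_absKernel_le hα hp0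
  lift C₁ to ℝ≥0 using hC₁
  refine ⟨C₁ * C₂ ^ (1 / p) + 1, by positivity, fun q hq b hb φ hφ hφ1 r hr0 hr1 => ?_⟩
  have hdb := defect_pos hb
  set s := (2 + α) / p with hs
  have hb1 := mem_unitDisk.1 hb
  -- The radius 2/(1+|b|) exceeds 1, yet |w b̄| < 1 still holds there, so the principal power stays
  -- analytic.
  have hdiff : DifferentiableOn ℂ (fun w => q.eval w * kern (s + 1) w b)
      (Metric.ball 0 (2 / (1 + ‖b‖))) := by
    intro w hw
    refine DifferentiableAt.differentiableWithinAt ?_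
    refine q.differentiable.differentiableAt.mul ?_
    have hw1 : ‖w * conj b‖ < 1 := by
      rw [norm_mul_conj]
      have h1 : ‖w‖ < 2 / (1 + ‖b‖) := by simpa using hw
      rw [lt_div_iff₀ (by positivity)] at h1
      nlinarith [norm_nonneg w, norm_nonneg b]
    have hsl := one_sub_mem_slitPlane hw1
    unfold kern
    refine DifferentiableAt.div (by fun_prop) (DifferentiableAt.cpow_const (by fun_prop) hsl) ?_
    rw [← norm_pos_iff, Complex.norm_cpow_real]
    have := norm_pos_iff.2 (Complex.slitPlane_ne_zero hsl)
    positivity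
  have h1 := hmain _ _ (by rw [lt_div_iff₀ (by positivity)]; linarith) hdiff φ hφ hφ1 r hr0 hr1
  have h2 : bergmanNorm p α (fun w => q.eval w * kern (s + 1) w b) ≤
      ENNReal.ofReal (C₂ ^ (1 / p) * defect b ^ (-1 : ℝ)) := by
    rw [bergmanNorm_eq hp0]
    have h3 : ∫⁻ w, ‖q.eval w * kern (s + 1) w b‖ₑ ^ p ∂weightedArea α ≤
        ENNReal.ofReal (C₂ * defect b ^ (-p)) := by
      refine le_trans (lintegral_mono_weightedArea fun w hw => ?_) (hFR b hb)
      have h4 : absKernel (2 + α + p) b w = absKernel (s + 1) w b ^ p := by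
        rw [absKernel_rpow _ hp0.le, absKernel_comm]
        congr 1; rw [hs]; field_simp
      rw [h4, enorm_mul, enorm_kern]
      gcongr
      refine mul_le_of_le_one_left' ?_
      rw [← ofReal_norm, ENNReal.ofReal_le_one]
      exact hq w hw
    calc _ ≤ ENNReal.ofReal (C₂ * defect b ^ (-p)) ^ (1 / p) := by gcongr
      _ = _ := by
        rw [ENNReal.ofReal_rpow_of_pos (by positivity),
          Real.mul_rpow (by positivity) (by positivity), ← Real.rpow_mul hdb.le]
        congr 3; field_simp
  have h3 := h1.trans (mul_le_mul' le_rfl h2)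
  rw [← ENNReal.ofReal_coe_nnreal, ← ENNReal.ofReal_mul (by positivity), ← ofReal_norm,
    ENNReal.ofReal_le_ofReal_iff (by positivity)] at h3
  refine h3.trans ?_
  have : 0 < defect b ^ (-1 : ℝ) := by positivity
  nlinarith

/-- Boundedness of the Toeplitz operator forces a kernel estimate for the measure. -/
theorem ToeplitzBounded.exists_lintegral_absKernel_le {μ : Measure ℂ} [IsFiniteMeasure μ]
    (hμ : ∀ᵐ w ∂μ, w ∈ unitDisk) {p α β : ℝ} (hp0 : 0 < p) (hp1 : p ≤ 1) (hα : -1 < α)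
    (hβ : -1 < β) (h : ToeplitzBounded μ β p α 1 β) :
    ∃ C : ℝ, 0 < C ∧ ∀ b ∈ unitDisk, ∫⁻ w, absKernel (2 * ((2 + α) / p + 1)) b w ∂μ ≤
      ENNReal.ofReal (C * defect b ^ (-((2 + α) / p + 2))) := by
  obtain ⟨C, hC, hmain⟩ := h.exists_norm_integral_kern_le hμ hp0 hα hβ
  have hs1 := one_lt_exponent hp0 hp1 hα
  set s := (2 + α) / p with hs
  have hm := mass_pos hβ
  refine ⟨2 ^ (s + 1) * C / mass β, by positivity, fun b hb => ?_⟩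
  have hdb := defect_pos hb
  have hb1 : 0 < 1 - ‖b‖ := by linarith [mem_unitDisk.1 hb]
  set k : ℂ → ℂ := fun u => kern (s + 1) u b with hk
  set κ : ℝ := (1 - ‖b‖) ^ (s + 1) with hκ
  have hκ0 : 0 < κ := by positivity
  have hkd : DifferentiableOn ℂ k unitDisk := differentiableOn_kern (s + 1) hb
  have hkle : ∀ u ∈ unitDisk, ‖k u‖ ≤ κ⁻¹ := by
    intro u hu
    simp only [hk]
    rw [norm_kern, norm_one_sub_mul_conj_comm, hκ, ← Real.rpow_neg hb1.le]
    exact Real.rpow_le_rpow_of_nonpos hb1 (one_sub_norm_le_norm (mem_unitDisk.1 hu).le)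
      (by linarith)
  -- The normalizing factor κ makes |φ| ≤ 1. Being analytic on the disk, φ is reproduced by the
  -- projection, so the pairing of k with it is a multiple of ∫ k(w) conj(k(rw)) dμ.
  set φ : ℂ → ℂ := fun u => κ * unitDisk.indicator k u with hφdef
  have hφ : Measurable φ := (measurable_indicator_of_continuousOn hkd.continuousOn).const_mul _
  have hφ1 : ∀ u, ‖φ u‖ ≤ 1 := by
    intro u
    simp only [hφdef]
    rw [norm_mul, Complex.norm_of_nonneg hκ0.le]
    by_cases hu : u ∈ unitDisk
    · rw [Set.indicator_of_mem hu]
      calc κ * ‖k u‖ ≤ κ * κ⁻¹ := by gcongr; exact hkle u hu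
        _ = 1 := mul_inv_cancel₀ hκ0.ne'
    · rw [Set.indicator_of_notMem hu]; simp
  have hkint : Integrable k (weightedArea β) := integrable_of_norm_le hβ
    (aestronglyMeasurable_of_continuousOn (ae_mem_unitDisk β) hkd.continuousOn) hkle
  have hproj : ∀ w ∈ unitDisk, bergmanProj β φ w = κ * (mass β * k w) := by
    intro w hw
    rw [← integral_mul_kern hβ hkd hkint hw, ← integral_const_mul, bergmanProj]
    refine integral_congr_ae ((ae_mem_unitDisk β).mono fun u hu => ?_)
    simp only [hφdef, Set.indicator_of_mem hu]; ring
  obtain ⟨r, -, hr, hrlim⟩ := exists_seq_strictMono_tendsto' (x := (1 : ℝ)) (y := 0) one_pos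
  have hbd : ∀ n, ‖∫ w, k w * conj (k (r n * w)) ∂μ‖ ≤ C * defect b ^ (-1 : ℝ) / (κ * mass β) := by
    intro n
    have h1 := hmain 1 (by simp) b hb φ hφ hφ1 (r n) (hr n).1.le (hr n).2
    have h2 : ∫ w, (1 : Polynomial ℂ).eval w * kern (s + 1) w b *
        conj (bergmanProj β φ (r n * w)) ∂μ =
        ((κ * mass β : ℝ) : ℂ) * ∫ w, k w * conj (k (r n * w)) ∂μ := by
      rw [← integral_const_mul]
      refine integral_congr_ae (hμ.mono fun w hw => ?_)
      simp only
      rw [hproj _ (ofReal_mul_mem (hr n).1.le (hr n).2.le hw)]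
      simp only [Polynomial.eval_one, map_mul, Complex.conj_ofReal, hk]
      push_cast; ring
    rw [h2, norm_mul, Complex.norm_of_nonneg (by positivity)] at h1
    rw [le_div_iff₀ (by positivity)]; linarith
  -- As r → 1 the integrand becomes |k|², so a bound on the modulus of a pairing turns into a bound
  -- on a positive integral. The factor 1/κ is comparable to d(b)^(-(s+1)), whence the exponent s+2.
  have hlim : Tendsto (fun n => ∫ w, k w * conj (k (r n * w)) ∂μ) atTop
      (𝓝 (∫ w, k w * conj (k w) ∂μ)) := by
    refine tendsto_integral_of_dominated_convergence (fun _ => κ⁻¹ * κ⁻¹) (fun n => ?_)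
      (integrable_const _) (fun n => ?_) ?_
    · refine aestronglyMeasurable_of_continuousOn hμ (hkd.continuousOn.mul ?_)
      refine Complex.continuous_conj.comp_continuousOn (hkd.continuousOn.comp (by fun_prop) ?_)
      exact fun w hw => ofReal_mul_mem (hr n).1.le (hr n).2.le hw
    · filter_upwards [hμ] with w hw
      rw [norm_mul, RCLike.norm_conj]
      have h1 := hkle w hw
      have h2 := hkle _ (ofReal_mul_mem (hr n).1.le (hr n).2.le hw)
      gcongr
    · filter_upwards [hμ] with w hw
      have h1 : Tendsto (fun n => (r n : ℂ) * w) atTop (𝓝 w) := by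
        have := (Complex.continuous_ofReal.tendsto 1).comp hrlim
        simpa using this.mul_const w
      have h2 : ContinuousAt k w := hkd.continuousOn.continuousAt (Metric.isOpen_ball.mem_nhds hw)
      exact ((Complex.continuous_conj.tendsto _).comp (h2.tendsto.comp h1)).const_mul (k w)
  have hle := le_of_tendsto hlim.norm (Eventually.of_forall hbd)
  have hsq : ∫ w, k w * conj (k w) ∂μ = ((∫ w, ‖k w * conj (k w)‖ ∂μ : ℝ) : ℂ) := by
    rw [← integral_complex_ofReal]
    refine integral_congr_ae (ae_of_all _ fun w => ?_)
    simp only [norm_mul, RCLike.norm_conj]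
    rw [Complex.mul_conj, Complex.normSq_eq_norm_sq]; push_cast; ring
  have hint : Integrable (fun w => k w * conj (k w)) μ := by
    refine Integrable.of_bound (C := κ⁻¹ * κ⁻¹) (aestronglyMeasurable_of_continuousOn hμ
      (hkd.continuousOn.mul (Complex.continuous_conj.comp_continuousOn hkd.continuousOn))) ?_
    filter_upwards [hμ] with w hw
    rw [norm_mul, RCLike.norm_conj]
    have h1 := hkle w hw
    gcongr
  rw [hsq, Complex.norm_of_nonneg (integral_nonneg fun _ => norm_nonneg _)] at hle
  have hle2 := ENNReal.ofReal_le_ofReal hle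
  rw [ofReal_integral_norm_eq_lintegral_enorm hint] at hle2
  have h3 : ∀ w, ‖k w * conj (k w)‖ₑ = absKernel (2 * (s + 1)) b w := by
    intro w
    rw [enorm_mul, ← ofReal_norm (conj (k w)), RCLike.norm_conj, ofReal_norm, hk, enorm_kern,
      ← sq, ← ENNReal.rpow_natCast, absKernel_rpow _ (by positivity), absKernel_comm]
    norm_num
  simp only [h3] at hle2
  refine hle2.trans (ENNReal.ofReal_le_ofReal ?_)
  have h4 : κ⁻¹ ≤ 2 ^ (s + 1) * defect b ^ (-(s + 1)) := by
    have hle : defect b / 2 ≤ 1 - ‖b‖ := by linarith [defect_le_two_mul hb]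
    rw [hκ, ← Real.rpow_neg hb1.le]
    refine (Real.rpow_le_rpow_of_nonpos (by positivity) hle (by linarith)).trans (le_of_eq ?_)
    rw [Real.div_rpow hdb.le (by norm_num), Real.rpow_neg (x := 2) (by norm_num), div_inv_eq_mul,
      mul_comm]
  calc C * defect b ^ (-1 : ℝ) / (κ * mass β) = C / mass β * defect b ^ (-1 : ℝ) * κ⁻¹ := by
        field_simp
    _ ≤ C / mass β * defect b ^ (-1 : ℝ) * (2 ^ (s + 1) * defect b ^ (-(s + 1))) := by gcongr
    _ = 2 ^ (s + 1) * C / mass β * (defect b ^ (-1 : ℝ) * defect b ^ (-(s + 1))) := by ring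
    _ = _ := by
        rw [← Real.rpow_add hdb]
        congr 2; ring

/-- Jensen's inequality for the power `q ≥ 1` with respect to a finite density. -/
lemma lintegral_mul_rpow_le {X : Type*} [MeasurableSpace X] {ν : Measure X} {q : ℝ} (hq : 1 ≤ q)
    {h k : X → ℝ≥0∞} (hh : Measurable h) (hk : Measurable k) :
    (∫⁻ x, h x * k x ∂ν) ^ q ≤ (∫⁻ x, h x ∂ν) ^ (q - 1) * ∫⁻ x, h x * k x ^ q ∂ν := by
  have hq0 : 0 < q := by linarith
  have h1 := eLpNorm'_le_eLpNorm'_mul_rpow_measure_univ (μ := ν.withDensity h) (f := k) one_pos hq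
    hk.aestronglyMeasurable
  simp only [eLpNorm', enorm_eq_self, ENNReal.rpow_one, div_one, withDensity_apply _ .univ,
    Measure.restrict_univ] at h1
  rw [lintegral_withDensity_eq_lintegral_mul _ hh hk,
    lintegral_withDensity_eq_lintegral_mul _ hh (hk.pow_const q)] at h1
  have h2 := ENNReal.rpow_le_rpow h1 hq0.le
  rw [ENNReal.mul_rpow_of_nonneg _ _ hq0.le, ← ENNReal.rpow_mul, ← ENNReal.rpow_mul,
    one_div_mul_cancel hq0.ne', ENNReal.rpow_one,
    show (1 - 1 / q) * q = q - 1 by field_simp, mul_comm (∫⁻ _, _ ∂ν)] at h2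
  exact h2

/-- A kernel estimate implies the Carleson embedding. -/
theorem isCarleson_of_lintegral_absKernel_le {μ : Measure ℂ} [IsFiniteMeasure μ]
    (hμ : ∀ᵐ w ∂μ, w ∈ unitDisk) {p α : ℝ} (hp0 : 0 < p) (hp1 : p ≤ 1) (hα : -1 < α)
    (h : ∃ C : ℝ, 0 < C ∧ ∀ b ∈ unitDisk, ∫⁻ w, absKernel (2 * ((2 + α) / p + 1)) b w ∂μ ≤
      ENNReal.ofReal (C * defect b ^ (-((2 + α) / p + 2)))) :
    IsCarleson μ (1 / p) 1 α := by
  obtain ⟨C, hC, hker⟩ := h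
  set s := (2 + α) / p with hs
  set q := 1 / p with hq
  have hq0 : 0 < q := by positivity
  have hq1 : 1 ≤ q := by rw [hq, le_div_iff₀ hp0]; linarith
  -- Chosen so that q(2+γ) = 2(s+1) and q(γ-α) = s+2, the two exponents in the kernel hypothesis.
  set γ : ℝ := 2 * α + 2 + 2 * p with hγdef
  have hγ : -1 < γ := by linarith
  have hm := mass_pos hγ
  have hfin := isFiniteMeasure_weightedArea hα
  set c : ℝ := (1 + γ) / (1 + α) with hc
  have hc0 : 0 < c := div_pos (by linarith) (by linarith)
  set A : ℝ := (c / mass γ) ^ q * C with hA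
  have hA0 : 0 < A := by positivity
  refine ⟨Real.toNNReal (A ^ p), Real.toNNReal_pos.2 (by positivity), fun f hf => ?_⟩
  obtain ⟨hd, hlt⟩ := hf
  rw [bergmanNorm_one_eq] at hlt ⊢
  set X := ∫⁻ z, ‖f z‖ₑ ∂weightedArea α with hX
  set F : ℂ → ℂ := unitDisk.indicator f with hF
  have hFm : Measurable F := measurable_indicator_of_continuousOn hd.continuousOn
  have hFf : ∀ z ∈ unitDisk, F z = f z := fun z hz => Set.indicator_of_mem hz f
  have hXF : ∫⁻ z, ‖F z‖ₑ ∂weightedArea α = X :=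
    lintegral_congr_weightedArea fun z hz => by rw [hFf z hz]
  have hint : Integrable f (weightedArea γ) := by
    refine ⟨aestronglyMeasurable_of_continuousOn (ae_mem_unitDisk γ) hd.continuousOn, ?_⟩
    rw [hasFiniteIntegral_iff_enorm, lintegral_weightedArea_change hα hγ]
    refine ENNReal.mul_lt_top (by simp) (lt_of_le_of_lt ?_ hlt)
    refine lintegral_mono_weightedArea fun z hz => mul_le_of_le_one_left' ?_
    rw [ENNReal.ofReal_le_one]
    exact Real.rpow_le_one (defect_pos hz).le (defect_le_one z) (by linarith)
  set k : ℂ → ℂ → ℝ≥0∞ := fun w z =>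
    ENNReal.ofReal (defect z ^ (γ - α)) * absKernel (2 + γ) w z with hk
  have hkm : Measurable (Function.uncurry k) := by
    refine Measurable.mul ?_ (measurable_absKernel_comp _ measurable_fst measurable_snd)
    have := continuous_defect.measurable
    fun_prop
  have hkm' : ∀ w, Measurable (k w) := fun w => hkm.of_uncurry_left
  have hpt : ∀ w ∈ unitDisk, ‖f w‖ₑ ≤ ENNReal.ofReal (c / mass γ) *
      ∫⁻ z, ‖F z‖ₑ * k w z ∂weightedArea α := by
    intro w hw
    have h1 := integral_mul_kern hγ hd hint hw
    have h2 : ENNReal.ofReal (mass γ) * ‖f w‖ₑ ≤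
        ENNReal.ofReal c * ∫⁻ z, ‖F z‖ₑ * k w z ∂weightedArea α := by
      rw [← Complex.norm_of_nonneg hm.le, ofReal_norm, ← enorm_mul, ← h1]
      refine (enorm_integral_le_lintegral_enorm _).trans (le_of_eq ?_)
      rw [lintegral_weightedArea_change hα hγ]
      congr 1
      refine lintegral_congr_weightedArea fun z hz => ?_
      rw [hFf z hz, enorm_mul, enorm_kern, hk]; ring
    rw [ENNReal.mul_le_iff_le_inv (by simpa using hm) (by simp)] at h2
    refine h2.trans (le_of_eq ?_)
    rw [ENNReal.ofReal_div_of_pos hm, div_eq_mul_inv]; ring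
  -- Jensen's inequality with density |f| moves the power q onto the kernel. After Fubini the inner
  -- μ-integral is bounded by C uniformly in z.
  have hmain : ∫⁻ w, ‖f w‖ₑ ^ q ∂μ ≤ ENNReal.ofReal A * X ^ q := by
    calc _ ≤ ∫⁻ w, ENNReal.ofReal ((c / mass γ) ^ q) * (X ^ (q - 1) *
          ∫⁻ z, ‖F z‖ₑ * k w z ^ q ∂weightedArea α) ∂μ := by
          refine lintegral_mono_ae (hμ.mono fun w hw => ?_)
          calc _ ≤ (ENNReal.ofReal (c / mass γ) * ∫⁻ z, ‖F z‖ₑ * k w z ∂weightedArea α) ^ q := by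
                gcongr
                exact hpt w hw
            _ ≤ _ := by
                rw [ENNReal.mul_rpow_of_nonneg _ _ hq0.le,
                  ENNReal.ofReal_rpow_of_pos (by positivity), ← hXF]
                gcongr
                exact lintegral_mul_rpow_le hq1 hFm.enorm (hkm' w)
      _ = ENNReal.ofReal ((c / mass γ) ^ q) * (X ^ (q - 1) *
          ∫⁻ z, ‖F z‖ₑ * ∫⁻ w, k w z ^ q ∂μ ∂weightedArea α) := by
          rw [lintegral_const_mul' _ _ (by simp), lintegral_const_mul' _ _
            (ENNReal.rpow_ne_top_of_nonneg (by linarith) hlt.ne), lintegral_lintegral_swap]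
          · congr 2
            exact lintegral_congr fun z => lintegral_const_mul' _ _ (by simp)
          · exact ((hFm.comp measurable_snd).enorm.mul (hkm.pow_const q)).aemeasurable
      _ ≤ ENNReal.ofReal ((c / mass γ) ^ q) * (X ^ (q - 1) *
          ∫⁻ z, ‖F z‖ₑ * ENNReal.ofReal C ∂weightedArea α) := by
          refine mul_le_mul' le_rfl (mul_le_mul' le_rfl
            (lintegral_mono_weightedArea fun z hz => mul_le_mul' le_rfl ?_))
          have hdz := defect_pos hz
          have h1 : ∀ w, k w z ^ q = ENNReal.ofReal (defect z ^ (s + 2)) *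
              absKernel (2 * (s + 1)) z w := by
            intro w
            simp only [hk]
            rw [ENNReal.mul_rpow_of_nonneg _ _ hq0.le, absKernel_rpow _ hq0.le, absKernel_comm,
              ENNReal.ofReal_rpow_of_pos (by positivity), ← Real.rpow_mul hdz.le]
            have e1 : (γ - α) * q = s + 2 := by rw [hγdef, hq, hs]; field_simp; ring
            have e2 : q * (2 + γ) = 2 * (s + 1) := by rw [hγdef, hq, hs]; field_simp; ring
            rw [e1, e2]
          simp only [h1]
          rw [lintegral_const_mul' _ _ (by simp)]
          calc _ ≤ ENNReal.ofReal (defect z ^ (s + 2)) *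
                ENNReal.ofReal (C * defect z ^ (-(s + 2))) := by
                gcongr
                exact hker z hz
            _ = _ := by
                rw [← ENNReal.ofReal_mul (by positivity), mul_left_comm, ← Real.rpow_add hdz,
                  add_neg_cancel, Real.rpow_zero, mul_one]
      _ = _ := by
          rw [lintegral_mul_const' _ _ (by simp), hXF, hA, ENNReal.ofReal_mul (by positivity)]
          have hXq : X ^ q = X ^ (q - 1) * X := by
            nth_rewrite 3 [← ENNReal.rpow_one X]
            rw [← ENNReal.rpow_add_of_nonneg _ _ (by linarith) zero_le_one, sub_add_cancel]
          rw [hXq]; ring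
  rw [eLpNorm_eq_lintegral_rpow_enorm_toReal (by simpa using hq0) (by simp),
    ENNReal.toReal_ofReal hq0.le]
  have h3 := ENNReal.rpow_le_rpow hmain (z := 1 / q) (by positivity)
  refine h3.trans (le_of_eq ?_)
  rw [ENNReal.mul_rpow_of_nonneg _ _ (by positivity), ← ENNReal.rpow_mul,
    mul_one_div_cancel hq0.ne', ENNReal.rpow_one, ENNReal.ofReal_rpow_of_pos hA0,
    show 1 / q = p by rw [hq]; field_simp, ENNReal.ofReal]

/-! ### Necessity: the logarithmic Bloch condition -/

/-- Necessity of the logarithmic Bloch condition. -/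
theorem ToeplitzBounded.memLogBloch {μ : Measure ℂ} [IsFiniteMeasure μ]
    (hμ : ∀ᵐ w ∂μ, w ∈ unitDisk) {p α β : ℝ} (hp0 : 0 < p) (hp1 : p ≤ 1) (hα : -1 < α)
    (hβ : -1 < β) (h : ToeplitzBounded μ β p α 1 β) (hcar : IsCarleson μ (1 / p) 1 α) :
    MemLogBloch 1 (toeplitz μ ((2 + α) / p - 2) fun _ => 1) := by
  obtain ⟨B, hB0, hbd⟩ := exists_bloch_bound_dilate hβ
  obtain ⟨C₁, hC₁, hpair⟩ := h.exists_norm_integral_kern_le hμ hp0 hα hβ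
  obtain ⟨C₂, hC₂, hosc⟩ := hcar.exists_lintegral_bloch_le hp0 hp1 hα hB0
  obtain ⟨C₃, hC₃, hker⟩ := hcar.exists_lintegral_absKernel_le hp0 hα one_pos
  obtain ⟨c, hc, hlow⟩ := log_le_lintegral_absKernel hβ
  have hs1 := one_lt_exponent hp0 hp1 hα
  set s := (2 + α) / p with hs
  refine ⟨differentiableOn_toeplitz hμ (s - 2) measurable_const (M := 1) (by simp), ?_⟩
  refine ⟨s * (Real.log 2 * C₃ + ((C₁ + C₂) / c + C₃)), ?_⟩
  rintro _ ⟨z, hz, rfl⟩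
  have hdz := defect_pos hz
  have hz1 := mem_unitDisk.1 hz
  -- The factor w makes conj I, times s, exactly the derivative of T_μ(1) at z.
  set I := ∫ w, w * kern (s + 1) w z ∂μ with hI
  have hconj : ∫ w, conj w * kern (s + 1) z w ∂μ = conj I := by
    rw [hI, ← integral_conj]
    refine integral_congr_ae (hμ.mono fun w hw => ?_)
    simp only
    rw [map_mul, conj_kern _ hw hz]
  have hmz : AEStronglyMeasurable (fun w => kern (s + 1) w z) μ :=
    (measurable_kern_comp _ measurable_id measurable_const).aestronglyMeasurable
  have hint : Integrable (fun w => w * kern (s + 1) w z) μ := by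
    refine Integrable.of_bound (C := 1 * ((1 - ‖z‖) ^ (-|s + 1|) * 2 ^ |s + 1|))
      (measurable_id.aestronglyMeasurable.mul hmz) (hμ.mono fun w hw => ?_)
    have h1 := norm_kern_le (s + 1) hz hw
    rw [norm_kern, norm_one_sub_mul_conj_comm, ← norm_kern] at h1
    rw [norm_mul]
    have := (mem_unitDisk.1 hw).le
    gcongr
  -- This bound without the logarithm later absorbs the additive constants -1 and log 2.
  have hIle : ‖I‖ ≤ C₃ * defect z ^ (-1 : ℝ) := by
    refine norm_integral_le_of_lintegral_le (by positivity) ((lintegral_mono_ae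
      (hμ.mono fun w hw => ?_)).trans (hker z hz))
    rw [enorm_mul, enorm_kern, absKernel_comm]
    refine mul_le_of_le_one_left' ?_
    rw [← ofReal_norm, ENNReal.ofReal_le_one]
    exact (mem_unitDisk.1 hw).le
  have hr : ∀ r ∈ Set.Ioo (0 : ℝ) 1,
      c * (Real.log (1 / (1 - r * ‖z‖)) - 1) * ‖I‖ ≤ (C₁ + C₂) * defect z ^ (-1 : ℝ) := by
    intro r hr
    have hζ := ofReal_mul_mem hr.1.le hr.2.le hz
    set ζ : ℂ := r * z with hζdef
    -- With φ the conjugate of the sign of the kernel at ζ = rz, the dilated projection g satisfies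
    -- g(z) = ∫ |`kern (2 + β) ζ`|, which is bounded below by the logarithm.
    obtain ⟨φ₀, hφ₀, hφ₀1, hsgn⟩ := exists_measurable_sign (continuousOn_kern (2 + β) hζ)
    have hφ : Measurable fun u => conj (φ₀ u) := Complex.continuous_conj.measurable.comp hφ₀
    have hφ1 : ∀ u, ‖conj (φ₀ u)‖ ≤ 1 := fun u => by rw [RCLike.norm_conj]; exact hφ₀1 u
    obtain ⟨hgd, -, hgB, N, hN⟩ := hbd _ hφ hφ1 r hr.1.le hr.2
    have hp := hpair Polynomial.X (fun w hw => by
      rw [Polynomial.eval_X]; exact (mem_unitDisk.1 hw).le) z hz _ hφ hφ1 r hr.1.le hr.2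
    simp only [Polynomial.eval_X] at hp
    set g : ℂ → ℂ := fun w => bergmanProj β (fun u => conj (φ₀ u)) (r * w) with hg
    have hfinβ := isFiniteMeasure_weightedArea hβ
    have hgz : g z = ((∫ u, ‖kern (2 + β) ζ u‖ ∂weightedArea β : ℝ) : ℂ) := by
      rw [← integral_complex_ofReal]
      exact integral_congr_ae ((ae_mem_unitDisk β).mono hsgn)
    have hlow' : c * (Real.log (1 / (1 - r * ‖z‖)) - 1) ≤ ‖g z‖ := by
      have h1 := hlow ζ hζ
      simp only [← enorm_kern] at h1
      rw [← ofReal_integral_norm_eq_lintegral_enorm (integrable_kern (ae_mem_unitDisk β) _ hζ),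
        ENNReal.ofReal_le_ofReal_iff (integral_nonneg fun _ => norm_nonneg _)] at h1
      rw [hgz, Complex.norm_of_nonneg (integral_nonneg fun _ => norm_nonneg _)]
      rwa [hζdef, norm_mul, Complex.norm_of_nonneg hr.1.le] at h1
    have hgm : AEStronglyMeasurable g μ :=
      aestronglyMeasurable_of_continuousOn hμ hgd.continuousOn
    have hi1 : Integrable (fun w => w * kern (s + 1) w z * conj (g w)) μ :=
      hint.mul_bdd (c := N) (Complex.continuous_conj.comp_aestronglyMeasurable hgm)
        (hμ.mono fun w hw => by rw [RCLike.norm_conj]; exact hN w hw)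
    -- Freezing g at z: the first integral is a pairing bounded by `hpair`, the second an
    -- oscillation bounded by the Carleson condition already proved.
    have hsplit : I * conj (g z) = ∫ w, w * kern (s + 1) w z * conj (g w) ∂μ -
        ∫ w, w * kern (s + 1) w z * conj (g w - g z) ∂μ := by
      have hi2 : Integrable (fun w => w * kern (s + 1) w z * conj (g w - g z)) μ := by
        have := hi1.sub (hint.mul_const (conj (g z)))
        refine this.congr (ae_of_all _ fun w => ?_)
        simp only [Pi.sub_apply, map_sub]; ring
      rw [← integral_sub hi1 hi2, hI, ← integral_mul_const]
      congr 1; ext w; rw [map_sub]; ring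
    have hdiff : ‖∫ w, w * kern (s + 1) w z * conj (g w - g z) ∂μ‖ ≤
        C₂ * defect z ^ (-1 : ℝ) := by
      refine norm_integral_le_of_lintegral_le (by positivity) ((lintegral_mono_ae
        (hμ.mono fun w hw => ?_)).trans (hosc g hgd hgB z hz))
      rw [enorm_mul, enorm_mul, enorm_kern, absKernel_comm, ← ofReal_norm (conj (g w - g z)),
        RCLike.norm_conj, ofReal_norm, mul_comm]
      refine mul_le_mul' le_rfl (mul_le_of_le_one_left' ?_)
      rw [← ofReal_norm, ENNReal.ofReal_le_one]
      exact (mem_unitDisk.1 hw).le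
    calc _ ≤ ‖g z‖ * ‖I‖ := by gcongr
      _ = ‖I * conj (g z)‖ := by rw [norm_mul, RCLike.norm_conj, mul_comm]
      _ ≤ C₁ * defect z ^ (-1 : ℝ) + C₂ * defect z ^ (-1 : ℝ) := by
          rw [hsplit]; exact (norm_sub_le _ _).trans (add_le_add hp hdiff)
      _ = _ := by ring
  -- C₁ and C₂ do not depend on r, so r → 1 replaces 1 - r|z| by 1 - |z|.
  have hlim : c * (Real.log (1 / (1 - ‖z‖)) - 1) * ‖I‖ ≤ (C₁ + C₂) * defect z ^ (-1 : ℝ) := by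
    have h0 : 1 - ‖z‖ ≠ 0 := by linarith
    have hcont : ContinuousAt
        (fun r : ℝ => c * (Real.log (1 / (1 - r * ‖z‖)) - 1) * ‖I‖) 1 := by
      have h1 : ContinuousAt (fun r : ℝ => 1 - r * ‖z‖) 1 := by fun_prop
      have h2 : ContinuousAt (fun r : ℝ => Real.log (1 / (1 - r * ‖z‖))) 1 :=
        (continuousAt_const.div h1 (by simpa using h0)).log (by simpa using h0)
      fun_prop
    have ht := hcont.tendsto.mono_left (nhdsWithin_le_nhds (s := Set.Iio 1))
    simp only [one_mul] at ht
    refine le_of_tendsto ht ?_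
    filter_upwards [Ioo_mem_nhdsLT (zero_lt_one (α := ℝ))] with r hr'
    exact hr r hr'
  have hlog : Real.log (2 / defect z) ≤ Real.log 2 + Real.log (1 / (1 - ‖z‖)) := by
    rw [← Real.log_mul (by norm_num) (by simp; linarith)]
    refine Real.log_le_log (by positivity) ?_
    rw [mul_one_div]
    have := one_sub_norm_le_defect hz
    have : 0 < 1 - ‖z‖ := by linarith
    gcongr
  have h1 : Real.log (1 / (1 - ‖z‖)) * ‖I‖ ≤ ((C₁ + C₂) / c + C₃) * defect z ^ (-1 : ℝ) := by
    have h2 : (Real.log (1 / (1 - ‖z‖)) - 1) * ‖I‖ ≤ (C₁ + C₂) / c * defect z ^ (-1 : ℝ) := by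
      rw [div_mul_eq_mul_div, le_div_iff₀ hc]; linarith
    linarith
  have h2 : Real.log (2 / defect z) * ‖I‖ ≤
      (Real.log 2 * C₃ + ((C₁ + C₂) / c + C₃)) * defect z ^ (-1 : ℝ) := by
    have hlog2 := Real.log_nonneg (one_le_two (α := ℝ))
    calc _ ≤ (Real.log 2 + Real.log (1 / (1 - ‖z‖))) * ‖I‖ := by gcongr
      _ = Real.log 2 * ‖I‖ + Real.log (1 / (1 - ‖z‖)) * ‖I‖ := by ring
      _ ≤ Real.log 2 * (C₃ * defect z ^ (-1 : ℝ)) +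
          ((C₁ + C₂) / c + C₃) * defect z ^ (-1 : ℝ) := by gcongr
      _ = _ := by ring
  simp only [Real.rpow_one, (hasDerivAt_toeplitz_one hμ s hz).deriv, norm_mul, hconj,
    RCLike.norm_conj, Complex.norm_of_nonneg (by linarith : 0 ≤ s)]
  rw [Real.rpow_neg_one] at h2
  change defect z * Real.log (2 / defect z) * (s * ‖I‖) ≤ _
  calc _ = s * (defect z * (Real.log (2 / defect z) * ‖I‖)) := by ring
    _ ≤ s * (defect z * ((Real.log 2 * C₃ + ((C₁ + C₂) / c + C₃)) * (defect z)⁻¹)) := by gcongr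
    _ = _ := by field_simp

end BergmanToeplitz

theorem theorem1p1 (μ : MeasureTheory.Measure ℂ) [MeasureTheory.IsFiniteMeasure μ]
    (hμ : μ (BergmanToeplitz.unitDisk)ᶜ = 0)
    (p α β : ℝ) (hp0 : 0 < p) (hp1 : p ≤ 1) (hα : -1 < α) (hβ : -1 < β) :
    BergmanToeplitz.ToeplitzBounded μ β p α 1 β ↔
      BergmanToeplitz.IsCarleson μ (1 / p) 1 α ∧
        BergmanToeplitz.MemLogBloch 1
          (BergmanToeplitz.toeplitz μ ((2 + α) / p - 2) fun _ => 1) := by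
  have hμ' : ∀ᵐ w ∂μ, w ∈ BergmanToeplitz.unitDisk := hμ
  constructor
  · intro h
    have hcar := BergmanToeplitz.isCarleson_of_lintegral_absKernel_le hμ' hp0 hp1 hα
      (h.exists_lintegral_absKernel_le hμ' hp0 hp1 hα hβ)
    exact ⟨hcar, h.memLogBloch hμ' hp0 hp1 hα hβ hcar⟩
  · rintro ⟨hcar, hlb⟩
    exact BergmanToeplitz.toeplitzBounded_of_isCarleson hμ' hp0 hp1 hα hβ hcar hlb
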